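/- Work in $\mathbb R^{1+3}$ with coordinates $(t,x)$, $x^0=t$, $r=|x|$, $s=\sqrt{t^2-r^2}$, $\partial_\alpha=\partial/\partial x^\alpha$ $(\alpha=0,\dots,3)$ and $\Box=\partial_t^2-\sum_{a=1}^3\partial_a^2$ (repeated indices are summed). Let $\mathcal K=\{t>r+1\}$, let $\mathcal K_{[2,s_1]}=\{(t,x)\in\mathcal K: 2\le s\le s_1\}$, let $\mathcal H_s=\{t=\sqrt{s^2+r^2}\}$, and for $f$ defined in $\mathcal K$ put $$\|f\|_{L^2(\mathcal H_s)}^2=\int_{\{x:(\sqrt{s^2+|x|^2},x)\in\mathcal K\}}\big|f(\sqrt{s^2+|x|^2},x)\big|^2dx .$$ Let $L_a=x^a\partial_t+t\partial_a$ $(a=1,2,3)$. For finite sequences $I=(i_1,\dots,i_k)$ in $\{0,1,2,3\}$ and $J=(j_1,\dots,j_l)$ in $\{1,2,3\}$ write $\partial^IL^J=\partial_{i_1}\cdots\partial_{i_k}L_{j_1}\cdots L_{j_l}$, $|I|=k$, $|J|=l$. With $\bar\partial_s=(s/t)\partial_t$, $\bar\partial_a=(x^a/t)\partial_t+\partial_a$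 and $Kv=s\bar\partial_sv+2x^a\bar\partial_av$, the (flat) conformal energy is $$E_{con}(s,v)=\big\|Kv+2v\big\|_{L^2(\mathcal H_s)}^2+\sum_{a=1}^3\big\|s\bar\partial_av\big\|^2_{L^2(\mathcal H_s)} .$$ Let $(Q^{\alpha\beta\gamma})$ be a constant null cubic form: $Q^{\alpha\beta\gamma}\xi_\alpha\xi_\beta\xi_\gamma=0$ whenever $\xi_0^2=\xi_1^2+\xi_2^2+\xi_3^2$. **Proposition.** Let $N\ge 9$ and $M>0$. There is a constant $C>0$, depending only on $N$, $Q$ and $M$, such that the following holds for all $C_1,\varepsilon>0$ with $C_1\varepsilon\le M$ and all $s_1>2$. Let $u$ be a solution of $$\Box u+Q^{\alpha\beta\gamma}\partial_\gamma u\,\partial_\alpha\partial_\beta u=0\quad\text{in }\mathcal K_{[2,s_1]},$$ of class $C^{N+2}$ in a neighbourhood of $\mathcal K_{[2,s_1]}$ and vanishing in $\mathcal K_{[2,s_1]}$ near the conical boundary $\{t=r+1\}$, and suppose that the bootstrap bound $$\sum_{|I|+|J|\le N}E_{con}(s,\partial^IL^Ju)^{1/2}\le C_1\varepsilon\qquad\text{for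 all }s\in[2,s_1]$$ holds. Then for all $I,J$ with $|I|+|J|\le N$ and all $s\in[2,s_1]$, $$\big\|s\,[\partial^IL^J,\,Q^{\alpha\beta\gamma}\partial_\gamma u\,\partial_\alpha\partial_\beta]u\big\|_{L^2(\mathcal H_s)}\le C\,(C_1\varepsilon)^2s^{-2},$$ where $[\partial^IL^J,Q^{\alpha\beta\gamma}\partial_\gamma u\,\partial_\alpha\partial_\beta]u=\partial^IL^J\big(Q^{\alpha\beta\gamma}\partial_\gamma u\,\partial_\alpha\partial_\beta u\big)-Q^{\alpha\beta\gamma}\partial_\gamma u\,\partial_\alpha\partial_\beta\,\partial^IL^Ju .$ -/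

import Mathlib

open MeasureTheory Filter Topology

noncomputable section

namespace HypWave

/-- The space `ℝ³` with its Euclidean norm. -/
abbrev Space : Type := EuclideanSpace ℝ (Fin 3)

/-- Points `(t, x)` of `ℝ^{1+3}`. -/
abbrev Spacetime : Type := ℝ × Space

/-- The canonical frame of `ℝ^{1+3}`: index `0` is the `t` direction and `a.succ` is the direction
of `xᵃ`. -/
def frame : Fin 4 → Spacetime :=
  Fin.cons (1, 0) fun a : Fin 3 => (0, EuclideanSpace.single a 1)

/-- The region `𝒦 = {(t, x) : t > |x| + 1}`. -/
def coneK : Set Spacetime := {p | ‖p.2‖ + 1 < p.1}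

/-- The conical boundary `{(t, x) : t = |x| + 1}` of `𝒦`. -/
def coneBoundary : Set Spacetime := {p | p.1 = ‖p.2‖ + 1}

/-- The hyperbolic time `s = √(t² - |x|²)`. -/
def hypTime (p : Spacetime) : ℝ := √(p.1 ^ 2 - ‖p.2‖ ^ 2)

/-- The hyperbolic slab `𝒦_{[s₀, s₁]}`: the points of `𝒦` of hyperbolic time in `[s₀, s₁]`. -/
def slab (s₀ s₁ : ℝ) : Set Spacetime := {p | p ∈ coneK ∧ s₀ ≤ hypTime p ∧ hypTime p ≤ s₁}

/-- The partial derivative `∂_α f`. -/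
def partialD (α : Fin 4) (f : Spacetime → ℝ) : Spacetime → ℝ :=
  fun p => fderiv ℝ f p (frame α)

/-- The Lorentz boost `L_a f = xᵃ ∂_t f + t ∂_a f`. -/
def boost (a : Fin 3) (f : Spacetime → ℝ) : Spacetime → ℝ :=
  fun p => p.2 a * partialD 0 f p + p.1 * partialD a.succ f p

/-- `∂^I = ∂_{i₁} ∂_{i₂} ⋯ ∂_{iₖ}` for `I = [i₁, …, iₖ]`. -/
def partialPow (I : List (Fin 4)) (f : Spacetime → ℝ) : Spacetime → ℝ := I.foldr partialD f

/-- `L^J = L_{j₁} L_{j₂} ⋯ L_{jₗ}` for `J = [j₁, …, jₗ]`. -/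
def boostPow (J : List (Fin 3)) (f : Spacetime → ℝ) : Spacetime → ℝ := J.foldr boost f

/-- The operator `∂^I L^J`. -/
def opIJ (I : List (Fin 4)) (J : List (Fin 3)) (f : Spacetime → ℝ) : Spacetime → ℝ :=
  partialPow I (boostPow J f)

/-- The wave operator `□ = ∂_t ∂_t - ∑ₐ ∂_a ∂_a`. -/
def box (f : Spacetime → ℝ) : Spacetime → ℝ :=
  fun p => partialD 0 (partialD 0 f) p - ∑ a : Fin 3, partialD a.succ (partialD a.succ f) p

/-- A constant cubic form is null if `Q^{αβγ} ξ_α ξ_β ξ_γ = 0` for all `ξ` with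
`ξ₀² = ξ₁² + ξ₂² + ξ₃²`. -/
def IsNullCubic (Q : Fin 4 → Fin 4 → Fin 4 → ℝ) : Prop :=
  ∀ ξ : Fin 4 → ℝ, ξ 0 ^ 2 - ∑ a : Fin 3, ξ a.succ ^ 2 = 0 →
    ∑ α, ∑ β, ∑ γ, Q α β γ * ξ α * ξ β * ξ γ = 0

/-- The second order operator `v ↦ Q^{αβγ} ∂_γ u ∂_α ∂_β v`. -/
def quasiOp (Q : Fin 4 → Fin 4 → Fin 4 → ℝ) (u v : Spacetime → ℝ) : Spacetime → ℝ :=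
  fun p => ∑ α, ∑ β, ∑ γ, Q α β γ * partialD γ u p * partialD α (partialD β v) p

/-- The commutator `[∂^I L^J, Q^{αβγ} ∂_γ u ∂_α ∂_β] u`. -/
def quasiCommutator (Q : Fin 4 → Fin 4 → Fin 4 → ℝ) (I : List (Fin 4)) (J : List (Fin 3))
    (u : Spacetime → ℝ) : Spacetime → ℝ :=
  fun p => opIJ I J (quasiOp Q u u) p - quasiOp Q u (opIJ I J u) p

/-- The hyperbolic frame vector `∂̄_s = (s/t) ∂_t`. -/
def hypDs (f : Spacetime → ℝ) : Spacetime → ℝ :=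
  fun p => hypTime p / p.1 * partialD 0 f p

/-- The hyperbolic frame vectors `∂̄_a = (xᵃ/t) ∂_t + ∂_a`. -/
def hypDa (a : Fin 3) (f : Spacetime → ℝ) : Spacetime → ℝ :=
  fun p => p.2 a / p.1 * partialD 0 f p + partialD a.succ f p

/-- The vector field `K = s ∂̄_s + 2 xᵃ ∂̄_a`. -/
def confK (f : Spacetime → ℝ) : Spacetime → ℝ :=
  fun p => hypTime p * hypDs f p + 2 * ∑ a : Fin 3, p.2 a * hypDa a f p

/-- The point `(√(s² + |x|²), x)` of the hyperboloid `ℋ_s`. -/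
def hypPoint (s : ℝ) (x : Space) : Spacetime := (√(s ^ 2 + ‖x‖ ^ 2), x)

/-- The part of `ℋ_s` inside `𝒦`, parametrized by `x`. The functions considered live in `𝒦`, so
all integrals over `ℋ_s` are taken over this part. -/
def hypSlice (s : ℝ) : Set Space := {x | hypPoint s x ∈ coneK}

/-- `‖f‖_{L²(ℋ_s)}`, with respect to `dx` (not the induced volume), for `f` defined in `𝒦`. -/
def hypL2Norm (s : ℝ) (f : Spacetime → ℝ) : ENNReal :=
  eLpNorm (fun x => f (hypPoint s x)) 2 (volume.restrict (hypSlice s))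

/-- The flat conformal energy
`E_con(s, f) = ∫_{ℋ_s} ((K f + 2 f)² + ∑ₐ (s ∂̄_a f)²) dx`. -/
def confEnergy (s : ℝ) (f : Spacetime → ℝ) : ENNReal :=
  ∫⁻ x in hypSlice s, ENNReal.ofReal
    ((confK f (hypPoint s x) + 2 * f (hypPoint s x)) ^ 2 +
      ∑ a : Fin 3, (s * hypDa a f (hypPoint s x)) ^ 2)

/-- `∑_{|I| + |J| ≤ N} E_con(s, ∂^I L^J u)^{1/2}`. -/
def energySum (N : ℕ) (s : ℝ) (u : Spacetime → ℝ) : ENNReal :=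
  ∑ k ∈ Finset.range (N + 1), ∑ l ∈ Finset.range (N + 1 - k),
    ∑ I : Fin k → Fin 4, ∑ J : Fin l → Fin 3,
      confEnergy s (opIJ (List.ofFn I) (List.ofFn J) u) ^ (1 / 2 : ℝ)

/-- `u` vanishes near the conical boundary of the slab `𝒦_{[s₀, s₁]}`. -/
def VanishesNearCone (s₀ s₁ : ℝ) (u : Spacetime → ℝ) : Prop :=
  ∀ p ∈ coneBoundary, s₀ ≤ hypTime p → hypTime p ≤ s₁ → ∀ᶠ q in 𝓝[slab s₀ s₁] p, u q = 0

/-- `u` is a (classical, `C^k`) solution of `□u + Q^{αβγ} ∂_γ u ∂_α ∂_β u = 0` in the slab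
`𝒦_{[s₀, s₁]}`, vanishing near the conical boundary. -/
structure IsSolutionOnSlab (Q : Fin 4 → Fin 4 → Fin 4 → ℝ) (k : ℕ) (s₀ s₁ : ℝ)
    (u : Spacetime → ℝ) : Prop where
  regular : ∀ p ∈ slab s₀ s₁, ContDiffAt ℝ k u p
  vanishes : VanishesNearCone s₀ s₁ u
  equation : ∀ p ∈ slab s₀ s₁, box u p + quasiOp Q u u p = 0

end HypWave

end

/-!
The estimate is obtained on each hyperboloid `ℋ_s` separately, by combining the algebra of null
forms with `L²` and pointwise bounds for the derivatives of `u`. Put `A = C₁ ε`; on `ℋ_s` one has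
`s² = t² - |x|²`, and `t ≤ s²` inside the cone `𝒦`.

*What the energy controls.* The boosts are tangent to the hyperboloids: `t⁻¹ L_a` restricts to the
coordinate derivative `∂_a` of the function `x ↦ v (√(s² + |x|²), x)`, which is compactly supported
because `u` vanishes near the conical boundary (`fderiv_restrictHyp`). The conformal energy of `v`
contains `‖(s/t) L_a v‖²`. The Hardy inequality (`hardy_inequality`) then bounds `‖(s/t) v‖`, and
`K v + 2 v` yields the transversal derivative: `‖s (s/t)² ∂_α v‖` is bounded as well
(`hypSq_partialD_le`).

*Pointwise decay.* If `W` is such a restriction, the mixed derivative `∂₁∂₂∂₃ (W²)` integrated over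
the part of an octant beyond `x` gives `W(x)²`; the weight `t` only grows there, so no cutoff is
needed (`sobolev_hyp`). Applied to `∂_α v` and to `L_a v`, with `v` of order at most `N - 3`, it
gives `|∂_α v| ≤ C A s⁻²` and `|L_a v| ≤ C A t⁻¹` (`exists_decay`). Products of boosts and
translations in any order are linear combinations of operators `∂^I L^J` (`exists_word_eq`).

*Null structure.* Translations and boosts act on `Q^{αβγ} ∂_γ u ∂_α∂_β v` by the Leibniz rule, up to
the infinitesimal boost of `Q`, which is again a null form (`isNullCubic_derivForm`,
`derivation_quasiOp`). The commutator is thus a combination of null forms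
`Q^{αβγ} ∂_γ Z u ∂_α∂_β Z' u` of total order at most `N` in which `Z'` has order less than `N`
(`exists_word_quasiOp`). Writing `∂_α = n_α ∂_t + t⁻¹ L_α` with `n = (1, -x/t)`, the coefficient of
`∂_t Z u ∂_t∂_t Z' u` is `Q(n, n, n) = O(s²/t²)`, and every other term contains a factor `t⁻¹ L_a`
(`abs_quasiOp_le`). With the shorter of the two words estimated pointwise and the other one in `L²`,
every term is at most `C A² s⁻³` in `L²(ℋ_s)`, that is `C A² s⁻²` after multiplication by `s`.
-/

namespace HypWave

/-! ### Calculus of the frame derivatives and the boosts -/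

/-- The admissible first order derivations: `∂_α` for `Sum.inl α` and `L_a` for `Sum.inr a`. -/
noncomputable def derivation : Fin 4 ⊕ Fin 3 → (Spacetime → ℝ) → Spacetime → ℝ :=
  Sum.elim partialD boost

/-- The composition of derivations along a word in the letters `∂_α` and `L_a`, in any order. -/
noncomputable def word (K : List (Fin 4 ⊕ Fin 3)) (f : Spacetime → ℝ) : Spacetime → ℝ :=
  K.foldr derivation f

@[simp] lemma word_nil (f : Spacetime → ℝ) : word [] f = f := rfl

@[simp] lemma word_cons (k : Fin 4 ⊕ Fin 3) (K : List (Fin 4 ⊕ Fin 3)) (f : Spacetime → ℝ) :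
    word (k :: K) f = derivation k (word K f) := rfl

@[simp] lemma derivation_inl (α : Fin 4) : derivation (Sum.inl α) = partialD α := rfl

@[simp] lemma derivation_inr (a : Fin 3) : derivation (Sum.inr a) = boost a := rfl

lemma word_append (K K' : List (Fin 4 ⊕ Fin 3)) (f : Spacetime → ℝ) :
    word (K ++ K') f = word K (word K' f) := by
  simp [word, List.foldr_append]

lemma opIJ_eq_word (I : List (Fin 4)) (J : List (Fin 3)) (f : Spacetime → ℝ) :
    opIJ I J f = word (I.map Sum.inl ++ J.map Sum.inr) f := by
  rw [word_append, opIJ]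
  have h1 : ∀ g, partialPow I g = word (I.map Sum.inl) g := by
    intro g
    induction I with
    | nil => rfl
    | cons α I ih => simp [partialPow, ← ih]
  have h2 : boostPow J f = word (J.map Sum.inr) f := by
    induction J with
    | nil => rfl
    | cons α I ih => simp [boostPow, ← ih]
  rw [h1, h2]

lemma frame_zero : frame 0 = (1, 0) := rfl

lemma frame_succ (a : Fin 3) : frame a.succ = (0, EuclideanSpace.single a 1) := rfl

lemma contDiff_time {n : WithTop ℕ∞} : ContDiff ℝ n (fun p : Spacetime => p.1) := contDiff_fst

lemma contDiff_coord {n : WithTop ℕ∞} (a : Fin 3) :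
    ContDiff ℝ n (fun p : Spacetime => p.2 a) :=
  ((EuclideanSpace.proj a : Space →L[ℝ] ℝ).contDiff).comp contDiff_snd

lemma partialD_time (α : Fin 4) (p : Spacetime) :
    partialD α (fun q => q.1) p = if α = 0 then 1 else 0 := by
  have : fderiv ℝ (fun q : Spacetime => q.1) p = ContinuousLinearMap.fst ℝ ℝ Space :=
    (ContinuousLinearMap.fst ℝ ℝ Space).fderiv
  rw [partialD, this]
  refine Fin.cases ?_ (fun a => ?_) α
  · simp [frame_zero]
  · simp [frame_succ, Fin.succ_ne_zero]

lemma partialD_coord (α : Fin 4) (a : Fin 3) (p : Spacetime) :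
    partialD α (fun q => q.2 a) p = if α = a.succ then 1 else 0 := by
  have : fderiv ℝ (fun q : Spacetime => q.2 a) p =
      (EuclideanSpace.proj a : Space →L[ℝ] ℝ).comp (ContinuousLinearMap.snd ℝ ℝ Space) :=
    ((EuclideanSpace.proj a : Space →L[ℝ] ℝ).comp (ContinuousLinearMap.snd ℝ ℝ Space)).fderiv
  rw [partialD, this]
  refine Fin.cases ?_ (fun b => ?_) α
  · simp [frame_zero, (Fin.succ_ne_zero a).symm]
  · simp [frame_succ, Fin.succ_inj, eq_comm]

lemma partialD_add (α : Fin 4) {f g : Spacetime → ℝ} {p : Spacetime}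
    (hf : DifferentiableAt ℝ f p) (hg : DifferentiableAt ℝ g p) :
    partialD α (fun q => f q + g q) p = partialD α f p + partialD α g p := by
  simp [partialD, fderiv_fun_add hf hg]

lemma partialD_mul (α : Fin 4) {f g : Spacetime → ℝ} {p : Spacetime}
    (hf : DifferentiableAt ℝ f p) (hg : DifferentiableAt ℝ g p) :
    partialD α (fun q => f q * g q) p = partialD α f p * g p + f p * partialD α g p := by
  simp [partialD, fderiv_fun_mul hf hg]; ring

lemma partialD_const_mul (α : Fin 4) (c : ℝ) {f : Spacetime → ℝ} {p : Spacetime}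
    (hf : DifferentiableAt ℝ f p) :
    partialD α (fun q => c * f q) p = c * partialD α f p := by
  simp [partialD, fderiv_const_mul hf c]

lemma partialD_sum {ι : Type*} (S : Finset ι) (α : Fin 4) {f : ι → Spacetime → ℝ} {p : Spacetime}
    (hf : ∀ i ∈ S, DifferentiableAt ℝ (f i) p) :
    partialD α (fun q => ∑ i ∈ S, f i q) p = ∑ i ∈ S, partialD α (f i) p := by
  simp [partialD, fderiv_fun_sum hf]

lemma boost_sum {ι : Type*} (S : Finset ι) (a : Fin 3) {f : ι → Spacetime → ℝ} {p : Spacetime}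
    (hf : ∀ i ∈ S, DifferentiableAt ℝ (f i) p) :
    boost a (fun q => ∑ i ∈ S, f i q) p = ∑ i ∈ S, boost a (f i) p := by
  simp only [boost, partialD_sum S _ hf, Finset.mul_sum, Finset.sum_add_distrib]

lemma derivation_add (k : Fin 4 ⊕ Fin 3) {f g : Spacetime → ℝ} {p : Spacetime}
    (hf : DifferentiableAt ℝ f p) (hg : DifferentiableAt ℝ g p) :
    derivation k (fun q => f q + g q) p = derivation k f p + derivation k g p := by
  rcases k with α | a
  · exact partialD_add α hf hg
  · simp only [derivation_inr, boost, partialD_add _ hf hg]; ring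

lemma derivation_mul (k : Fin 4 ⊕ Fin 3) {f g : Spacetime → ℝ} {p : Spacetime}
    (hf : DifferentiableAt ℝ f p) (hg : DifferentiableAt ℝ g p) :
    derivation k (fun q => f q * g q) p = derivation k f p * g p + f p * derivation k g p := by
  rcases k with α | a
  · exact partialD_mul α hf hg
  · simp only [derivation_inr, boost, partialD_mul _ hf hg]; ring

lemma derivation_const_mul (k : Fin 4 ⊕ Fin 3) (c : ℝ) {f : Spacetime → ℝ} {p : Spacetime}
    (hf : DifferentiableAt ℝ f p) :
    derivation k (fun q => c * f q) p = c * derivation k f p := by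
  rcases k with α | a
  · exact partialD_const_mul α c hf
  · simp only [derivation_inr, boost, partialD_const_mul _ c hf]; ring

lemma derivation_sum {ι : Type*} (S : Finset ι) (k : Fin 4 ⊕ Fin 3) {f : ι → Spacetime → ℝ}
    {p : Spacetime} (hf : ∀ i ∈ S, DifferentiableAt ℝ (f i) p) :
    derivation k (fun q => ∑ i ∈ S, f i q) p = ∑ i ∈ S, derivation k (f i) p := by
  rcases k with α | a
  · exact partialD_sum S α hf
  · exact boost_sum S a hf

lemma derivation_zero (k : Fin 4 ⊕ Fin 3) : derivation k 0 = 0 := by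
  rcases k with α | a
  · funext p; simp [partialD]
  · funext p; simp [boost, partialD]

lemma derivation_congr_of_eventuallyEq (k : Fin 4 ⊕ Fin 3) {f g : Spacetime → ℝ} {p : Spacetime}
    (h : f =ᶠ[𝓝 p] g) : derivation k f p = derivation k g p := by
  rcases k with α | a
  · simp [partialD, h.fderiv_eq]
  · simp [boost, partialD, h.fderiv_eq]

lemma derivation_congr (k : Fin 4 ⊕ Fin 3) {U : Set Spacetime} (hU : IsOpen U)
    {f g : Spacetime → ℝ} (h : Set.EqOn f g U) :
    Set.EqOn (derivation k f) (derivation k g) U := fun _ hp =>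
  derivation_congr_of_eventuallyEq k (h.eventuallyEq_of_mem (hU.mem_nhds hp))

lemma contDiffOn_partialD (α : Fin 4) {U : Set Spacetime} (hU : IsOpen U) {n : ℕ}
    {f : Spacetime → ℝ} (hf : ContDiffOn ℝ (n + 1 : ℕ) f U) :
    ContDiffOn ℝ n (partialD α f) U :=
  (hf.fderiv_of_isOpen hU (m := n) (by norm_cast)).clm_apply contDiffOn_const

lemma contDiffOn_derivation (k : Fin 4 ⊕ Fin 3) {U : Set Spacetime} (hU : IsOpen U) {n : ℕ}
    {f : Spacetime → ℝ} (hf : ContDiffOn ℝ (n + 1 : ℕ) f U) :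
    ContDiffOn ℝ n (derivation k f) U := by
  rcases k with α | a
  · exact contDiffOn_partialD α hU hf
  · exact ((contDiff_coord a).contDiffOn.mul (contDiffOn_partialD 0 hU hf)).add
      (contDiff_time.contDiffOn.mul (contDiffOn_partialD a.succ hU hf))

lemma ContDiffOn.differentiableAt_of_isOpen {U : Set Spacetime} (hU : IsOpen U) {n : ℕ}
    (hn : n ≠ 0) {f : Spacetime → ℝ} (hf : ContDiffOn ℝ n f U) {p : Spacetime} (hp : p ∈ U) :
    DifferentiableAt ℝ f p :=
  (hf.contDiffAt (hU.mem_nhds hp)).differentiableAt (by exact_mod_cast hn)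

lemma partialD_comm (α β : Fin 4) {f : Spacetime → ℝ} {p : Spacetime}
    (hf : ContDiffAt ℝ 2 f p) :
    partialD α (partialD β f) p = partialD β (partialD α f) p := by
  have hd : DifferentiableAt ℝ (fderiv ℝ f) p :=
    (hf.fderiv_right (m := 1) (by norm_num)).differentiableAt (by norm_num)
  have key : ∀ α β, partialD α (partialD β f) p =
      fderiv ℝ (fderiv ℝ f) p (frame α) (frame β) := by
    intro α β
    change fderiv ℝ (fun q => fderiv ℝ f q (frame β)) p (frame α) = _
    rw [fderiv_clm_apply hd (differentiableAt_const _)]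
    simp
  rw [key, key]
  exact (hf.isSymmSndFDerivAt (by simp)).eq _ _

/-- The constants of `[L_a, ∂_β] = ∑_γ c_{aβγ} ∂_γ`. -/
noncomputable def boostCoeff (a : Fin 3) (β γ : Fin 4) : ℝ :=
  -((if β = a.succ ∧ γ = 0 then 1 else 0) + (if β = 0 ∧ γ = a.succ then 1 else 0))

lemma sum_boostCoeff_mul (a : Fin 3) (β : Fin 4) (v : Fin 4 → ℝ) :
    ∑ γ, boostCoeff a β γ * v γ =
      -((if β = a.succ then v 0 else 0) + (if β = 0 then v a.succ else 0)) := by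
  simp [boostCoeff, add_mul, Finset.sum_add_distrib, ite_and]

lemma boost_partialD (a : Fin 3) (β : Fin 4) {f : Spacetime → ℝ} {p : Spacetime}
    (hf : ContDiffAt ℝ 2 f p) :
    boost a (partialD β f) p =
      partialD β (boost a f) p + ∑ γ, boostCoeff a β γ * partialD γ f p := by
  have hd : ∀ γ, DifferentiableAt ℝ (partialD γ f) p := fun γ =>
    ((hf.fderiv_right (m := 1) (by norm_num)).clm_apply contDiffAt_const).differentiableAt
      (by norm_num)
  have hx : DifferentiableAt ℝ (fun q : Spacetime => q.2 a) p :=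
    (contDiff_coord a (n := 1)).contDiffAt.differentiableAt (by norm_num)
  have ht : DifferentiableAt ℝ (fun q : Spacetime => q.1) p := differentiableAt_fst
  rw [sum_boostCoeff_mul]
  have : partialD β (boost a f) p =
      partialD β (fun q => q.2 a * partialD 0 f q + q.1 * partialD a.succ f q) p := rfl
  rw [this, partialD_add _ (hx.fun_mul (hd 0)) (ht.fun_mul (hd _)), partialD_mul _ hx (hd 0),
    partialD_mul _ ht (hd _), partialD_time, partialD_coord, partialD_comm β 0 hf,
    partialD_comm β a.succ hf, boost]
  split_ifs <;> ring

/-! ### Null cubic forms -/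

/-- The cubic form produced when the derivation `k` acts on the coefficients of `quasiOp Q`:
it vanishes for `∂_α`, and for `L_a` it is the infinitesimal Lorentz boost of `Q`. -/
noncomputable def derivForm : Fin 4 ⊕ Fin 3 → (Fin 4 → Fin 4 → Fin 4 → ℝ) →
    Fin 4 → Fin 4 → Fin 4 → ℝ
  | Sum.inl _, _ => 0
  | Sum.inr a, Q => fun α β γ => ∑ δ, (boostCoeff a δ α * Q δ β γ + boostCoeff a δ β * Q α δ γ +
      boostCoeff a δ γ * Q α β δ)

lemma sum_boostForm (a : Fin 3) (Q A : Fin 4 → Fin 4 → Fin 4 → ℝ) :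
    ∑ α, ∑ β, ∑ γ, derivForm (Sum.inr a) Q α β γ * A α β γ =
      ∑ α, ∑ β, ∑ γ, Q α β γ * ((∑ δ, boostCoeff a α δ * A δ β γ) +
        (∑ δ, boostCoeff a β δ * A α δ γ) + ∑ δ, boostCoeff a γ δ * A α β δ) := by
  simp only [derivForm, Finset.sum_mul, Finset.mul_sum, add_mul, mul_add,
    Finset.sum_add_distrib]
  congr 1
  · congr 1
    · have h : ∀ F : Fin 4 → Fin 4 → Fin 4 → Fin 4 → ℝ,
          ∑ α, ∑ β, ∑ γ, ∑ δ, F α β γ δ = ∑ δ, ∑ β, ∑ γ, ∑ α, F α β γ δ := by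
        intro F
        calc _ = ∑ α, ∑ β, ∑ δ, ∑ γ, F α β γ δ :=
              Finset.sum_congr rfl fun α _ => Finset.sum_congr rfl fun β _ => Finset.sum_comm
          _ = ∑ α, ∑ δ, ∑ β, ∑ γ, F α β γ δ := Finset.sum_congr rfl fun α _ => Finset.sum_comm
          _ = ∑ δ, ∑ α, ∑ β, ∑ γ, F α β γ δ := Finset.sum_comm
          _ = ∑ δ, ∑ β, ∑ α, ∑ γ, F α β γ δ := Finset.sum_congr rfl fun α _ => Finset.sum_comm
          _ = _ := Finset.sum_congr rfl fun α _ => Finset.sum_congr rfl fun β _ => Finset.sum_comm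
      rw [h]
      refine Finset.sum_congr rfl fun α _ => Finset.sum_congr rfl fun β _ =>
        Finset.sum_congr rfl fun γ _ => Finset.sum_congr rfl fun δ _ => by ring
    · refine Finset.sum_congr rfl fun α _ => ?_
      have h : ∀ F : Fin 4 → Fin 4 → Fin 4 → ℝ,
          ∑ β, ∑ γ, ∑ δ, F β γ δ = ∑ δ, ∑ γ, ∑ β, F β γ δ := by
        intro F
        calc _ = ∑ β, ∑ δ, ∑ γ, F β γ δ := Finset.sum_congr rfl fun α _ => Finset.sum_comm
          _ = ∑ δ, ∑ β, ∑ γ, F β γ δ := Finset.sum_comm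
          _ = _ := Finset.sum_congr rfl fun α _ => Finset.sum_comm
      rw [h]
      refine Finset.sum_congr rfl fun β _ =>
        Finset.sum_congr rfl fun γ _ => Finset.sum_congr rfl fun δ _ => by ring
  · refine Finset.sum_congr rfl fun α _ => Finset.sum_congr rfl fun β _ => ?_
    rw [Finset.sum_comm]
    refine Finset.sum_congr rfl fun γ _ => Finset.sum_congr rfl fun δ _ => by ring

/-- Nullity is invariant under infinitesimal boosts: for `ξ` on the light cone, the derived form
at `ξ` is the derivative at `θ = 0` of `Q` along the orbit of `ξ` under the boosts of rapidity `θ`,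
and this orbit stays on the light cone. -/
lemma isNullCubic_derivForm (k : Fin 4 ⊕ Fin 3) {Q : Fin 4 → Fin 4 → Fin 4 → ℝ}
    (hQ : IsNullCubic Q) : IsNullCubic (derivForm k Q) := by
  rcases k with α | a
  · intro ξ _; simp [derivForm]
  intro ξ hξ
  -- the orbit of `ξ` under the boosts in the direction `a`
  let X : ℝ → Fin 4 → ℝ := fun θ δ =>
    if δ = 0 then Real.cosh θ * ξ 0 - Real.sinh θ * ξ a.succ
    else if δ = a.succ then Real.cosh θ * ξ a.succ - Real.sinh θ * ξ 0 else ξ δ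
  have hX0 : X 0 = ξ := by
    funext δ
    by_cases h0 : δ = 0
    · simp [X, h0]
    · by_cases h1 : δ = a.succ
      · simp [X, h1]
      · simp [X, h0, h1]
  have hd : ∀ δ, HasDerivAt (fun θ => X θ δ) (∑ ε, boostCoeff a δ ε * ξ ε) 0 := by
    intro δ
    have hc : ∀ y z : ℝ, HasDerivAt (fun θ => Real.cosh θ * y - Real.sinh θ * z) (-z) 0 := by
      intro y z
      have := ((Real.hasDerivAt_cosh 0).mul_const y).fun_sub ((Real.hasDerivAt_sinh 0).mul_const z)
      simpa using this
    rw [sum_boostCoeff_mul]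
    by_cases h0 : δ = 0
    · subst h0
      simpa [X, (Fin.succ_ne_zero a).symm] using hc (ξ 0) (ξ a.succ)
    · by_cases h1 : δ = a.succ
      · subst h1
        simpa [X, h0] using hc (ξ a.succ) (ξ 0)
      · simpa [X, h0, h1] using hasDerivAt_const (0 : ℝ) (ξ δ)
  have hcone : ∀ θ, X θ 0 ^ 2 - ∑ b : Fin 3, X θ b.succ ^ 2 = 0 := by
    intro θ
    rw [← hξ]
    have hcs := Real.cosh_sq θ
    have hs : ∀ b : Fin 3, X θ b.succ ^ 2 = ξ b.succ ^ 2 + if b = a then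
        (Real.cosh θ * ξ a.succ - Real.sinh θ * ξ 0) ^ 2 - ξ a.succ ^ 2 else 0 := by
      intro b
      by_cases hb : b = a
      · simp [X, hb]
      · simp [X, hb, Fin.succ_inj]
    have h0 : X θ 0 = Real.cosh θ * ξ 0 - Real.sinh θ * ξ a.succ := by simp [X]
    simp only [hs, h0, Finset.sum_add_distrib, Finset.sum_ite_eq', Finset.mem_univ, if_true]
    linear_combination (ξ 0 ^ 2 - ξ a.succ ^ 2) * hcs
  have hzero : ∀ θ, ∑ α, ∑ β, ∑ γ, Q α β γ * X θ α * X θ β * X θ γ = 0 := fun θ =>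
    hQ (X θ) (hcone θ)
  have hder : HasDerivAt (fun θ => ∑ α, ∑ β, ∑ γ, Q α β γ * X θ α * X θ β * X θ γ)
      (∑ α, ∑ β, ∑ γ, Q α β γ * ((∑ δ, boostCoeff a α δ * (ξ δ * ξ β * ξ γ)) +
        (∑ δ, boostCoeff a β δ * (ξ α * ξ δ * ξ γ)) +
        ∑ δ, boostCoeff a γ δ * (ξ α * ξ β * ξ δ))) 0 := by
    refine HasDerivAt.fun_sum fun α _ => HasDerivAt.fun_sum fun β _ =>
      HasDerivAt.fun_sum fun γ _ => ?_
    have h := (((hd α).const_mul (Q α β γ)).fun_mul (hd β)).fun_mul (hd γ)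
    refine h.congr_deriv ?_
    rw [hX0]
    have e1 : ∑ δ, boostCoeff a α δ * (ξ δ * ξ β * ξ γ) =
        (∑ δ, boostCoeff a α δ * ξ δ) * (ξ β * ξ γ) := by
      rw [Finset.sum_mul]; exact Finset.sum_congr rfl fun δ _ => by ring
    have e2 : ∑ δ, boostCoeff a β δ * (ξ α * ξ δ * ξ γ) =
        (∑ δ, boostCoeff a β δ * ξ δ) * (ξ α * ξ γ) := by
      rw [Finset.sum_mul]; exact Finset.sum_congr rfl fun δ _ => by ring
    have e3 : ∑ δ, boostCoeff a γ δ * (ξ α * ξ β * ξ δ) =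
        (∑ δ, boostCoeff a γ δ * ξ δ) * (ξ α * ξ β) := by
      rw [Finset.sum_mul]; exact Finset.sum_congr rfl fun δ _ => by ring
    rw [e1, e2, e3]
    ring
  have h0 : (fun θ => ∑ α, ∑ β, ∑ γ, Q α β γ * X θ α * X θ β * X θ γ) = fun _ => 0 :=
    funext hzero
  rw [h0] at hder
  have hfin := hder.unique (hasDerivAt_const (0 : ℝ) (0 : ℝ))
  rw [← sum_boostForm a Q (fun α β γ => ξ α * ξ β * ξ γ)] at hfin
  rw [← hfin]
  exact Finset.sum_congr rfl fun α _ => Finset.sum_congr rfl fun β _ =>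
    Finset.sum_congr rfl fun γ _ => by ring

/-- The `ℓ¹` size of the coefficients of a cubic form. -/
noncomputable def cubicNorm (Q : Fin 4 → Fin 4 → Fin 4 → ℝ) : ℝ := ∑ α, ∑ β, ∑ γ, |Q α β γ|

lemma cubicNorm_nonneg (Q : Fin 4 → Fin 4 → Fin 4 → ℝ) : 0 ≤ cubicNorm Q :=
  Finset.sum_nonneg fun _ _ => Finset.sum_nonneg fun _ _ => Finset.sum_nonneg fun _ _ =>
    abs_nonneg _

lemma abs_sum_cubic_le (Q A : Fin 4 → Fin 4 → Fin 4 → ℝ) {B : ℝ}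
    (h : ∀ α β γ, |A α β γ| ≤ B) :
    |∑ α, ∑ β, ∑ γ, Q α β γ * A α β γ| ≤ cubicNorm Q * B := by
  rw [cubicNorm, Finset.sum_mul]
  refine (Finset.abs_sum_le_sum_abs _ _).trans (Finset.sum_le_sum fun α _ => ?_)
  rw [Finset.sum_mul]
  refine (Finset.abs_sum_le_sum_abs _ _).trans (Finset.sum_le_sum fun β _ => ?_)
  rw [Finset.sum_mul]
  refine (Finset.abs_sum_le_sum_abs _ _).trans (Finset.sum_le_sum fun γ _ => ?_)
  rw [abs_mul]
  exact mul_le_mul_of_nonneg_left (h α β γ) (abs_nonneg _)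

/-- A null form evaluated at the conormal `n = (1, -x/t)` of a hyperboloid gains the factor
`1 - |x|²/t² = s²/t²`, because `n` differs by at most that from a null covector. -/
lemma abs_cubic_le_of_isNull {Q : Fin 4 → Fin 4 → Fin 4 → ℝ} (hQ : IsNullCubic Q)
    {n : Fin 4 → ℝ} (h0 : n 0 = 1) (h1 : ∑ a : Fin 3, n a.succ ^ 2 ≤ 1) :
    |∑ α, ∑ β, ∑ γ, Q α β γ * (n α * n β * n γ)| ≤
      cubicNorm Q * (3 * (1 - ∑ a : Fin 3, n a.succ ^ 2)) := by
  set R := ∑ a : Fin 3, n a.succ ^ 2 with hR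
  have hR0 : 0 ≤ R := Finset.sum_nonneg fun _ _ => sq_nonneg _
  have hρ2 : √R ^ 2 = R := Real.sq_sqrt hR0
  have hρ0 : 0 ≤ √R := Real.sqrt_nonneg R
  have hρ1 : √R ≤ 1 := Real.sqrt_le_one.mpr h1
  -- the null covector with the same spatial part as `n`
  let ξ : Fin 4 → ℝ := Fin.cons √R fun a : Fin 3 => n a.succ
  have hξ0 : ξ 0 = √R := rfl
  have hξs : ∀ a : Fin 3, ξ a.succ = n a.succ := fun a => rfl
  have hnull := hQ ξ (by simp only [hξ0, hξs, hρ2, ← hR, sub_self])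
  have hsucc : ∀ a : Fin 3, |n a.succ| ≤ 1 := by
    intro a
    have : n a.succ ^ 2 ≤ R :=
      Finset.single_le_sum (f := fun a : Fin 3 => n a.succ ^ 2) (fun _ _ => sq_nonneg _)
        (Finset.mem_univ a)
    rw [← abs_one, ← sq_le_sq]
    linarith
  have hn : ∀ α, |n α| ≤ 1 := by
    intro α
    refine Fin.cases ?_ (fun a => ?_) α
    · simp [h0]
    · exact hsucc a
  have hξ : ∀ α, |ξ α| ≤ 1 := by
    intro α
    refine Fin.cases ?_ (fun a => ?_) α
    · rw [hξ0, abs_of_nonneg hρ0]; exact hρ1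
    · exact hsucc a
  have hd : ∀ α, |n α - ξ α| ≤ 1 - R := by
    intro α
    refine Fin.cases ?_ (fun a => ?_) α
    · rw [hξ0, h0, abs_of_nonneg (by linarith)]; nlinarith
    · rw [hξs, sub_self, abs_zero]; linarith
  have hdiff : ∑ α, ∑ β, ∑ γ, Q α β γ * (n α * n β * n γ) =
      ∑ α, ∑ β, ∑ γ, Q α β γ * (n α * n β * n γ - ξ α * ξ β * ξ γ) := by
    have : ∑ α, ∑ β, ∑ γ, Q α β γ * (ξ α * ξ β * ξ γ) = 0 := by
      rw [← hnull]
      exact Finset.sum_congr rfl fun α _ => Finset.sum_congr rfl fun β _ =>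
        Finset.sum_congr rfl fun γ _ => by ring
    simp only [mul_sub, Finset.sum_sub_distrib, this, sub_zero]
  rw [hdiff]
  refine abs_sum_cubic_le _ _ fun α β γ => ?_
  have e : n α * n β * n γ - ξ α * ξ β * ξ γ =
      (n α - ξ α) * (n β * n γ) + ξ α * (n β - ξ β) * n γ + ξ α * ξ β * (n γ - ξ γ) := by ring
  have hRR : 0 ≤ 1 - R := by linarith
  rw [e]
  have e1 : |(n α - ξ α) * (n β * n γ)| ≤ (1 - R) * (1 * 1) := by
    rw [abs_mul, abs_mul]
    exact mul_le_mul (hd α) (mul_le_mul (hn β) (hn γ) (abs_nonneg _) zero_le_one)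
      (by positivity) hRR
  have e2 : |ξ α * (n β - ξ β) * n γ| ≤ 1 * (1 - R) * 1 := by
    rw [abs_mul, abs_mul]
    exact mul_le_mul (mul_le_mul (hξ α) (hd β) (abs_nonneg _) zero_le_one) (hn γ) (abs_nonneg _)
      (by linarith)
  have e3 : |ξ α * ξ β * (n γ - ξ γ)| ≤ 1 * 1 * (1 - R) := by
    rw [abs_mul, abs_mul]
    exact mul_le_mul (mul_le_mul (hξ α) (hξ β) (abs_nonneg _) zero_le_one) (hd γ) (abs_nonneg _)
      (by norm_num)
  exact (abs_add_three _ _ _).trans (by linarith)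

/-! ### The quasilinear operator -/

/-- The derivations act on `quasiOp Q` by the Leibniz rule, up to a term of the same kind with
the derived cubic form. -/
lemma derivation_quasiOp (k : Fin 4 ⊕ Fin 3) (Q : Fin 4 → Fin 4 → Fin 4 → ℝ)
    {f g : Spacetime → ℝ} {U : Set Spacetime} (hU : IsOpen U) (hf : ContDiffOn ℝ 2 f U)
    (hg : ContDiffOn ℝ 3 g U) {p : Spacetime} (hp : p ∈ U) :
    derivation k (quasiOp Q f g) p =
      quasiOp Q (derivation k f) g p + quasiOp Q f (derivation k g) p +
        quasiOp (derivForm k Q) f g p := by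
  have hUp := hU.mem_nhds hp
  have hf1 : ∀ γ, DifferentiableAt ℝ (partialD γ f) p := fun γ =>
    ContDiffOn.differentiableAt_of_isOpen hU one_ne_zero (contDiffOn_partialD γ hU hf) hp
  have hg1 : ∀ β, ContDiffOn ℝ 2 (partialD β g) U := fun β => contDiffOn_partialD β hU hg
  have hg2 : ∀ α β, DifferentiableAt ℝ (partialD α (partialD β g)) p := fun α β =>
    ContDiffOn.differentiableAt_of_isOpen hU one_ne_zero (contDiffOn_partialD α hU (hg1 β)) hp
  have hfp : ContDiffAt ℝ 2 f p := hf.contDiffAt hUp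
  have hg2p : ∀ β, ContDiffAt ℝ 2 (partialD β g) p := fun β => (hg1 β).contDiffAt hUp
  have step : derivation k (quasiOp Q f g) p = ∑ α, ∑ β, ∑ γ, Q α β γ *
      (derivation k (partialD γ f) p * partialD α (partialD β g) p +
        partialD γ f p * derivation k (partialD α (partialD β g)) p) := by
    have hterm : ∀ α β γ, DifferentiableAt ℝ
        (fun q => Q α β γ * (partialD γ f q * partialD α (partialD β g) q)) p :=
      fun α β γ => ((hf1 γ).fun_mul (hg2 α β)).const_mul _
    have e : quasiOp Q f g = fun q => ∑ α, ∑ β, ∑ γ,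
        Q α β γ * (partialD γ f q * partialD α (partialD β g) q) := by
      funext q; simp only [quasiOp, mul_assoc]
    rw [e, derivation_sum]
    · refine Finset.sum_congr rfl fun α _ => ?_
      rw [derivation_sum]
      · refine Finset.sum_congr rfl fun β _ => ?_
        rw [derivation_sum]
        · refine Finset.sum_congr rfl fun γ _ => ?_
          rw [derivation_const_mul _ _ ((hf1 γ).fun_mul (hg2 α β)),
            derivation_mul _ (hf1 γ) (hg2 α β)]
        · exact fun γ _ => hterm α β γ
      · exact fun β _ => DifferentiableAt.fun_sum fun γ _ => hterm α β γ
    · exact fun α _ => DifferentiableAt.fun_sum fun β _ => DifferentiableAt.fun_sum fun γ _ =>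
        hterm α β γ
  rw [step]
  rcases k with δ | a
  · have e0 : quasiOp (derivForm (Sum.inl δ) Q) f g p = 0 := by simp [quasiOp, derivForm]
    rw [e0, add_zero]
    simp only [quasiOp, derivation_inl, ← Finset.sum_add_distrib]
    refine Finset.sum_congr rfl fun α _ => Finset.sum_congr rfl fun β _ =>
      Finset.sum_congr rfl fun γ _ => ?_
    have h1 : partialD δ (partialD γ f) p = partialD γ (partialD δ f) p := partialD_comm _ _ hfp
    have h2 : partialD δ (partialD α (partialD β g)) p =
        partialD α (partialD β (partialD δ g)) p := by
      rw [partialD_comm δ α (hg2p β)]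
      refine derivation_congr (Sum.inl α) hU (fun q hq => ?_) hp
      exact partialD_comm δ β ((hg.of_le (by norm_num)).contDiffAt (hU.mem_nhds hq))
    rw [h1, h2]; ring
  · have e0 : quasiOp (derivForm (Sum.inr a) Q) f g p = ∑ α, ∑ β, ∑ γ,
        derivForm (Sum.inr a) Q α β γ * (partialD γ f p * partialD α (partialD β g) p) := by
      simp only [quasiOp, mul_assoc]
    rw [e0, sum_boostForm a Q (fun α β γ => partialD γ f p * partialD α (partialD β g) p)]
    simp only [quasiOp, derivation_inr, ← Finset.sum_add_distrib]
    refine Finset.sum_congr rfl fun α _ => Finset.sum_congr rfl fun β _ =>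
      Finset.sum_congr rfl fun γ _ => ?_
    have h1 := boost_partialD a γ hfp
    have h2 : boost a (partialD α (partialD β g)) p =
        partialD α (partialD β (boost a g)) p +
          ∑ δ, boostCoeff a β δ * partialD α (partialD δ g) p +
          ∑ δ, boostCoeff a α δ * partialD δ (partialD β g) p := by
      rw [boost_partialD a α (hg2p β)]
      congr 1
      have hb : Set.EqOn (boost a (partialD β g))
          (fun q => partialD β (boost a g) q + ∑ δ, boostCoeff a β δ * partialD δ g q) U :=
        fun q hq => boost_partialD a β ((hg.of_le (by norm_num)).contDiffAt (hU.mem_nhds hq))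
      have hdb : DifferentiableAt ℝ (partialD β (boost a g)) p :=
        ContDiffOn.differentiableAt_of_isOpen hU one_ne_zero
          (contDiffOn_partialD β hU (contDiffOn_derivation (Sum.inr a) hU hg)) hp
      have hdg : ∀ δ, DifferentiableAt ℝ (partialD δ g) p := fun δ =>
        (hg2p δ).differentiableAt (by norm_num)
      have := derivation_congr (Sum.inl α) hU hb hp
      simp only [derivation_inl] at this
      rw [this, partialD_add _ hdb (DifferentiableAt.fun_sum fun δ _ => (hdg δ).const_mul _),
        partialD_sum _ _ fun δ _ => (hdg δ).const_mul _]
      congr 1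
      exact Finset.sum_congr rfl fun δ _ => partialD_const_mul _ _ (hdg δ)
    rw [h1, h2]
    simp only [mul_add, add_mul, Finset.mul_sum, Finset.sum_mul]
    have c1 : ∀ δ, Q α β γ * (boostCoeff a γ δ * partialD δ f p * partialD α (partialD β g) p) =
      Q α β γ * (boostCoeff a γ δ * (partialD δ f p * partialD α (partialD β g) p)) := by
      intro δ; ring
    have c2 : ∀ δ, Q α β γ * (partialD γ f p * (boostCoeff a β δ * partialD α (partialD δ g) p)) =
      Q α β γ * (boostCoeff a β δ * (partialD γ f p * partialD α (partialD δ g) p)) := by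
      intro δ; ring
    have c3 : ∀ δ, Q α β γ * (partialD γ f p * (boostCoeff a α δ * partialD δ (partialD β g) p)) =
      Q α β γ * (boostCoeff a α δ * (partialD γ f p * partialD δ (partialD β g) p)) := by
      intro δ; ring
    simp only [c1, c2, c3, Finset.sum_add_distrib]
    ring

/-- The null structure in the frame adapted to the hyperboloids. Writing
`∂_α = n_α ∂_t + t⁻¹ L_α` with `n = (1, -x/t)` and `L_0 = 0`, the part of `Q^{αβγ} ∂_γ f ∂_α∂_β g`
without a boost carries the factor `Q^{αβγ} n_α n_β n_γ = O(s²/t²)`. -/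
lemma abs_quasiOp_le {Q : Fin 4 → Fin 4 → Fin 4 → ℝ} (hQ : IsNullCubic Q)
    {f g : Spacetime → ℝ} {p : Spacetime} (hp : ‖p.2‖ ≤ p.1) (ht : 0 < p.1)
    (hg : ContDiffAt ℝ 2 g p) {m₁ l₁ m₂ l₂ : ℝ}
    (hm₁ : ∀ γ, |partialD γ f p| ≤ m₁) (hl₁ : ∀ a, |boost a f p| ≤ l₁)
    (hm₂ : ∀ α β, |partialD α (partialD β g) p| ≤ m₂)
    (hl₂ : ∀ a β, |boost a (partialD β g) p| ≤ l₂) :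
    |quasiOp Q f g p| ≤ cubicNorm Q *
      (3 * ((p.1 ^ 2 - ‖p.2‖ ^ 2) / p.1 ^ 2) * (m₁ * m₂) + l₁ / p.1 * m₂ +
        2 * (m₁ * (l₂ / p.1))) := by
  have htne : p.1 ≠ 0 := ht.ne'
  let n : Fin 4 → ℝ := Fin.cons 1 fun a : Fin 3 => -(p.2 a / p.1)
  let d : (Spacetime → ℝ) → Fin 4 → ℝ := fun h => Fin.cons 0 fun a : Fin 3 => boost a h p / p.1
  have hn0 : n 0 = 1 := rfl
  have hns : ∀ a : Fin 3, n a.succ = -(p.2 a / p.1) := fun a => rfl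
  have hR : ∑ a : Fin 3, n a.succ ^ 2 = ‖p.2‖ ^ 2 / p.1 ^ 2 := by
    simp only [hns, neg_sq, div_pow, ← Finset.sum_div]
    rw [EuclideanSpace.real_norm_sq_eq]
  have hR1 : ∑ a : Fin 3, n a.succ ^ 2 ≤ 1 := by
    rw [hR, div_le_one (by positivity)]
    exact pow_le_pow_left₀ (norm_nonneg _) hp 2
  have hdec : ∀ h : Spacetime → ℝ, ∀ α, partialD α h p = n α * partialD 0 h p + d h α := by
    intro h α
    refine Fin.cases ?_ (fun a => ?_) α
    · simp [hn0, d]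
    · rw [hns]
      change _ = _ + boost a h p / p.1
      rw [boost]
      field_simp
      ring
  have hm₁0 : 0 ≤ m₁ := (abs_nonneg _).trans (hm₁ 0)
  have hm₂0 : 0 ≤ m₂ := (abs_nonneg _).trans (hm₂ 0 0)
  have hl₁0 : 0 ≤ l₁ := (abs_nonneg _).trans (hl₁ 0)
  have hl₂0 : 0 ≤ l₂ := (abs_nonneg _).trans (hl₂ 0 0)
  have hn : ∀ α, |n α| ≤ 1 := by
    intro α
    refine Fin.cases ?_ (fun a => ?_) α
    · simp [hn0]
    · have : n a.succ ^ 2 ≤ ∑ a : Fin 3, n a.succ ^ 2 :=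
        Finset.single_le_sum (f := fun a : Fin 3 => n a.succ ^ 2) (fun _ _ => sq_nonneg _)
          (Finset.mem_univ a)
      rw [← abs_one, ← sq_le_sq]
      linarith
  have hdf : ∀ γ, |d f γ| ≤ l₁ / p.1 := by
    intro γ
    refine Fin.cases ?_ (fun a => ?_) γ
    · simp only [d, Fin.cons_zero, abs_zero]; positivity
    · simp only [d, Fin.cons_succ, abs_div, abs_of_pos ht]
      exact div_le_div_of_nonneg_right (hl₁ a) ht.le
  have hdg : ∀ α β, |d (partialD β g) α| ≤ l₂ / p.1 := by
    intro α β
    refine Fin.cases ?_ (fun a => ?_) α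
    · simp only [d, Fin.cons_zero, abs_zero]; positivity
    · simp only [d, Fin.cons_succ, abs_div, abs_of_pos ht]
      exact div_le_div_of_nonneg_right (hl₂ a β) ht.le
  let e : Fin 4 → Fin 4 → ℝ := fun α β => n α * d (partialD 0 g) β + d (partialD β g) α
  have he : ∀ α β, |e α β| ≤ 2 * (l₂ / p.1) := by
    intro α β
    have h1 : |n α * d (partialD 0 g) β| ≤ 1 * (l₂ / p.1) := by
      rw [abs_mul]
      exact mul_le_mul (hn α) (hdg β 0) (abs_nonneg _) zero_le_one
    have := abs_add_le (n α * d (partialD 0 g) β) (d (partialD β g) α)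
    have := hdg α β
    simp only [e]; linarith
  have hdd : ∀ α β, partialD α (partialD β g) p =
      n α * n β * partialD 0 (partialD 0 g) p + e α β := by
    intro α β
    rw [hdec (partialD β g) α, partialD_comm 0 β hg, hdec (partialD 0 g) β]
    simp only [e]; ring
  have hsplit : quasiOp Q f g p =
      (partialD 0 f p * partialD 0 (partialD 0 g) p) *
        (∑ α, ∑ β, ∑ γ, Q α β γ * (n α * n β * n γ)) +
      (∑ α, ∑ β, ∑ γ, Q α β γ * (n γ * partialD 0 f p * e α β)) +
      ∑ α, ∑ β, ∑ γ, Q α β γ * (d f γ * partialD α (partialD β g) p) := by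
    simp only [quasiOp, Finset.mul_sum, ← Finset.sum_add_distrib]
    refine Finset.sum_congr rfl fun α _ => Finset.sum_congr rfl fun β _ =>
      Finset.sum_congr rfl fun γ _ => ?_
    have h1 := hdec f γ
    have h2 := hdd α β
    have : partialD γ f p * partialD α (partialD β g) p =
        n γ * partialD 0 f p * (n α * n β * partialD 0 (partialD 0 g) p + e α β) +
          d f γ * partialD α (partialD β g) p := by
      rw [← h2, h1]; ring
    rw [mul_assoc, this]; ring
  have b1 := abs_cubic_le_of_isNull hQ hn0 hR1
  have b2 := abs_sum_cubic_le Q (fun α β γ => n γ * partialD 0 f p * e α β)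
    (B := m₁ * (2 * (l₂ / p.1))) (by
      intro α β γ
      rw [abs_mul, abs_mul]
      refine mul_le_mul ?_ (he α β) (abs_nonneg _) hm₁0
      calc |n γ| * |partialD 0 f p| ≤ 1 * m₁ :=
            mul_le_mul (hn γ) (hm₁ 0) (abs_nonneg _) zero_le_one
        _ = m₁ := one_mul _)
  have b3 := abs_sum_cubic_le Q (fun α β γ => d f γ * partialD α (partialD β g) p)
    (B := l₁ / p.1 * m₂) (by
      intro α β γ
      rw [abs_mul]
      exact mul_le_mul (hdf γ) (hm₂ α β) (abs_nonneg _) (by positivity))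
  have b1' : |(partialD 0 f p * partialD 0 (partialD 0 g) p) *
      (∑ α, ∑ β, ∑ γ, Q α β γ * (n α * n β * n γ))| ≤
      (m₁ * m₂) * (cubicNorm Q * (3 * (1 - ∑ a : Fin 3, n a.succ ^ 2))) := by
    rw [abs_mul, abs_mul]
    exact mul_le_mul (mul_le_mul (hm₁ 0) (hm₂ 0 0) (abs_nonneg _) hm₁0) b1 (abs_nonneg _)
      (by positivity)
  have hR' : 1 - ∑ a : Fin 3, n a.succ ^ 2 = (p.1 ^ 2 - ‖p.2‖ ^ 2) / p.1 ^ 2 := by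
    rw [hR]; field_simp
  rw [hR'] at b1'
  rw [hsplit]
  refine (abs_add_three _ _ _).trans ((add_le_add (add_le_add b1' b2) b3).trans (le_of_eq ?_))
  ring

/-! ### Geometry of the slab and of the hyperboloids -/

lemma isOpen_coneK : IsOpen coneK :=
  isOpen_lt ((continuous_snd.norm).add continuous_const) continuous_fst

lemma one_lt_time_of_mem_coneK {p : Spacetime} (hp : p ∈ coneK) : 1 < p.1 := by
  have : ‖p.2‖ + 1 < p.1 := hp
  linarith [norm_nonneg p.2]

lemma hypPoint_fst_sq (s : ℝ) (x : Space) : (hypPoint s x).1 ^ 2 = s ^ 2 + ‖x‖ ^ 2 :=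
  Real.sq_sqrt (by positivity)

lemma hypPoint_fst_pos {s : ℝ} (hs : 0 < s) (x : Space) : 0 < (hypPoint s x).1 :=
  Real.sqrt_pos.mpr (by positivity)

lemma hypTime_hypPoint {s : ℝ} (hs : 0 ≤ s) (x : Space) : hypTime (hypPoint s x) = s := by
  rw [hypTime, hypPoint_fst_sq]
  simp [hypPoint, Real.sqrt_sq hs]

lemma contDiff_hypPoint {s : ℝ} (hs : 0 < s) {n : WithTop ℕ∞} : ContDiff ℝ n (hypPoint s) :=
  ((contDiff_const.add (contDiff_norm_sq ℝ)).sqrt fun x => by positivity).prodMk contDiff_id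

lemma hypPoint_mem_slab {s s₁ : ℝ} (hs : s ∈ Set.Icc 2 s₁) {x : Space} (hx : x ∈ hypSlice s) :
    hypPoint s x ∈ slab 2 s₁ := by
  have h0 : hypTime (hypPoint s x) = s := hypTime_hypPoint (by linarith [hs.1]) x
  exact ⟨hx, by rw [h0]; exact hs.1, by rw [h0]; exact hs.2⟩

/-- On the part of `ℋ_s` inside `𝒦` one has `t ≤ s²`, since `s² = (t - r)(t + r)` with
`t - r > 1`. -/
lemma hypPoint_fst_le {s : ℝ} {x : Space} (hx : x ∈ hypSlice s) : (hypPoint s x).1 ≤ s ^ 2 := by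
  have h1 : ‖x‖ + 1 < (hypPoint s x).1 := hx
  have h2 := hypPoint_fst_sq s x
  nlinarith [norm_nonneg x]

lemma norm_le_of_mem_hypSlice {s : ℝ} {x : Space} (hx : x ∈ hypSlice s) : ‖x‖ ≤ s ^ 2 := by
  have h1 : ‖x‖ + 1 < (hypPoint s x).1 := hx
  linarith [hypPoint_fst_le hx]

lemma le_hypPoint_fst (s : ℝ) (x : Space) : s ≤ (hypPoint s x).1 :=
  Real.le_sqrt_of_sq_le (by nlinarith [sq_nonneg ‖x‖])

lemma isOpen_hypSlice {s : ℝ} (hs : 0 < s) : IsOpen (hypSlice s) :=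
  isOpen_coneK.preimage (contDiff_hypPoint hs (n := 0)).continuous

lemma hypTime_smul {c : ℝ} (hc : 0 ≤ c) (p : Spacetime) : hypTime (c • p) = c * hypTime p := by
  have : (c • p).1 ^ 2 - ‖(c • p).2‖ ^ 2 = c ^ 2 * (p.1 ^ 2 - ‖p.2‖ ^ 2) := by
    simp only [Prod.smul_fst, Prod.smul_snd, norm_smul, smul_eq_mul, mul_pow, Real.norm_eq_abs,
      sq_abs]
    ring
  rw [hypTime, this, Real.sqrt_mul (sq_nonneg c), Real.sqrt_sq hc, hypTime]

lemma continuous_hypTime : Continuous hypTime :=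
  ((continuous_fst.pow 2).sub ((continuous_snd.norm).pow 2)).sqrt

/-- The points of the cone of hyperbolic time strictly between the end values. -/
def openSlab (s₀ s₁ : ℝ) : Set Spacetime := {p | p ∈ coneK ∧ s₀ < hypTime p ∧ hypTime p < s₁}

lemma isOpen_openSlab (s₀ s₁ : ℝ) : IsOpen (openSlab s₀ s₁) :=
  isOpen_coneK.inter ((isOpen_lt continuous_const continuous_hypTime).inter
    (isOpen_lt continuous_hypTime continuous_const))

lemma openSlab_subset_slab (s₀ s₁ : ℝ) : openSlab s₀ s₁ ⊆ slab s₀ s₁ :=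
  fun _ hp => ⟨hp.1, hp.2.1.le, hp.2.2.le⟩

/-- The slab lies in the closure of its interior: scaling a point by factors close to `1` moves its
hyperbolic time into the open interval. -/
lemma slab_subset_closure_openSlab {s₁ : ℝ} (h : 2 < s₁) :
    slab 2 s₁ ⊆ closure (openSlab 2 s₁) := by
  intro q hq
  have hcont : Continuous fun c : ℝ => c • q := continuous_id.smul continuous_const
  have hK : ∀ᶠ c : ℝ in 𝓝 1, c • q ∈ coneK :=
    hcont.continuousAt.eventually_mem (by simp only [one_smul]; exact isOpen_coneK.mem_nhds hq.1)
  have htend : Tendsto (fun c : ℝ => hypTime (c • q)) (𝓝 1) (𝓝 (hypTime q)) := by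
    have := (continuous_hypTime.comp hcont).tendsto 1
    simpa [Function.comp_def] using this
  have hpos : ∀ᶠ c : ℝ in 𝓝 1, 0 < c := lt_mem_nhds one_pos
  rcases lt_or_ge (hypTime q) s₁ with hlt | hge
  · refine mem_closure_of_tendsto (f := fun c : ℝ => c • q) (b := 𝓝[>] 1) ?_ ?_
    · exact (by simpa using hcont.tendsto 1 : Tendsto (fun c : ℝ => c • q) (𝓝 1) (𝓝 q)).mono_left
        nhdsWithin_le_nhds
    · filter_upwards [nhdsWithin_le_nhds hK, nhdsWithin_le_nhds hpos,
        nhdsWithin_le_nhds (htend.eventually_lt_const hlt), self_mem_nhdsWithin] with c h1 h2 h3 h4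
      refine ⟨h1, ?_, h3⟩
      rw [hypTime_smul h2.le]
      have : (1 : ℝ) < c := h4
      nlinarith [hq.2.1]
  · have h2 : 2 < hypTime q := h.trans_le hge
    refine mem_closure_of_tendsto (f := fun c : ℝ => c • q) (b := 𝓝[<] 1) ?_ ?_
    · exact (by simpa using hcont.tendsto 1 : Tendsto (fun c : ℝ => c • q) (𝓝 1) (𝓝 q)).mono_left
        nhdsWithin_le_nhds
    · filter_upwards [nhdsWithin_le_nhds hK, nhdsWithin_le_nhds hpos,
        nhdsWithin_le_nhds (htend.eventually_const_lt h2), self_mem_nhdsWithin] with c h1 h2 h3 h4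
      refine ⟨h1, h3, ?_⟩
      rw [hypTime_smul h2.le]
      have : c < 1 := h4
      nlinarith [hq.2.1, hq.2.2]

/-! ### Functions regular on the slab and vanishing near the cone -/

/-- An open neighbourhood, inside the cone, of a slab of positive thickness. -/
structure SlabNhd (s₁ : ℝ) (U : Set Spacetime) : Prop where
  lt : 2 < s₁
  isOpen : IsOpen U
  slab_subset : slab 2 s₁ ⊆ U
  subset_coneK : U ⊆ coneK

/-- `f` is of class `C^k` on `U` and vanishes in the slab near the conical boundary. -/
structure Reg (s₁ : ℝ) (U : Set Spacetime) (k : ℕ) (f : Spacetime → ℝ) : Prop where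
  contDiffOn : ContDiffOn ℝ k f U
  vanishes : VanishesNearCone 2 s₁ f

section Reg

variable {s₁ : ℝ} {U : Set Spacetime} {k : ℕ} {f g : Spacetime → ℝ}

lemma Reg.of_le (hf : Reg s₁ U k f) {m : ℕ} (h : m ≤ k) : Reg s₁ U m f :=
  ⟨hf.contDiffOn.of_le (by exact_mod_cast h), hf.vanishes⟩

lemma Reg.add (hf : Reg s₁ U k f) (hg : Reg s₁ U k g) : Reg s₁ U k (fun p => f p + g p) :=
  ⟨hf.contDiffOn.add hg.contDiffOn, fun p hp h1 h2 => by
    filter_upwards [hf.vanishes p hp h1 h2, hg.vanishes p hp h1 h2] with q h3 h4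
    rw [h3, h4, add_zero]⟩

lemma Reg.mul (hf : ContDiffOn ℝ k f U) (hg : Reg s₁ U k g) : Reg s₁ U k (fun p => f p * g p) :=
  ⟨hf.mul hg.contDiffOn, fun p hp h1 h2 => by
    filter_upwards [hg.vanishes p hp h1 h2] with q h4
    rw [h4, mul_zero]⟩

lemma Reg.const_mul (c : ℝ) (hg : Reg s₁ U k g) : Reg s₁ U k (fun p => c * g p) :=
  Reg.mul contDiffOn_const hg

lemma Reg.zero : Reg s₁ U k (fun _ => 0) :=
  ⟨contDiffOn_const, fun _ _ _ _ => Eventually.of_forall fun _ => rfl⟩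

lemma Reg.sum {ι : Type*} (S : Finset ι) {F : ι → Spacetime → ℝ}
    (h : ∀ i ∈ S, Reg s₁ U k (F i)) : Reg s₁ U k (fun p => ∑ i ∈ S, F i p) := by
  classical
  induction S using Finset.induction_on with
  | empty => simpa using Reg.zero
  | insert i S hi ih =>
    simp only [Finset.sum_insert hi]
    exact (h i (Finset.mem_insert_self _ _)).add
      (ih fun j hj => h j (Finset.mem_insert_of_mem hj))

lemma Reg.congr (hN : SlabNhd s₁ U) (hf : Reg s₁ U k f) (h : Set.EqOn g f U) : Reg s₁ U k g :=
  ⟨hf.contDiffOn.congr h, fun p hp h1 h2 => by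
    filter_upwards [hf.vanishes p hp h1 h2, self_mem_nhdsWithin] with q h3 h4
    rw [h (hN.slab_subset h4), h3]⟩

/-- The slab is not open, so the vanishing of `∂_α f` is first seen in its interior, and extends to
the boundary hyperboloids by continuity. -/
lemma Reg.partialD (hN : SlabNhd s₁ U) (α : Fin 4) (hf : Reg s₁ U (k + 1) f) :
    Reg s₁ U k (partialD α f) := by
  refine ⟨contDiffOn_partialD α hN.isOpen hf.contDiffOn, fun p hp h1 h2 => ?_⟩
  filter_upwards [eventually_eventually_nhdsWithin.mpr (hf.vanishes p hp h1 h2),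
    self_mem_nhdsWithin] with q hq hqs
  have hcl := slab_subset_closure_openSlab hN.lt hqs
  have hne : (𝓝[openSlab 2 s₁] q).NeBot := mem_closure_iff_nhdsWithin_neBot.mp hcl
  have hO : ∀ᶠ y in 𝓝[openSlab 2 s₁] q, f y = 0 :=
    (nhdsWithin_mono q (openSlab_subset_slab 2 s₁)) hq
  have hz : ∀ᶠ y in 𝓝[openSlab 2 s₁] q, HypWave.partialD α f y = 0 := by
    filter_upwards [eventually_eventually_nhdsWithin.mpr hO, self_mem_nhdsWithin] with y hy hyO
    rw [(isOpen_openSlab 2 s₁).nhdsWithin_eq hyO] at hy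
    have : HypWave.partialD α f y = HypWave.partialD α 0 y :=
      derivation_congr_of_eventuallyEq (Sum.inl α) hy
    rw [this]
    exact congrFun (derivation_zero (Sum.inl α)) y
  have hc : ContinuousAt (HypWave.partialD α f) q :=
    (contDiffOn_partialD α hN.isOpen hf.contDiffOn).continuousOn.continuousAt
      (hN.isOpen.mem_nhds (hN.slab_subset hqs))
  have ht : Tendsto (HypWave.partialD α f) (𝓝[openSlab 2 s₁] q) (𝓝 (HypWave.partialD α f q)) :=
    hc.tendsto.mono_left nhdsWithin_le_nhds
  exact tendsto_nhds_unique (ht.congr' hz) tendsto_const_nhds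

lemma Reg.derivation (hN : SlabNhd s₁ U) (i : Fin 4 ⊕ Fin 3) (hf : Reg s₁ U (k + 1) f) :
    Reg s₁ U k (derivation i f) := by
  rcases i with α | a
  · exact hf.partialD hN α
  · exact (Reg.mul (contDiff_coord a).contDiffOn (hf.partialD hN 0)).add
      (Reg.mul contDiff_time.contDiffOn (hf.partialD hN a.succ))

lemma Reg.word (hN : SlabNhd s₁ U) (K : List (Fin 4 ⊕ Fin 3)) (hf : Reg s₁ U (k + K.length) f) :
    Reg s₁ U k (word K f) := by
  induction K generalizing k with
  | nil => simpa using hf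
  | cons i K ih =>
    refine Reg.derivation hN i (ih ?_)
    convert hf using 1
    simp; ring

lemma contDiffOn_time_inv_pow (hN : SlabNhd s₁ U) (m : ℕ) :
    ContDiffOn ℝ k (fun p : Spacetime => (p.1 ^ m)⁻¹) U :=
  (contDiff_time.pow m).contDiffOn.inv fun p hp => by
    have := one_lt_time_of_mem_coneK (hN.subset_coneK hp)
    positivity

end Reg

/-! ### Restriction to a hyperboloid -/

/-- The restriction of `f` to `ℋ_s`, as a function of `x`, extended by zero outside of `𝒦`. -/
noncomputable def restrictHyp (s : ℝ) (f : Spacetime → ℝ) : Space → ℝ :=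
  (hypSlice s).indicator fun x => f (hypPoint s x)

lemma restrictHyp_of_mem {s : ℝ} (f : Spacetime → ℝ) {x : Space} (hx : x ∈ hypSlice s) :
    restrictHyp s f x = f (hypPoint s x) := Set.indicator_of_mem hx _

lemma restrictHyp_of_notMem {s : ℝ} (f : Spacetime → ℝ) {x : Space} (hx : x ∉ hypSlice s) :
    restrictHyp s f x = 0 := Set.indicator_of_notMem hx _

section restrict

variable {s s₁ : ℝ} {U : Set Spacetime} {k : ℕ} {f g : Spacetime → ℝ}

/-- Vanishing near the cone makes the extension by zero vanish near every point outside of the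
slice. -/
lemma restrictHyp_eventuallyEq_zero (hs : s ∈ Set.Icc 2 s₁) (hf : VanishesNearCone 2 s₁ f)
    {x : Space} (hx : x ∉ hypSlice s) : restrictHyp s f =ᶠ[𝓝 x] 0 := by
  have hs0 : 0 < s := by linarith [hs.1]
  have hcont : Continuous (hypPoint s) := (contDiff_hypPoint hs0 (n := 0)).continuous
  have hle : (hypPoint s x).1 ≤ ‖x‖ + 1 := not_lt.mp hx
  rcases hle.lt_or_eq with hlt | heq
  · have : ∀ᶠ y in 𝓝 x, (hypPoint s y).1 < ‖y‖ + 1 :=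
      (isOpen_lt (continuous_fst.comp hcont) (continuous_norm.add continuous_const)).mem_nhds hlt
    filter_upwards [this] with y hy
    exact restrictHyp_of_notMem f (not_lt.mpr hy.le)
  · have h0 : hypTime (hypPoint s x) = s := hypTime_hypPoint hs0.le x
    have hv := hf (hypPoint s x) heq (by rw [h0]; exact hs.1) (by rw [h0]; exact hs.2)
    rw [eventually_nhdsWithin_iff] at hv
    filter_upwards [hcont.continuousAt.eventually hv] with y hy
    by_cases hys : y ∈ hypSlice s
    · rw [restrictHyp_of_mem f hys]
      exact hy (hypPoint_mem_slab hs hys)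
    · exact restrictHyp_of_notMem f hys

lemma restrictHyp_eventuallyEq (hs : 0 < s) (f : Spacetime → ℝ) {x : Space} (hx : x ∈ hypSlice s) :
    restrictHyp s f =ᶠ[𝓝 x] fun y => f (hypPoint s y) := by
  filter_upwards [(isOpen_hypSlice hs).mem_nhds hx] with y hy
  exact restrictHyp_of_mem f hy

lemma contDiff_restrictHyp (hN : SlabNhd s₁ U) (hs : s ∈ Set.Icc 2 s₁) (hf : Reg s₁ U k f) :
    ContDiff ℝ k (restrictHyp s f) := by
  have hs0 : 0 < s := by linarith [hs.1]
  rw [contDiff_iff_contDiffAt]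
  intro x
  by_cases hx : x ∈ hypSlice s
  · have hfx : ContDiffAt ℝ k f (hypPoint s x) := hf.contDiffOn.contDiffAt
      (hN.isOpen.mem_nhds (hN.slab_subset (hypPoint_mem_slab hs hx)))
    exact (hfx.comp x (contDiff_hypPoint hs0).contDiffAt).congr_of_eventuallyEq
      (restrictHyp_eventuallyEq hs0 f hx)
  · exact (contDiffAt_const (c := (0 : ℝ))).congr_of_eventuallyEq
      (restrictHyp_eventuallyEq_zero hs hf.vanishes hx)

lemma hasCompactSupport_restrictHyp (s : ℝ) (f : Spacetime → ℝ) :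
    HasCompactSupport (restrictHyp s f) :=
  HasCompactSupport.intro (isCompact_closedBall (0 : Space) (s ^ 2)) fun x hx =>
    restrictHyp_of_notMem f fun h => hx (by simpa using norm_le_of_mem_hypSlice h)

lemma fderiv_hypPoint_single (hs : 0 < s) (x : Space) (a : Fin 3) :
    HasFDerivAt (hypPoint s) (fderiv ℝ (hypPoint s) x) x ∧
      fderiv ℝ (hypPoint s) x (EuclideanSpace.single a 1) =
        (x a / (hypPoint s x).1, EuclideanSpace.single a 1) := by
  have hd : DifferentiableAt ℝ (hypPoint s) x :=
    (contDiff_hypPoint hs (n := 1)).contDiffAt.differentiableAt (by norm_num)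
  refine ⟨hd.hasFDerivAt, ?_⟩
  have h1 : HasFDerivAt (fun y : Space => s ^ 2 + ‖y‖ ^ 2) (2 • innerSL ℝ x) x :=
    (hasStrictFDerivAt_norm_sq x).hasFDerivAt.const_add _
  have h2 := (h1.sqrt (by positivity)).prodMk (hasFDerivAt_id (𝕜 := ℝ) x)
  have h3 : HasFDerivAt (hypPoint s) _ x := h2
  rw [h3.fderiv]
  have hin : inner ℝ x (EuclideanSpace.single a (1 : ℝ)) = x a := by
    rw [EuclideanSpace.inner_single_right]; simp
  refine Prod.ext ?_ (by simp)
  simp [hypPoint, hin]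
  field_simp

/-- The boosts are tangent to the hyperboloids: the derivative along `e_a` of the restriction of
`f` to `ℋ_s` is the restriction of `t⁻¹ L_a f`. -/
lemma fderiv_restrictHyp (hN : SlabNhd s₁ U) (hs : s ∈ Set.Icc 2 s₁) (hf : Reg s₁ U (k + 1) f)
    (x : Space) (a : Fin 3) :
    fderiv ℝ (restrictHyp s f) x (EuclideanSpace.single a 1) =
      restrictHyp s (boost a f) x / (hypPoint s x).1 := by
  have hs0 : 0 < s := by linarith [hs.1]
  by_cases hx : x ∈ hypSlice s
  · have hfx : DifferentiableAt ℝ f (hypPoint s x) :=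
      ContDiffOn.differentiableAt_of_isOpen hN.isOpen k.succ_ne_zero hf.contDiffOn
        (hN.slab_subset (hypPoint_mem_slab hs hx))
    obtain ⟨h1, h2⟩ := fderiv_hypPoint_single hs0 x a
    rw [(restrictHyp_eventuallyEq hs0 f hx).fderiv_eq, restrictHyp_of_mem _ hx]
    have h3 := (hfx.hasFDerivAt.comp x h1).fderiv
    have h4 : fderiv ℝ (fun y => f (hypPoint s y)) x = _ := h3
    rw [h4, ContinuousLinearMap.comp_apply, h2]
    have hpos := hypPoint_fst_pos hs0 x
    have e : ((x a / (hypPoint s x).1, EuclideanSpace.single a 1) : Spacetime) =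
        (x a / (hypPoint s x).1) • frame 0 + frame a.succ := by
      rw [frame_zero, frame_succ]
      simp
    rw [e, map_add, map_smul, boost, partialD, partialD]
    change x a / _ * _ + _ = (x a * _ + _) / _
    field_simp
  · rw [(restrictHyp_eventuallyEq_zero hs hf.vanishes hx).fderiv_eq, restrictHyp_of_notMem _ hx]
    simp

lemma restrictHyp_sq (f : Spacetime → ℝ) (x : Space) :
    restrictHyp s f x ^ 2 = restrictHyp s (fun p => f p ^ 2) x := by
  by_cases hx : x ∈ hypSlice s
  · simp [restrictHyp_of_mem _ hx]
  · simp [restrictHyp_of_notMem _ hx]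

/-- The square of the `L²` norm on `ℋ_s`, as a Bochner integral. -/
noncomputable def hypSq (s : ℝ) (f : Spacetime → ℝ) : ℝ := ∫ x in hypSlice s, f (hypPoint s x) ^ 2

lemma hypSq_nonneg (s : ℝ) (f : Spacetime → ℝ) : 0 ≤ hypSq s f :=
  integral_nonneg fun _ => sq_nonneg _

lemma hypSq_eq_integral (hs : 0 < s) (f : Spacetime → ℝ) :
    hypSq s f = ∫ x, restrictHyp s f x ^ 2 := by
  simp only [restrictHyp_sq]
  exact (integral_indicator (isOpen_hypSlice hs).measurableSet).symm

lemma continuous_restrictHyp (hN : SlabNhd s₁ U) (hs : s ∈ Set.Icc 2 s₁) (hf : Reg s₁ U 0 f) :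
    Continuous (restrictHyp s f) :=
  (contDiff_restrictHyp hN hs hf).continuous

lemma integrableOn_sq (hN : SlabNhd s₁ U) (hs : s ∈ Set.Icc 2 s₁) (hf : Reg s₁ U 0 f) :
    IntegrableOn (fun x => f (hypPoint s x) ^ 2) (hypSlice s) := by
  have hs0 : 0 < s := by linarith [hs.1]
  rw [← integrable_indicator_iff (isOpen_hypSlice hs0).measurableSet]
  have h : (hypSlice s).indicator (fun x => f (hypPoint s x) ^ 2) =
      restrictHyp s f * restrictHyp s f := by
    funext x
    rw [Pi.mul_apply, ← pow_two, restrictHyp_sq]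
    rfl
  rw [h]
  have hc := continuous_restrictHyp hN hs hf
  exact (hc.mul hc).integrable_of_hasCompactSupport
    (HasCompactSupport.mul_right (hasCompactSupport_restrictHyp s f))

/-- Comparison of `L²` norms on `ℋ_s` from a pointwise bound by a finite sum of squares. -/
lemma hypSq_le_sum (hN : SlabNhd s₁ U) (hs : s ∈ Set.Icc 2 s₁) {ι : Type*} (S : Finset ι)
    {F : ι → Spacetime → ℝ} (hf : Reg s₁ U 0 f) (hF : ∀ i ∈ S, Reg s₁ U 0 (F i)) (c : ι → ℝ)
    (h : ∀ x ∈ hypSlice s, f (hypPoint s x) ^ 2 ≤ ∑ i ∈ S, c i * F i (hypPoint s x) ^ 2) :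
    hypSq s f ≤ ∑ i ∈ S, c i * hypSq s (F i) := by
  have hs0 : 0 < s := by linarith [hs.1]
  have hint : ∀ i ∈ S, IntegrableOn (fun x => c i * F i (hypPoint s x) ^ 2) (hypSlice s) :=
    fun i hi => (integrableOn_sq hN hs (hF i hi)).const_mul _
  calc hypSq s f ≤ ∫ x in hypSlice s, ∑ i ∈ S, c i * F i (hypPoint s x) ^ 2 :=
        setIntegral_mono_on (integrableOn_sq hN hs hf) (integrable_finsetSum S hint)
          (isOpen_hypSlice hs0).measurableSet h
    _ = _ := by
        rw [integral_finsetSum S hint]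
        exact Finset.sum_congr rfl fun i _ => integral_const_mul _ _

end restrict

/-! ### A Hardy inequality on hyperboloids -/

/-- Hardy's inequality with the regular weight `(s² + |x|²)⁻¹`: integrate the divergence of the
vector field `W² x / (s² + |x|²)`, and use `div (x / (s² + |x|²)) ≥ (s² + |x|²)⁻¹`. -/
lemma hardy_inequality {s : ℝ} (hs : 0 < s) {W : Space → ℝ} (hW : ContDiff ℝ 1 W)
    (hc : HasCompactSupport W) :
    ∫ x, W x ^ 2 / (s ^ 2 + ‖x‖ ^ 2) ≤
      4 * ∑ a : Fin 3, ∫ x, (fderiv ℝ W x (EuclideanSpace.single a 1)) ^ 2 := by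
  let T : Space → ℝ := fun x => s ^ 2 + ‖x‖ ^ 2
  have hT : ∀ x, 0 < T x := fun x => by positivity
  have hTc : Continuous T := continuous_const.add (continuous_norm.pow 2)
  let D : Fin 3 → Space → ℝ := fun a x => fderiv ℝ W x (EuclideanSpace.single a 1)
  have hDc : ∀ a, Continuous (D a) := fun a =>
    (hW.continuous_fderiv one_ne_zero).clm_apply continuous_const
  have hcoord : ∀ a : Fin 3, Continuous fun x : Space => x a := fun a =>
    (EuclideanSpace.proj a : Space →L[ℝ] ℝ).continuous
  have hWc := hW.continuous
  have hWd : ∀ x, HasFDerivAt W (fderiv ℝ W x) x := fun x =>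
    (hW.differentiable one_ne_zero x).hasFDerivAt
  have hDs : ∀ a, HasCompactSupport (D a) := fun a => hc.fderiv_apply (𝕜 := ℝ) _
  have int1 : Integrable fun x => W x ^ 2 / T x := by
    have : (fun x => W x ^ 2 / T x) = fun x => W x * (W x / T x) := by
      funext x; ring
    rw [this]
    exact (hWc.mul (hWc.div hTc fun x => (hT x).ne')).integrable_of_hasCompactSupport hc.mul_right
  have int2 : ∀ a, Integrable fun x => D a x ^ 2 := by
    intro a
    simp only [pow_two]
    exact ((hDc a).mul (hDc a)).integrable_of_hasCompactSupport (hDs a).mul_right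
  have int3 : ∀ a, Integrable fun x => (1 / T x - 2 * x a ^ 2 / T x ^ 2) * W x ^ 2 := by
    intro a
    have : (fun x : Space => (1 / T x - 2 * x a ^ 2 / T x ^ 2) * W x ^ 2) =
        fun x => W x * (W x * (1 / T x - 2 * x a ^ 2 / T x ^ 2)) := by
      funext x; ring
    rw [this]
    refine (hWc.mul (hWc.mul ?_)).integrable_of_hasCompactSupport hc.mul_right
    exact (continuous_const.div hTc fun x => (hT x).ne').sub
      ((continuous_const.mul ((hcoord a).pow 2)).div (hTc.pow 2) fun x => (pow_pos (hT x) 2).ne')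
  have int4 : ∀ a, Integrable fun x => (x a / T x) * (2 * W x * D a x) := by
    intro a
    have : (fun x : Space => (x a / T x) * (2 * W x * D a x)) =
        fun x => W x * (2 * D a x * (x a / T x)) := by
      funext x; ring
    rw [this]
    refine (hWc.mul ((continuous_const.mul (hDc a)).mul ?_)).integrable_of_hasCompactSupport
      hc.mul_right
    exact (hcoord a).div hTc fun x => (hT x).ne'
  have hTd : ∀ x, HasFDerivAt T (2 • innerSL ℝ x) x := fun x =>
    (hasStrictFDerivAt_norm_sq x).hasFDerivAt.const_add _
  have hin : ∀ (x : Space) (a : Fin 3), inner ℝ x (EuclideanSpace.single a (1 : ℝ)) = x a := by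
    intro x a
    rw [EuclideanSpace.inner_single_right]; simp
  have hXd : ∀ (a : Fin 3) (x : Space), DifferentiableAt ℝ (fun y : Space => y a / T y) x ∧
      fderiv ℝ (fun y : Space => y a / T y) x (EuclideanSpace.single a 1) =
        1 / T x - 2 * x a ^ 2 / T x ^ 2 := by
    intro a x
    have h1 : HasFDerivAt (fun y : Space => y a) (EuclideanSpace.proj a : Space →L[ℝ] ℝ) x :=
      (EuclideanSpace.proj a : Space →L[ℝ] ℝ).hasFDerivAt
    have h2 : HasFDerivAt (fun y : Space => y a / T y) _ x :=
      h1.mul ((hasDerivAt_inv (hT x).ne').comp_hasFDerivAt x (hTd x))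
    refine ⟨h2.differentiableAt, ?_⟩
    have := hT x
    rw [h2.fderiv]
    simp [hin]
    field_simp
    ring
  have hW2 : ∀ (a : Fin 3) (x : Space), DifferentiableAt ℝ (fun y => W y ^ 2) x ∧
      fderiv ℝ (fun y => W y ^ 2) x (EuclideanSpace.single a 1) = 2 * W x * D a x := by
    intro a x
    have h2 := (hWd x).pow 2
    refine ⟨h2.differentiableAt, ?_⟩
    rw [h2.fderiv]
    simp [D]
  have ibp : ∀ a : Fin 3, ∫ x, (x a / T x) * (2 * W x * D a x) =
      -∫ x, (1 / T x - 2 * x a ^ 2 / T x ^ 2) * W x ^ 2 := by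
    intro a
    have h := integral_mul_fderiv_eq_neg_fderiv_mul_of_integrable
      (μ := (volume : Measure Space)) (f := fun x : Space => x a / T x) (g := fun x => W x ^ 2)
      (v := EuclideanSpace.single a 1) ?_ ?_ ?_ (fun x _ => (hXd a x).1) (fun x _ => (hW2 a x).1)
    · simpa only [(hXd a _).2, (hW2 a _).2] using h
    · simpa only [(hXd a _).2] using int3 a
    · simpa only [(hW2 a _).2] using int4 a
    · have : (fun x : Space => x a / T x * W x ^ 2) = fun x => W x * (W x * (x a / T x)) := by
        funext x; ring
      rw [this]
      have hc1 := hWc.mul (hWc.mul ((hcoord a).div hTc fun x => (hT x).ne'))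
      exact hc1.integrable_of_hasCompactSupport hc.mul_right
  have hnorm : ∀ x : Space, ‖x‖ ^ 2 = ∑ a : Fin 3, x a ^ 2 := EuclideanSpace.real_norm_sq_eq
  have low : ∫ x, W x ^ 2 / T x ≤
      ∑ a : Fin 3, ∫ x, (1 / T x - 2 * x a ^ 2 / T x ^ 2) * W x ^ 2 := by
    rw [← integral_finsetSum _ fun a _ => int3 a]
    refine integral_mono int1 (integrable_finsetSum _ fun a _ => int3 a) fun x => ?_
    have h1 : ∑ a : Fin 3, (1 / T x - 2 * x a ^ 2 / T x ^ 2) * W x ^ 2 =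
        W x ^ 2 / T x + 2 * (s ^ 2 / T x ^ 2) * W x ^ 2 := by
      have hTx : T x = s ^ 2 + (x 0 ^ 2 + x 1 ^ 2 + x 2 ^ 2) := by
        simp only [T, hnorm, Fin.sum_univ_three]
      have hne := (hT x).ne'
      rw [Fin.sum_univ_three]
      field_simp
      rw [hTx]; ring
    simp only [h1]
    have := hT x
    have : 0 ≤ 2 * (s ^ 2 / T x ^ 2) * W x ^ 2 := by positivity
    linarith
  have up : -∑ a : Fin 3, ∫ x, (x a / T x) * (2 * W x * D a x) ≤
      (1 / 2) * (∫ x, W x ^ 2 / T x) + 2 * ∑ a : Fin 3, ∫ x, D a x ^ 2 := by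
    rw [← integral_finsetSum _ fun a _ => int4 a, ← integral_neg, ← integral_const_mul,
      ← integral_finsetSum _ fun a _ => int2 a, ← integral_const_mul, ← integral_add
        (int1.const_mul _) ((integrable_finsetSum _ fun a _ => int2 a).const_mul _)]
    refine integral_mono (integrable_finsetSum _ fun a _ => int4 a).neg
      ((int1.const_mul _).add ((integrable_finsetSum _ fun a _ => int2 a).const_mul _)) fun x => ?_
    have hTx : T x = s ^ 2 + (x 0 ^ 2 + x 1 ^ 2 + x 2 ^ 2) := by
      simp only [T, hnorm, Fin.sum_univ_three]
    have hp := hT x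
    simp only [Fin.sum_univ_three]
    set d0 := D 0 x
    set d1 := D 1 x
    set d2 := D 2 x
    -- Young's inequality and Cauchy–Schwarz for `x · ∇W`
    have e : (1 / 2 * (W x ^ 2 / T x) + 2 * (d0 ^ 2 + d1 ^ 2 + d2 ^ 2)) -
        -(x 0 / T x * (2 * W x * d0) + x 1 / T x * (2 * W x * d1) + x 2 / T x * (2 * W x * d2)) =
        ((W x + 2 * (x 0 * d0 + x 1 * d1 + x 2 * d2)) ^ 2 +
          4 * (T x * (d0 ^ 2 + d1 ^ 2 + d2 ^ 2) - (x 0 * d0 + x 1 * d1 + x 2 * d2) ^ 2)) /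
          (2 * T x) := by
      field_simp
      ring
    have cs : 0 ≤ T x * (d0 ^ 2 + d1 ^ 2 + d2 ^ 2) - (x 0 * d0 + x 1 * d1 + x 2 * d2) ^ 2 := by
      rw [hTx]
      nlinarith [sq_nonneg (x 0 * d1 - x 1 * d0), sq_nonneg (x 0 * d2 - x 2 * d0),
        sq_nonneg (x 1 * d2 - x 2 * d1), mul_nonneg (sq_nonneg s) (sq_nonneg d0),
        mul_nonneg (sq_nonneg s) (sq_nonneg d1), mul_nonneg (sq_nonneg s) (sq_nonneg d2)]
    have : 0 ≤ (1 / 2 * (W x ^ 2 / T x) + 2 * (d0 ^ 2 + d1 ^ 2 + d2 ^ 2)) -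
        -(x 0 / T x * (2 * W x * d0) + x 1 / T x * (2 * W x * d1) +
          x 2 / T x * (2 * W x * d2)) := by
      rw [e]; positivity
    linarith
  have hsum : ∑ a : Fin 3, ∫ x, (1 / T x - 2 * x a ^ 2 / T x ^ 2) * W x ^ 2 =
      -∑ a : Fin 3, ∫ x, (x a / T x) * (2 * W x * D a x) := by
    simp only [ibp, Finset.sum_neg_distrib, neg_neg]
  change ∫ x, W x ^ 2 / T x ≤ 4 * ∑ a : Fin 3, ∫ x, D a x ^ 2
  linarith

section

variable {s s₁ : ℝ} {U : Set Spacetime} {k : ℕ} {f g : Spacetime → ℝ}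

/-- The function `c t^{-m} f`. The weights that occur are `s³/t² = s (s/t)²`, for derivatives
transversal to the hyperboloids, and `s/t`, for boosts and for the function itself. -/
noncomputable def weighted (c : ℝ) (m : ℕ) (f : Spacetime → ℝ) : Spacetime → ℝ :=
  fun p => c * (p.1 ^ m)⁻¹ * f p

lemma Reg.weighted (hN : SlabNhd s₁ U) (c : ℝ) (m : ℕ) (hf : Reg s₁ U k f) :
    Reg s₁ U k (weighted c m f) :=
  Reg.mul (contDiffOn_const.mul (contDiffOn_time_inv_pow hN m)) hf

/-- Hardy's inequality on `ℋ_s`: as `t² = s² + |x|²` there, the weight is `t⁻²`. -/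
lemma hypSq_hardy (hN : SlabNhd s₁ U) (hs : s ∈ Set.Icc 2 s₁) (hf : Reg s₁ U 1 f) :
    hypSq s (weighted s 1 f) ≤ 4 * ∑ a : Fin 3, hypSq s (weighted s 1 (boost a f)) := by
  have hs0 : 0 < s := by linarith [hs.1]
  have h := hardy_inequality hs0 (contDiff_restrictHyp hN hs hf)
    (hasCompactSupport_restrictHyp s f)
  have e1 : hypSq s (weighted s 1 f) =
      s ^ 2 * ∫ x, restrictHyp s f x ^ 2 / (s ^ 2 + ‖x‖ ^ 2) := by
    rw [hypSq_eq_integral hs0, ← integral_const_mul]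
    congr 1
    funext x
    rw [← hypPoint_fst_sq]
    by_cases hx : x ∈ hypSlice s
    · simp only [restrictHyp_of_mem _ hx, weighted]
      have := hypPoint_fst_pos hs0 x
      field_simp
    · simp [restrictHyp_of_notMem _ hx]
  have e2 : ∀ a : Fin 3, hypSq s (weighted s 1 (boost a f)) =
      s ^ 2 * ∫ x, (fderiv ℝ (restrictHyp s f) x (EuclideanSpace.single a 1)) ^ 2 := by
    intro a
    rw [hypSq_eq_integral hs0, ← integral_const_mul]
    congr 1
    funext x
    rw [fderiv_restrictHyp hN hs (k := 0) hf]
    by_cases hx : x ∈ hypSlice s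
    · simp only [restrictHyp_of_mem _ hx, weighted]
      have := hypPoint_fst_pos hs0 x
      field_simp
    · simp [restrictHyp_of_notMem _ hx]
  simp only [e2]
  rw [e1, ← Finset.mul_sum]
  nlinarith [mul_le_mul_of_nonneg_left h (sq_nonneg s)]

/-! ### What the conformal energy controls -/

lemma hypDa_eq (a : Fin 3) (f : Spacetime → ℝ) {p : Spacetime} (hp : p.1 ≠ 0) :
    hypDa a f p = boost a f p / p.1 := by
  rw [hypDa, boost]; field_simp

/-- The zeroth order part `K f + 2 f` of the conformal energy, with the hyperbolic time frozen to
the constant `s`. -/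
noncomputable def confPart (s : ℝ) (f : Spacetime → ℝ) : Spacetime → ℝ := fun p =>
  weighted (s ^ 2) 1 (partialD 0 f) p +
    (∑ a : Fin 3, 2 * (p.2 a * weighted 1 1 (boost a f) p) + 2 * f p)

lemma confPart_eq (hs : 0 < s) (f : Spacetime → ℝ) (x : Space) :
    confPart s f (hypPoint s x) = confK f (hypPoint s x) + 2 * f (hypPoint s x) := by
  have hne := (hypPoint_fst_pos hs x).ne'
  simp only [confPart, confK, hypDs, hypTime_hypPoint hs.le, hypDa_eq _ _ hne, weighted,
    Fin.sum_univ_three]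
  field_simp
  ring

lemma reg_confPart (hN : SlabNhd s₁ U) (hf : Reg s₁ U 1 f) : Reg s₁ U 0 (confPart s f) :=
  ((hf.partialD hN 0).weighted hN _ _).add
    ((Reg.sum _ fun a _ => ((Reg.mul (contDiff_coord a).contDiffOn
      ((Reg.derivation hN (Sum.inr a) hf).weighted hN 1 1)).const_mul 2)).add
      ((hf.of_le zero_le_one).const_mul 2))

lemma energy_controls (hN : SlabNhd s₁ U) (hs : s ∈ Set.Icc 2 s₁) (hf : Reg s₁ U 1 f) {A : ℝ}
    (hA : 0 ≤ A) (hE : confEnergy s f ^ (1 / 2 : ℝ) ≤ ENNReal.ofReal A) :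
    hypSq s (confPart s f) + ∑ a : Fin 3, hypSq s (weighted s 1 (boost a f)) ≤ A ^ 2 := by
  have hs0 : 0 < s := by linarith [hs.1]
  have hE' : confEnergy s f ≤ ENNReal.ofReal (A ^ 2) := by
    have := ENNReal.rpow_le_rpow hE (z := 2) (by norm_num)
    rwa [← ENNReal.rpow_mul, ENNReal.ofReal_rpow_of_nonneg hA (by norm_num),
      show (1 / 2 : ℝ) * 2 = 1 by norm_num, ENNReal.rpow_one, Real.rpow_two] at this
  have hb : ∀ a : Fin 3, Reg s₁ U 0 (weighted s 1 (boost a f)) := fun a =>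
    (Reg.derivation hN (Sum.inr a) hf).weighted hN _ _
  have i1 := integrableOn_sq hN hs (reg_confPart (s := s) hN hf)
  have i2 := fun a : Fin 3 => integrableOn_sq hN hs (hb a)
  have e : confEnergy s f = ∫⁻ x in hypSlice s, ENNReal.ofReal
      (confPart s f (hypPoint s x) ^ 2 +
        ∑ a : Fin 3, weighted s 1 (boost a f) (hypPoint s x) ^ 2) := by
    rw [confEnergy]
    congr 1
    funext x
    have hne := (hypPoint_fst_pos hs0 x).ne'
    have h2 : ∀ a : Fin 3, s * hypDa a f (hypPoint s x) =
        weighted s 1 (boost a f) (hypPoint s x) := by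
      intro a
      rw [hypDa_eq _ _ hne, weighted]
      field_simp
    rw [confPart_eq hs0]
    simp only [h2]
  have i3 : IntegrableOn (fun x => confPart s f (hypPoint s x) ^ 2 +
      ∑ a : Fin 3, weighted s 1 (boost a f) (hypPoint s x) ^ 2) (hypSlice s) :=
    i1.add (integrable_finsetSum _ fun a _ => i2 a)
  rw [e, ← ofReal_integral_eq_lintegral_ofReal i3 (Eventually.of_forall fun x => by positivity),
    ENNReal.ofReal_le_ofReal_iff (by positivity)] at hE'
  have h3 := integral_add i1 (integrable_finsetSum Finset.univ fun a _ => i2 a)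
  rw [integral_finsetSum _ fun a _ => i2 a] at h3
  exact h3.symm.le.trans hE'

lemma div_mul_sq_le {c t : ℝ} (ht : 0 < t) (hc : c ^ 2 ≤ t ^ 2) (y : ℝ) :
    ((c / t) * y) ^ 2 ≤ y ^ 2 := by
  rw [mul_pow, div_pow]
  exact mul_le_of_le_one_left (sq_nonneg _) ((div_le_one (by positivity)).mpr hc)

lemma transversal_sq_le {s t x₀ x₁ x₂ : ℝ} (ht : 0 < t) (hs : 0 ≤ s) (hst : s ≤ t)
    (h₀ : x₀ ^ 2 ≤ t ^ 2) (h₁ : x₁ ^ 2 ≤ t ^ 2) (h₂ : x₂ ^ 2 ≤ t ^ 2) (D b₀ b₁ b₂ w : ℝ) :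
    (s ^ 3 * (t ^ 2)⁻¹ * D) ^ 2 ≤
      20 * (s * (t ^ 1)⁻¹ * b₀) ^ 2 + 20 * (s * (t ^ 1)⁻¹ * b₁) ^ 2 +
        20 * (s * (t ^ 1)⁻¹ * b₂) ^ 2 +
      (5 * (s ^ 2 * (t ^ 1)⁻¹ * D + (2 * (x₀ * (1 * (t ^ 1)⁻¹ * b₀)) +
          2 * (x₁ * (1 * (t ^ 1)⁻¹ * b₁)) + 2 * (x₂ * (1 * (t ^ 1)⁻¹ * b₂)) + 2 * w)) ^ 2 +
        20 * (s * (t ^ 1)⁻¹ * w) ^ 2) := by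
  obtain ⟨E, hE⟩ : ∃ E, E = s ^ 2 * (t ^ 1)⁻¹ * D + (2 * (x₀ * (1 * (t ^ 1)⁻¹ * b₀)) +
    2 * (x₁ * (1 * (t ^ 1)⁻¹ * b₁)) + 2 * (x₂ * (1 * (t ^ 1)⁻¹ * b₂)) + 2 * w) := ⟨_, rfl⟩
  have key : s ^ 3 * (t ^ 2)⁻¹ * D = (s / t) * E - 2 * ((x₀ / t) * (s * (t ^ 1)⁻¹ * b₀)) -
      2 * ((x₁ / t) * (s * (t ^ 1)⁻¹ * b₁)) - 2 * ((x₂ / t) * (s * (t ^ 1)⁻¹ * b₂)) -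
      2 * (s * (t ^ 1)⁻¹ * w) := by
    rw [hE]; field_simp; ring
  have five : ∀ y₀ y₁ y₂ y₃ y₄ : ℝ, (y₀ - 2 * y₁ - 2 * y₂ - 2 * y₃ - 2 * y₄) ^ 2 ≤
      5 * y₀ ^ 2 + 20 * y₁ ^ 2 + 20 * y₂ ^ 2 + 20 * y₃ ^ 2 + 20 * y₄ ^ 2 := by
    intro y₀ y₁ y₂ y₃ y₄
    linarith [sq_nonneg (y₀ + 2 * y₁), sq_nonneg (y₀ + 2 * y₂), sq_nonneg (y₀ + 2 * y₃),
      sq_nonneg (y₀ + 2 * y₄), sq_nonneg (y₁ - y₂), sq_nonneg (y₁ - y₃), sq_nonneg (y₁ - y₄),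
      sq_nonneg (y₂ - y₃), sq_nonneg (y₂ - y₄), sq_nonneg (y₃ - y₄)]
  have k := div_mul_sq_le ht (pow_le_pow_left₀ hs hst 2) E
  have k₀ := div_mul_sq_le ht h₀ (s * (t ^ 1)⁻¹ * b₀)
  have k₁ := div_mul_sq_le ht h₁ (s * (t ^ 1)⁻¹ * b₁)
  have k₂ := div_mul_sq_le ht h₂ (s * (t ^ 1)⁻¹ * b₂)
  rw [← hE, key]
  have := five (s / t * E) (x₀ / t * (s * (t ^ 1)⁻¹ * b₀)) (x₁ / t * (s * (t ^ 1)⁻¹ * b₁))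
    (x₂ / t * (s * (t ^ 1)⁻¹ * b₂)) (s * (t ^ 1)⁻¹ * w)
  linarith

lemma tangential_sq_le {s t x : ℝ} (ht : 0 < t) (hs : 0 ≤ s) (hst : s ≤ t) (h : x ^ 2 ≤ t ^ 2)
    (D Da : ℝ) :
    (s ^ 3 * (t ^ 2)⁻¹ * Da) ^ 2 ≤ 2 * (s * (t ^ 1)⁻¹ * (x * D + t * Da)) ^ 2 +
      2 * (s ^ 3 * (t ^ 2)⁻¹ * D) ^ 2 := by
  obtain ⟨b, hb⟩ : ∃ b, b = s * (t ^ 1)⁻¹ * (x * D + t * Da) := ⟨_, rfl⟩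
  have key : s ^ 3 * (t ^ 2)⁻¹ * Da = (s / t) * ((s / t) * b) -
      (x / t) * (s ^ 3 * (t ^ 2)⁻¹ * D) := by
    rw [hb]; field_simp; ring
  have hst2 := pow_le_pow_left₀ hs hst 2
  have k₁ := div_mul_sq_le ht h (s ^ 3 * (t ^ 2)⁻¹ * D)
  have k₂ := (div_mul_sq_le ht hst2 ((s / t) * b)).trans (div_mul_sq_le ht hst2 b)
  have two : ∀ y z : ℝ, (y - z) ^ 2 ≤ 2 * y ^ 2 + 2 * z ^ 2 := fun y z => by
    linarith [sq_nonneg (y + z)]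
  rw [← hb]
  have := two ((s / t) * ((s / t) * b)) ((x / t) * (s ^ 3 * (t ^ 2)⁻¹ * D))
  rw [← key] at this
  linarith

/-- The conformal energy controls `‖s (s/t)² ∂_α f‖` on `ℋ_s`: the Hardy inequality bounds the
zeroth order term of `K f + 2 f`, and then `K f + 2 f` itself yields the transversal derivative. -/
lemma hypSq_partialD_le (hN : SlabNhd s₁ U) (hs : s ∈ Set.Icc 2 s₁) (hf : Reg s₁ U 1 f) {A : ℝ}
    (hA : 0 ≤ A) (hE : confEnergy s f ^ (1 / 2 : ℝ) ≤ ENNReal.ofReal A) (α : Fin 4) :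
    hypSq s (weighted (s ^ 3) 2 (partialD α f)) ≤ 250 * A ^ 2 := by
  have hs0 : 0 < s := by linarith [hs.1]
  have hen := energy_controls hN hs hf hA hE
  have hH := hypSq_hardy hN hs hf
  have hb : ∀ a : Fin 3, Reg s₁ U 0 (weighted s 1 (boost a f)) := fun a =>
    (Reg.derivation hN (Sum.inr a) hf).weighted hN _ _
  have hp : ∀ α, Reg s₁ U 0 (weighted (s ^ 3) 2 (partialD α f)) := fun α =>
    (hf.partialD hN α).weighted hN _ _
  have hw : Reg s₁ U 0 (weighted s 1 f) := (hf.of_le zero_le_one).weighted hN _ _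
  have hcp := reg_confPart (s := s) hN hf
  have hnn := fun a : Fin 3 => hypSq_nonneg s (weighted s 1 (boost a f))
  have hcn := hypSq_nonneg s (confPart s f)
  have hcoord : ∀ (x : Space) (a : Fin 3), x a ^ 2 ≤ (hypPoint s x).1 ^ 2 := by
    intro x a
    rw [hypPoint_fst_sq, EuclideanSpace.real_norm_sq_eq]
    have := Finset.single_le_sum (f := fun a : Fin 3 => x a ^ 2) (fun _ _ => sq_nonneg _)
      (Finset.mem_univ a)
    nlinarith [sq_nonneg s]
  have h0 : hypSq s (weighted (s ^ 3) 2 (partialD 0 f)) ≤ 5 * hypSq s (confPart s f) +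
      (20 * ∑ a : Fin 3, hypSq s (weighted s 1 (boost a f)) + 20 * hypSq s (weighted s 1 f)) := by
    have := hypSq_le_sum hN hs (ι := Fin 3 ⊕ Bool) Finset.univ
      (F := Sum.elim (fun a => weighted s 1 (boost a f))
        fun b => cond b (confPart s f) (weighted s 1 f)) (hp 0)
      (by rintro (a | _ | _) _; exacts [hb a, hw, hcp])
      (Sum.elim (fun _ => 20) fun b => cond b 5 20) (by
        intro x hx
        have ht := hypPoint_fst_pos hs0 x
        have hst := le_hypPoint_fst s x
        have hc0 := hcoord x 0
        have hc1 := hcoord x 1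
        have hc2 := hcoord x 2
        simp only [Fintype.sum_sum_type, Sum.elim_inl, Sum.elim_inr, Fintype.sum_bool, cond_true,
          cond_false]
        simp only [confPart, weighted, Fin.sum_univ_three]
        have hx2 : ∀ a, (hypPoint s x).2 a = x a := fun a => rfl
        simp only [hx2]
        exact transversal_sq_le ht hs0.le hst hc0 hc1 hc2 _ _ _ _ _)
    simp only [Fintype.sum_sum_type, Sum.elim_inl, Sum.elim_inr, Fintype.sum_bool, cond_true,
      cond_false, ← Finset.mul_sum] at this
    linarith
  have hsum : 0 ≤ ∑ a : Fin 3, hypSq s (weighted s 1 (boost a f)) :=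
    Finset.sum_nonneg fun a _ => hnn a
  have h0' : hypSq s (weighted (s ^ 3) 2 (partialD 0 f)) ≤ 100 * A ^ 2 := by nlinarith
  refine Fin.cases (by nlinarith [sq_nonneg A]) (fun a => ?_) α
  have h1 : hypSq s (weighted (s ^ 3) 2 (partialD a.succ f)) ≤
      2 * hypSq s (weighted s 1 (boost a f)) +
        2 * hypSq s (weighted (s ^ 3) 2 (partialD 0 f)) := by
    have := hypSq_le_sum hN hs (ι := Bool) Finset.univ
      (F := fun b => cond b (weighted s 1 (boost a f)) (weighted (s ^ 3) 2 (partialD 0 f)))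
      (hp a.succ) (by rintro (_ | _) _; exacts [hp 0, hb a]) (fun _ => 2) (by
        intro x hx
        have ht := hypPoint_fst_pos hs0 x
        have hst := le_hypPoint_fst s x
        have hca := hcoord x a
        simp only [Fintype.sum_bool, cond_true, cond_false, weighted]
        exact tangential_sq_le ht hs0.le hst hca _ _)
    simpa only [Fintype.sum_bool, cond_true, cond_false] using this
  have h2 : hypSq s (weighted s 1 (boost a f)) ≤
      ∑ a : Fin 3, hypSq s (weighted s 1 (boost a f)) :=
    Finset.single_le_sum (f := fun a : Fin 3 => hypSq s (weighted s 1 (boost a f)))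
      (fun a _ => hnn a) (Finset.mem_univ a)
  nlinarith [sq_nonneg A]

lemma hypSq_boost_le (hN : SlabNhd s₁ U) (hs : s ∈ Set.Icc 2 s₁) (hf : Reg s₁ U 1 f) {A : ℝ}
    (hA : 0 ≤ A) (hE : confEnergy s f ^ (1 / 2 : ℝ) ≤ ENNReal.ofReal A) (a : Fin 3) :
    hypSq s (weighted s 1 (boost a f)) ≤ A ^ 2 := by
  have hen := energy_controls hN hs hf hA hE
  have h2 : hypSq s (weighted s 1 (boost a f)) ≤
      ∑ a : Fin 3, hypSq s (weighted s 1 (boost a f)) :=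
    Finset.single_le_sum (f := fun a : Fin 3 => hypSq s (weighted s 1 (boost a f)))
      (fun a _ => hypSq_nonneg s _) (Finset.mem_univ a)
  linarith [hypSq_nonneg s (confPart s f)]

end

/-! ### A Sobolev inequality on hyperboloids -/

/-- The partial derivative `∂_a W` on `ℝ³`. -/
noncomputable def dirD (a : Fin 3) (W : Space → ℝ) : Space → ℝ :=
  fun x => fderiv ℝ W x (EuclideanSpace.single a 1)

lemma contDiff_dirD (a : Fin 3) {n : ℕ} {W : Space → ℝ} (hW : ContDiff ℝ (n + 1 : ℕ) W) :
    ContDiff ℝ n (dirD a W) :=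
  (hW.fderiv_right (m := n) (by norm_cast)).clm_apply contDiff_const

lemma hasCompactSupport_dirD (a : Fin 3) {W : Space → ℝ} (hc : HasCompactSupport W) :
    HasCompactSupport (dirD a W) := hc.fderiv_apply (𝕜 := ℝ) _

/-- For a compactly supported function of one variable, the value at `a` is bounded by the integral
of the derivative over the half line from `a` that leads away from the origin. -/
lemma enorm_le_lintegral_outward {h : ℝ → ℝ} (hh : ContDiff ℝ 1 h) (hc : HasCompactSupport h)
    (a : ℝ) : ‖h a‖ₑ ≤ ∫⁻ ξ, {ξ : ℝ | |a| ≤ |ξ|}.indicator (fun ξ => ‖deriv h ξ‖ₑ) ξ := by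
  have hm : MeasurableSet {ξ : ℝ | |a| ≤ |ξ|} :=
    (isClosed_le continuous_const continuous_abs).measurableSet
  rw [lintegral_indicator hm]
  rcases le_total a 0 with ha | ha
  · refine (HasCompactSupport.enorm_le_lintegral_Ici_deriv hh hc a).trans
      (lintegral_mono_set fun ξ hξ => ?_)
    have hξ' : ξ ≤ a := hξ
    simp only [Set.mem_ofPred_eq, abs_of_nonpos ha, abs_of_nonpos (hξ'.trans ha)]
    linarith
  · have h1 := HasCompactSupport.integral_Ioi_deriv_eq hh hc a
    have h2 : ‖h a‖ₑ = ‖∫ ξ in Set.Ioi a, deriv h ξ‖ₑ := by rw [h1, enorm_neg]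
    rw [h2]
    refine (enorm_integral_le_lintegral_enorm _).trans (lintegral_mono_set fun ξ hξ => ?_)
    have hξ' : a < ξ := hξ
    simp only [Set.mem_ofPred_eq, abs_of_nonneg ha, abs_of_nonneg (ha.trans hξ'.le)]
    exact hξ'.le

lemma enorm_le_lintegral_update {F : Space → ℝ} (hF : ContDiff ℝ 1 F) (hc : HasCompactSupport F)
    (y : Fin 3 → ℝ) (i : Fin 3) :
    ‖F (WithLp.toLp 2 y)‖ₑ ≤ ∫⁻ ξ, {ξ : ℝ | |y i| ≤ |ξ|}.indicator
      (fun ξ => ‖dirD i F (WithLp.toLp 2 (Function.update y i ξ))‖ₑ) ξ := by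
  have hcurve : ∀ ξ, (WithLp.toLp 2 (Function.update y i ξ) : Space) =
      WithLp.toLp 2 y + (ξ - y i) • EuclideanSpace.single i (1 : ℝ) := by
    intro ξ
    ext j
    by_cases hj : j = i
    · subst hj; simp
    · simp [hj]
  have hcd : ContDiff ℝ 1 fun ξ : ℝ => (WithLp.toLp 2 (Function.update y i ξ) : Space) := by
    simp only [hcurve]
    exact contDiff_const.add ((contDiff_id.sub contDiff_const).smul contDiff_const)
  have hder : ∀ ξ : ℝ, HasDerivAt (fun ξ : ℝ => (WithLp.toLp 2 (Function.update y i ξ) : Space))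
      (EuclideanSpace.single i (1 : ℝ)) ξ := by
    intro ξ
    simp only [hcurve]
    simpa using (((hasDerivAt_id ξ).sub_const (y i)).smul_const
      (EuclideanSpace.single i (1 : ℝ) : Space)).const_add (WithLp.toLp 2 y)
  obtain ⟨R, hR⟩ := hc.isCompact.isBounded.subset_closedBall (0 : Space)
  have hsupp : HasCompactSupport fun ξ : ℝ => F (WithLp.toLp 2 (Function.update y i ξ)) := by
    refine HasCompactSupport.intro (isCompact_closedBall (0 : ℝ) R) fun ξ hξ => ?_
    by_contra hne
    have h1 := hR (subset_tsupport F (Function.mem_support.mpr hne))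
    refine hξ ?_
    rw [mem_closedBall_zero_iff] at h1 ⊢
    have := PiLp.norm_apply_le (WithLp.toLp 2 (Function.update y i ξ) : Space) i
    simp only [Function.update_self] at this
    exact this.trans h1
  have h := enorm_le_lintegral_outward (hF.comp hcd) hsupp (y i)
  have hd : ∀ ξ, deriv (F ∘ fun ξ : ℝ => (WithLp.toLp 2 (Function.update y i ξ) : Space)) ξ =
      dirD i F (WithLp.toLp 2 (Function.update y i ξ)) := by
    intro ξ
    exact ((hF.differentiable one_ne_zero _).hasFDerivAt.comp_hasDerivAt ξ (hder ξ)).deriv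
  simp only [hd] at h
  simpa using h

/-- Integrating the mixed third derivative over the part of the octant of `x` that lies farther
out than `x` in every coordinate direction. -/
lemma enorm_le_lintegral_octant {F : Space → ℝ} (hF : ContDiff ℝ 3 F) (hc : HasCompactSupport F)
    (x : Space) :
    ‖F x‖ₑ ≤ ∫⁻ y, {y : Space | ∀ i, |x i| ≤ |y i|}.indicator
      (fun y => ‖dirD 2 (dirD 1 (dirD 0 F)) y‖ₑ) y := by
  have hF0 : ContDiff ℝ 2 (dirD 0 F) := contDiff_dirD 0 (n := 2) hF
  have hF1 : ContDiff ℝ 1 (dirD 1 (dirD 0 F)) := contDiff_dirD 1 (n := 1) hF0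
  have hF2 : ContDiff ℝ 0 (dirD 2 (dirD 1 (dirD 0 F))) := contDiff_dirD 2 (n := 0) hF1
  have hc0 := hasCompactSupport_dirD 0 hc
  have hc1 := hasCompactSupport_dirD 1 hc0
  let B : Set Space := {y | ∀ i, |x i| ≤ |y i|}
  have hB : MeasurableSet B := by
    have : B = ⋂ i, {y : Space | |x i| ≤ |y i|} := by
      ext y; simp [B]
    rw [this]
    exact MeasurableSet.iInter fun i => (isClosed_le continuous_const
      (EuclideanSpace.proj i : Space →L[ℝ] ℝ).continuous.abs).measurableSet
  let H : Space → ENNReal := B.indicator fun y => ‖dirD 2 (dirD 1 (dirD 0 F)) y‖ₑ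
  have hH : Measurable H := (hF2.continuous.enorm.measurable).indicator hB
  let G : (Fin 3 → ℝ) → ENNReal := fun y => H (WithLp.toLp 2 y)
  have hG : Measurable G := hH.comp (PiLp.volume_preserving_toLp (Fin 3)).measurable
  have hint : ∫⁻ y, H y = ∫⁻ y, G y :=
    ((PiLp.volume_preserving_toLp (Fin 3)).lintegral_comp hH).symm
  change ‖F x‖ₑ ≤ ∫⁻ y, H y
  rw [hint, volume_pi, lintegral_eq_lmarginal_univ x.ofLp,
    show (Finset.univ : Finset (Fin 3)) = insert 0 (insert 1 {2}) by decide,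
    lmarginal_insert _ hG (by decide)]
  have e0 : F x = F (WithLp.toLp 2 x.ofLp) := rfl
  rw [e0]
  refine (enorm_le_lintegral_update (hF.of_le (by norm_num)) hc x.ofLp 0).trans
    (lintegral_mono fun ξ₀ => ?_)
  refine Set.indicator_apply_le' (fun h0 => ?_) fun _ => zero_le
  rw [lmarginal_insert _ hG (by decide)]
  refine (enorm_le_lintegral_update (hF0.of_le (by norm_num)) hc0 _ 1).trans
    (lintegral_mono fun ξ₁ => ?_)
  refine Set.indicator_apply_le' (fun h1 => ?_) fun _ => zero_le
  rw [lmarginal_singleton]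
  refine (enorm_le_lintegral_update hF1 hc1 _ 2).trans (lintegral_mono fun ξ₂ => ?_)
  refine Set.indicator_apply_le' (fun h2 => ?_) fun _ => zero_le
  refine le_of_eq (Set.indicator_of_mem (s := B)
    (f := fun y => ‖dirD 2 (dirD 1 (dirD 0 F)) y‖ₑ) ?_).symm
  intro i
  fin_cases i
  · simpa [Function.update] using h0
  · simpa [Function.update] using h1
  · simpa [Function.update] using h2

section

variable {s s₁ : ℝ} {U : Set Spacetime} {k : ℕ} {f g : Spacetime → ℝ}

/-- The hyperbolic derivative `t⁻¹ L_a f`, which restricts to `∂_a` on every hyperboloid. -/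
noncomputable def tangD (a : Fin 3) (f : Spacetime → ℝ) : Spacetime → ℝ := weighted 1 1 (boost a f)

lemma Reg.tangD (hN : SlabNhd s₁ U) (a : Fin 3) (hf : Reg s₁ U (k + 1) f) :
    Reg s₁ U k (tangD a f) := (Reg.derivation hN (Sum.inr a) hf).weighted hN _ _

lemma dirD_restrictHyp (hN : SlabNhd s₁ U) (hs : s ∈ Set.Icc 2 s₁) (hf : Reg s₁ U (k + 1) f)
    (a : Fin 3) : dirD a (restrictHyp s f) = restrictHyp s (tangD a f) := by
  funext x
  rw [dirD, fderiv_restrictHyp hN hs hf]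
  by_cases hx : x ∈ hypSlice s
  · simp only [restrictHyp_of_mem _ hx, tangD, weighted]
    field_simp
  · simp [restrictHyp_of_notMem _ hx]

/-- The boosts whose products occur in `∂₂∂₁∂₀ (W²)`. -/
def sobolevWords : Finset (List (Fin 3)) := {[], [0], [1], [2], [1, 0], [2, 0], [2, 1], [2, 1, 0]}

lemma length_le_of_mem_sobolevWords {J : List (Fin 3)} (hJ : J ∈ sobolevWords) : J.length ≤ 3 := by
  revert J; decide

lemma sum_sobolevWords (F : List (Fin 3) → ℝ) : ∑ J ∈ sobolevWords, F J =
    F [] + F [0] + F [1] + F [2] + F [1, 0] + F [2, 0] + F [2, 1] + F [2, 1, 0] := by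
  simp [sobolevWords]
  ring

lemma boost_mul (a : Fin 3) {p : Spacetime} (hf : DifferentiableAt ℝ f p)
    (hg : DifferentiableAt ℝ g p) :
    boost a (fun q => f q * g q) p = boost a f p * g p + f p * boost a g p :=
  derivation_mul (Sum.inr a) hf hg

lemma boost_add (a : Fin 3) {p : Spacetime} (hf : DifferentiableAt ℝ f p)
    (hg : DifferentiableAt ℝ g p) :
    boost a (fun q => f q + g q) p = boost a f p + boost a g p :=
  derivation_add (Sum.inr a) hf hg

lemma boost_const_mul (a : Fin 3) (c : ℝ) {p : Spacetime} (hf : DifferentiableAt ℝ f p) :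
    boost a (fun q => c * f q) p = c * boost a f p :=
  derivation_const_mul (Sum.inr a) c hf

lemma boost_congr (a : Fin 3) (hU : IsOpen U) (h : Set.EqOn f g U) :
    Set.EqOn (boost a f) (boost a g) U :=
  derivation_congr (Sum.inr a) hU h

lemma boost_time_inv_pow (a : Fin 3) (m : ℕ) {p : Spacetime} (hp : p.1 ≠ 0) :
    boost a (fun q => (q.1 ^ m)⁻¹) p = -(m * p.2 a * (p.1 ^ (m + 1))⁻¹) := by
  have h : ∀ α, partialD α (fun q : Spacetime => (q.1 ^ m)⁻¹) p =
      -(m * p.1 ^ (m - 1)) / (p.1 ^ m) ^ 2 * partialD α (fun q => q.1) p := by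
    intro α
    have h1 : HasFDerivAt (fun q : Spacetime => q.1) (ContinuousLinearMap.fst ℝ ℝ Space) p :=
      (ContinuousLinearMap.fst ℝ ℝ Space).hasFDerivAt
    have h2 : HasDerivAt (fun y : ℝ => (y ^ m)⁻¹) (-(m * p.1 ^ (m - 1)) / (p.1 ^ m) ^ 2) p.1 :=
      (hasDerivAt_pow m p.1).fun_inv (pow_ne_zero _ hp)
    have h3 := h2.comp_hasFDerivAt p h1
    have h4 : fderiv ℝ (fun q : Spacetime => (q.1 ^ m)⁻¹) p = _ := h3.fderiv
    rw [partialD, partialD, h4, h1.fderiv]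
    simp
  rw [boost, h, h, partialD_time, partialD_time]
  simp only [if_true, Fin.succ_ne_zero, if_false]
  rcases m with _ | m
  · simp
  · simp only [Nat.add_sub_cancel]
    field_simp
    ring

lemma boost_weighted (a : Fin 3) (m : ℕ) {p : Spacetime} (hp : p.1 ≠ 0)
    (hf : DifferentiableAt ℝ f p) :
    boost a (weighted 1 m f) p =
      (p.1 ^ m)⁻¹ * boost a f p - m * p.2 a * (p.1 ^ (m + 1))⁻¹ * f p := by
  have e : weighted 1 m f = fun q => (q.1 ^ m)⁻¹ * f q := by
    funext q; simp [weighted]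
  have hd : DifferentiableAt ℝ (fun q : Spacetime => (q.1 ^ m)⁻¹) p :=
    (differentiableAt_fst.pow m).inv (pow_ne_zero _ hp)
  rw [e, boost_mul a hd hf, boost_time_inv_pow a m hp]
  ring

/-- Three different hyperbolic derivatives in terms of boosts. -/
lemma tangD_tangD_tangD (hU : IsOpen U) (hUK : U ⊆ coneK) (hg : ContDiffOn ℝ 3 g U)
    {a b c : Fin 3} (hbc : b ≠ c) {p : Spacetime} (hp : p ∈ U) :
    p.1 ^ 3 * tangD c (tangD b (tangD a g)) p =
      boost c (boost b (boost a g)) p - 2 * (p.2 c / p.1) * boost b (boost a g) p -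
        (p.2 b / p.1) * boost c (boost a g) p +
        3 * ((p.2 b / p.1) * (p.2 c / p.1)) * boost a g p := by
  have hne : ∀ q ∈ U, q.1 ≠ 0 := fun q hq => by
    have := one_lt_time_of_mem_coneK (hUK hq); positivity
  have h1 : ContDiffOn ℝ 2 (boost a g) U := contDiffOn_derivation (Sum.inr a) hU hg
  have h2 : ContDiffOn ℝ 1 (boost b (boost a g)) U := contDiffOn_derivation (Sum.inr b) hU h1
  set h := boost a g
  have d1 : ∀ q ∈ U, DifferentiableAt ℝ h q := fun q hq =>
    ContDiffOn.differentiableAt_of_isOpen hU two_ne_zero h1 hq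
  have d2 : ∀ q ∈ U, DifferentiableAt ℝ (boost b h) q := fun q hq =>
    ContDiffOn.differentiableAt_of_isOpen hU one_ne_zero h2 hq
  have e1 : Set.EqOn (tangD b (tangD a g))
      (fun q => weighted 1 2 (boost b h) q + (-1) * (q.2 b * weighted 1 3 h q)) U := by
    intro q hq
    have := hne q hq
    change 1 * (q.1 ^ 1)⁻¹ * boost b (weighted 1 1 h) q = _
    rw [boost_weighted b 1 this (d1 q hq)]
    simp only [weighted]
    push_cast
    field_simp
    ring
  have hpne := hne p hp
  have hw : ∀ (m : ℕ) {u : Spacetime → ℝ}, DifferentiableAt ℝ u p →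
      DifferentiableAt ℝ (weighted 1 m u) p := fun m u hu =>
    (((differentiableAt_fst.pow m).inv (pow_ne_zero _ hpne)).const_mul 1).mul hu
  have hx : DifferentiableAt ℝ (fun q : Spacetime => q.2 b) p :=
    (contDiff_coord b (n := 1)).contDiffAt.differentiableAt (by norm_num)
  have hxb : boost c (fun q : Spacetime => q.2 b) p = 0 := by
    rw [boost, partialD_coord, partialD_coord]
    simp [(Fin.succ_ne_zero b).symm, Fin.succ_inj, hbc.symm]
  have e2 : boost c (tangD b (tangD a g)) p =
      boost c (weighted 1 2 (boost b h)) p + (-1) * (p.2 b * boost c (weighted 1 3 h) p) := by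
    have hd1 := hw 2 (d2 p hp)
    have hd2 := hw 3 (d1 p hp)
    rw [boost_congr c hU e1 hp]
    rw [boost_add c hd1 ((hx.fun_mul hd2).const_mul (-1)),
      boost_const_mul c (-1) (hx.fun_mul hd2), boost_mul c hx hd2, hxb]
    ring
  change p.1 ^ 3 * (1 * (p.1 ^ 1)⁻¹ * boost c (tangD b (tangD a g)) p) = _
  rw [e2, boost_weighted c 2 hpne (d2 p hp), boost_weighted c 3 hpne (d1 p hp)]
  push_cast
  field_simp
  ring

lemma abs_tangD_sq_le (hU : IsOpen U) (hUK : U ⊆ coneK) (hf : ContDiffOn ℝ 3 f U) {p : Spacetime}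
    (hp : p ∈ U) :
    p.1 ^ 3 * |tangD 2 (tangD 1 (tangD 0 fun q => f q * f q)) p| ≤
      7 * ∑ J ∈ sobolevWords, boostPow J f p ^ 2 := by
  have ht : 0 < p.1 := one_pos.trans (one_lt_time_of_mem_coneK (hUK hp))
  have c : ∀ a : Fin 3, |p.2 a / p.1| ≤ 1 := by
    intro a
    rw [abs_div, abs_of_pos ht, div_le_one ht]
    have h1 : ‖p.2‖ + 1 < p.1 := hUK hp
    have h2 := PiLp.norm_apply_le p.2 a
    rw [Real.norm_eq_abs] at h2
    linarith
  have hb : ∀ {n : ℕ} (a : Fin 3) {u : Spacetime → ℝ}, ContDiffOn ℝ (n + 1 : ℕ) u U →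
      ContDiffOn ℝ n (boost a u) U := fun a _ hu => contDiffOn_derivation (Sum.inr a) hU hu
  have dd : ∀ {n : ℕ} {u : Spacetime → ℝ}, ContDiffOn ℝ (n + 1 : ℕ) u U → ∀ q ∈ U,
      DifferentiableAt ℝ u q := fun hu q hq =>
    ContDiffOn.differentiableAt_of_isOpen hU (Nat.succ_ne_zero _) hu hq
  have hg : ContDiffOn ℝ 3 (fun q => f q * f q) U := hf.mul hf
  have f1 : ∀ a, ContDiffOn ℝ 2 (boost a f) U := fun a => hb (n := 2) a hf
  have f2 : ∀ a b, ContDiffOn ℝ 1 (boost b (boost a f)) U := fun a b => hb (n := 1) b (f1 a)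
  have s1 : ∀ a, Set.EqOn (boost a fun q => f q * f q) (fun q => 2 * (f q * boost a f q)) U := by
    intro a q hq
    rw [boost_mul a (dd (n := 2) hf q hq) (dd (n := 2) hf q hq)]
    ring
  have s2 : ∀ a b, Set.EqOn (boost b (boost a fun q => f q * f q))
      (fun q => 2 * (boost b f q * boost a f q + f q * boost b (boost a f) q)) U := by
    intro a b q hq
    have h1 := dd (n := 2) hf q hq
    have h2 := dd (n := 1) (f1 a) q hq
    rw [boost_congr b hU (s1 a) hq]
    rw [boost_const_mul b 2 (h1.fun_mul h2), boost_mul b h1 h2]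
  have s3 : boost 2 (boost 1 (boost 0 fun q => f q * f q)) p =
      2 * (boost 2 (boost 1 f) p * boost 0 f p + boost 1 f p * boost 2 (boost 0 f) p +
        (boost 2 f p * boost 1 (boost 0 f) p + f p * boost 2 (boost 1 (boost 0 f)) p)) := by
    have h0 := dd (n := 2) hf p hp
    have h1 := fun a => dd (n := 1) (f1 a) p hp
    have h2 := dd (n := 0) (f2 0 1) p hp
    rw [boost_congr 2 hU (s2 0 1) hp]
    rw [boost_const_mul 2 2 (((h1 1).fun_mul (h1 0)).fun_add (h0.fun_mul h2)),
      boost_add 2 ((h1 1).fun_mul (h1 0)) (h0.fun_mul h2), boost_mul 2 (h1 1) (h1 0),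
      boost_mul 2 h0 h2]
  have key := tangD_tangD_tangD hU hUK hg (a := 0) (b := 1) (c := 2) (by decide) hp
  have e : p.1 ^ 3 * |tangD 2 (tangD 1 (tangD 0 fun q => f q * f q)) p| =
      |p.1 ^ 3 * tangD 2 (tangD 1 (tangD 0 fun q => f q * f q)) p| := by
    rw [abs_mul, abs_of_pos (pow_pos ht 3)]
  rw [e, key, s3, s2 0 1 hp, s2 0 2 hp, s1 0 hp, sum_sobolevWords]
  simp only [boostPow, List.foldr_cons, List.foldr_nil]
  generalize boost 2 (boost 1 (boost 0 f)) p = f210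
  generalize boost 2 (boost 1 f) p = f21
  generalize boost 2 (boost 0 f) p = f20
  generalize boost 1 (boost 0 f) p = f10
  generalize boost 2 f p = f2'
  generalize boost 1 f p = f1'
  generalize boost 0 f p = f0'
  generalize f p = f'
  have y : ∀ u v : ℝ, |2 * (u * v)| ≤ u ^ 2 + v ^ 2 := by
    intro u v
    rw [abs_le]
    constructor <;> nlinarith [sq_nonneg (u + v), sq_nonneg (u - v)]
  have c1 := c 1
  have c2 := c 2
  generalize p.2 1 / p.1 = z1 at *
  generalize p.2 2 / p.1 = z2 at *
  have m : ∀ z w B : ℝ, |z| ≤ 1 → |w| ≤ B → |z * w| ≤ B := by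
    intro z w B hz hw
    rw [abs_mul]
    exact (mul_le_of_le_one_left (abs_nonneg _) hz).trans hw
  have hz : |z1 * z2| ≤ 1 := m _ _ _ c1 c2
  have t1 := abs_le.mp (y f21 f0')
  have t2 := abs_le.mp (y f1' f20)
  have t3 := abs_le.mp (y f2' f10)
  have t4 := abs_le.mp (y f' f210)
  have u1 := abs_le.mp (m _ _ _ c2 (y f1' f0'))
  have u2 := abs_le.mp (m _ _ _ c2 (y f' f10))
  have u3 := abs_le.mp (m _ _ _ c1 (y f2' f0'))
  have u4 := abs_le.mp (m _ _ _ c1 (y f' f20))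
  have u5 := abs_le.mp (m _ _ _ hz (y f' f0'))
  rw [abs_le]
  constructor <;>
  linarith [sq_nonneg f', sq_nonneg f0', sq_nonneg f1', sq_nonneg f2', sq_nonneg f10,
    sq_nonneg f20, sq_nonneg f21, sq_nonneg f210]

lemma boostPow_eq_word (J : List (Fin 3)) (f : Spacetime → ℝ) :
    boostPow J f = word (J.map Sum.inr) f := by
  simpa [opIJ, partialPow] using opIJ_eq_word [] J f

/-- Weighted Klainerman–Sobolev inequality on a hyperboloid. No cutoff is needed: the fundamental
theorem of calculus is applied to the square of the function along paths leading away from the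
origin, on which the weight `t` increases. -/
lemma sobolev_hyp (hN : SlabNhd s₁ U) (hs : s ∈ Set.Icc 2 s₁) (hf : Reg s₁ U 3 f) {x : Space}
    (hx : x ∈ hypSlice s) {m : ℕ} (hm : m ≤ 2) :
    ((hypPoint s x).1 ^ m * f (hypPoint s x)) ^ 2 ≤
      7 * ∑ J ∈ sobolevWords, hypSq s (weighted s (2 - m) (boostPow J f)) := by
  have hs0 : 0 < s := by linarith [hs.1]
  have hg : Reg s₁ U 3 (fun q => f q * f q) := Reg.mul hf.contDiffOn hf
  have hg0 : Reg s₁ U 2 (tangD 0 fun q => f q * f q) := hg.tangD hN 0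
  have hg1 : Reg s₁ U 1 (tangD 1 (tangD 0 fun q => f q * f q)) := hg0.tangD hN 1
  have hg2 : Reg s₁ U 0 (tangD 2 (tangD 1 (tangD 0 fun q => f q * f q))) := hg1.tangD hN 2
  set T := tangD 2 (tangD 1 (tangD 0 fun q => f q * f q)) with hTdef
  have hoct := enorm_le_lintegral_octant (contDiff_restrictHyp hN hs hg)
    (hasCompactSupport_restrictHyp s _) x
  rw [dirD_restrictHyp hN hs hg, dirD_restrictHyp hN hs hg0, dirD_restrictHyp hN hs hg1,
    ← hTdef] at hoct
  have hw : ∀ J ∈ sobolevWords, Reg s₁ U 0 (weighted s (2 - m) (boostPow J f)) := by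
    intro J hJ
    rw [boostPow_eq_word]
    refine Reg.weighted hN _ _ (Reg.word hN _ (hf.of_le ?_))
    simpa using length_le_of_mem_sobolevWords hJ
  have hint : IntegrableOn (fun y => 7 * ∑ J ∈ sobolevWords,
      weighted s (2 - m) (boostPow J f) (hypPoint s y) ^ 2) (hypSlice s) :=
    (integrable_finsetSum _ fun J hJ => integrableOn_sq hN hs (hw J hJ)).const_mul 7
  -- `t ≤ s²` trades the weight `t^(2m-3)` for the weight `s² t^(2m-4)` of the energy
  have hpt : ∀ y ∈ hypSlice s, (hypPoint s y).1 ^ (2 * m) * |T (hypPoint s y)| ≤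
      7 * ∑ J ∈ sobolevWords, weighted s (2 - m) (boostPow J f) (hypPoint s y) ^ 2 := by
    intro y hy
    have hyU := hN.slab_subset (hypPoint_mem_slab hs hy)
    have h1 := abs_tangD_sq_le hN.isOpen hN.subset_coneK hf.contDiffOn hyU
    have h2 := hypPoint_fst_le hy
    have h3 := hypPoint_fst_pos hs0 y
    rw [← hTdef] at h1
    have h4 : ∑ J ∈ sobolevWords, weighted s (2 - m) (boostPow J f) (hypPoint s y) ^ 2 =
        (s * ((hypPoint s y).1 ^ (2 - m))⁻¹) ^ 2 *
          ∑ J ∈ sobolevWords, boostPow J f (hypPoint s y) ^ 2 := by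
      rw [Finset.mul_sum]
      exact Finset.sum_congr rfl fun J _ => by simp only [weighted]; ring
    rw [h4]
    set S := ∑ J ∈ sobolevWords, boostPow J f (hypPoint s y) ^ 2
    have hS : 0 ≤ S := Finset.sum_nonneg fun _ _ => sq_nonneg _
    set t := (hypPoint s y).1
    have h5 : t ^ (2 * m) = t ^ 4 * ((t ^ (2 - m))⁻¹) ^ 2 := by
      have : t ^ 4 = t ^ (2 * m) * (t ^ (2 - m)) ^ 2 := by
        rw [← pow_mul, ← pow_add]
        congr 1
        omega
      rw [this]
      field_simp
    calc t ^ (2 * m) * |T (hypPoint s y)|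
        = ((t ^ (2 - m))⁻¹) ^ 2 * t * (t ^ 3 * |T (hypPoint s y)|) := by
          rw [h5]; ring
      _ ≤ ((t ^ (2 - m))⁻¹) ^ 2 * s ^ 2 * (7 * S) := by gcongr
      _ = 7 * ((s * (t ^ (2 - m))⁻¹) ^ 2 * S) := by ring
  -- the weight is larger at all points of the domain of integration than at `x`
  have hmono : ∀ y : Space, (∀ i, |x i| ≤ |y i|) → (hypPoint s x).1 ≤ (hypPoint s y).1 := by
    intro y hy
    refine Real.sqrt_le_sqrt ?_
    rw [EuclideanSpace.real_norm_sq_eq, EuclideanSpace.real_norm_sq_eq]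
    have := Finset.sum_le_sum fun i (_ : i ∈ Finset.univ) => sq_le_sq.mpr (hy i)
    linarith
  have hfinal : ENNReal.ofReal ((hypPoint s x).1 ^ (2 * m)) *
      ‖restrictHyp s (fun q => f q * f q) x‖ₑ ≤
      ENNReal.ofReal (7 * ∑ J ∈ sobolevWords, hypSq s (weighted s (2 - m) (boostPow J f))) := by
    have e : 7 * ∑ J ∈ sobolevWords, hypSq s (weighted s (2 - m) (boostPow J f)) =
        ∫ y in hypSlice s, 7 * ∑ J ∈ sobolevWords,
          weighted s (2 - m) (boostPow J f) (hypPoint s y) ^ 2 := by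
      rw [integral_const_mul, integral_finsetSum _ fun J hJ => integrableOn_sq hN hs (hw J hJ)]
      rfl
    rw [e, ofReal_integral_eq_lintegral_ofReal hint
      (Eventually.of_forall fun y => by positivity),
      ← lintegral_indicator (isOpen_hypSlice hs0).measurableSet]
    refine (mul_le_mul_right hoct _).trans ?_
    rw [← lintegral_const_mul' _ _ ENNReal.ofReal_ne_top]
    refine lintegral_mono fun y => ?_
    by_cases hy : y ∈ hypSlice s
    · rw [Set.indicator_of_mem hy]
      by_cases hyx : ∀ i, |x i| ≤ |y i|
      · rw [Set.indicator_of_mem (show y ∈ {y : Space | ∀ i, |x i| ≤ |y i|} from hyx),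
          restrictHyp_of_mem _ hy, Real.enorm_eq_ofReal_abs,
          ← ENNReal.ofReal_mul (by have := hypPoint_fst_pos hs0 x; positivity)]
        refine ENNReal.ofReal_le_ofReal (le_trans ?_ (hpt y hy))
        refine mul_le_mul_of_nonneg_right ?_ (abs_nonneg _)
        exact pow_le_pow_left₀ (hypPoint_fst_pos hs0 x).le (hmono y hyx) _
      · rw [Set.indicator_of_notMem (show y ∉ {y : Space | ∀ i, |x i| ≤ |y i|} from hyx)]
        simp
    · have : restrictHyp s T y = 0 := restrictHyp_of_notMem _ hy
      have h0 : {y : Space | ∀ i, |x i| ≤ |y i|}.indicator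
          (fun y => ‖restrictHyp s T y‖ₑ) y = 0 := by
        refine Set.indicator_apply_eq_zero.mpr fun _ => ?_
        rw [this, enorm_zero]
      simp [h0]
  rw [restrictHyp_of_mem _ hx, Real.enorm_eq_ofReal_abs, abs_of_nonneg (mul_self_nonneg _),
    ← ENNReal.ofReal_mul (by have := hypPoint_fst_pos hs0 x; positivity),
    ENNReal.ofReal_le_ofReal_iff (mul_nonneg (by norm_num)
      (Finset.sum_nonneg fun _ _ => hypSq_nonneg _ _))] at hfinal
  calc _ = _ := by ring
    _ ≤ _ := hfinal

end

/-! ### Reordering boosts and translations -/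

section

variable {s₁ : ℝ} {U : Set Spacetime} {k : ℕ} {f g u : Spacetime → ℝ}

/-- The linear combinations of the operators `∂^I L^J` with `|I| = i` and `|I| + |J| ≤ n`. -/
noncomputable def opSpan (i n : ℕ) : Submodule ℝ ((Spacetime → ℝ) → Spacetime → ℝ) :=
  Submodule.span ℝ {T | ∃ (I : List (Fin 4)) (J : List (Fin 3)),
    I.length = i ∧ I.length + J.length ≤ n ∧ T = opIJ I J}

lemma opIJ_mem_opSpan {I : List (Fin 4)} {J : List (Fin 3)} {n : ℕ}
    (h : I.length + J.length ≤ n) : opIJ I J ∈ opSpan I.length n :=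
  Submodule.subset_span ⟨I, J, rfl, h, rfl⟩

lemma Reg.opIJ (hN : SlabNhd s₁ U) {I : List (Fin 4)} {J : List (Fin 3)} {n : ℕ}
    (h : I.length + J.length ≤ n) (hu : Reg s₁ U (k + n) u) : Reg s₁ U k (opIJ I J u) := by
  rw [opIJ_eq_word]
  exact Reg.word hN _ (hu.of_le (by simpa using h))

lemma Reg.differentiableAt (hN : SlabNhd s₁ U) (hf : Reg s₁ U (k + 1) f) {p : Spacetime}
    (hp : p ∈ U) : DifferentiableAt ℝ f p :=
  ContDiffOn.differentiableAt_of_isOpen hN.isOpen k.succ_ne_zero hf.contDiffOn hp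

/-- A derivation of a linear combination of operators, computed term by term. -/
lemma exists_derivation_of_mem_span (i' : Fin 4 ⊕ Fin 3) {n m : ℕ}
    {G : Set ((Spacetime → ℝ) → Spacetime → ℝ)}
    {V : Submodule ℝ ((Spacetime → ℝ) → Spacetime → ℝ)}
    (hreg : ∀ T ∈ G, ∀ (s₁ : ℝ) (U : Set Spacetime) (u : Spacetime → ℝ), SlabNhd s₁ U →
      Reg s₁ U (n + 1) u → Reg s₁ U 1 (T u))
    (hm : n ≤ m)
    (hG : ∀ T ∈ G, ∃ T' ∈ V, ∀ (s₁ : ℝ) (U : Set Spacetime) (u : Spacetime → ℝ), SlabNhd s₁ U →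
      Reg s₁ U (m + 1) u → Set.EqOn (derivation i' (T u)) (T' u) U)
    {T : (Spacetime → ℝ) → Spacetime → ℝ} (hT : T ∈ Submodule.span ℝ G) :
    ∃ T' ∈ V, ∀ (s₁ : ℝ) (U : Set Spacetime) (u : Spacetime → ℝ), SlabNhd s₁ U →
      Reg s₁ U (m + 1) u → Set.EqOn (derivation i' (T u)) (T' u) U := by
  have hspan : ∀ T ∈ Submodule.span ℝ G, ∀ (s₁ : ℝ) (U : Set Spacetime) (u : Spacetime → ℝ),
      SlabNhd s₁ U → Reg s₁ U (m + 1) u → Reg s₁ U 1 (T u) := by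
    intro T hT s₁ U u hN hu
    induction hT using Submodule.span_induction with
    | mem T h => exact hreg T h s₁ U u hN (hu.of_le (by omega))
    | zero => exact Reg.zero
    | add T T' _ _ h h' => exact h.add h'
    | smul c T _ h => exact h.const_mul c
  induction hT using Submodule.span_induction with
  | mem T h => exact hG T h
  | zero => exact ⟨0, V.zero_mem, fun _ _ _ _ _ p _ => congrFun (derivation_zero i') p⟩
  | add T T' hT hT' h h' =>
    obtain ⟨S, hS, e⟩ := h
    obtain ⟨S', hS', e'⟩ := h'
    refine ⟨S + S', V.add_mem hS hS', fun s₁ U u hN hu p hp => ?_⟩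
    have h1 := derivation_add i' ((hspan T hT s₁ U u hN hu).differentiableAt (k := 0) hN hp)
      ((hspan T' hT' s₁ U u hN hu).differentiableAt (k := 0) hN hp)
    change derivation i' (fun q => T u q + T' u q) p = S u p + S' u p
    rw [h1, e s₁ U u hN hu hp, e' s₁ U u hN hu hp]
  | smul c T hT h =>
    obtain ⟨S, hS, e⟩ := h
    refine ⟨c • S, V.smul_mem c hS, fun s₁ U u hN hu p hp => ?_⟩
    have h1 := derivation_const_mul i' c
      ((hspan T hT s₁ U u hN hu).differentiableAt (k := 0) hN hp)
    change derivation i' (fun q => c * T u q) p = c * S u p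
    rw [h1, e s₁ U u hN hu hp]

lemma exists_partialD_of_mem_opSpan (α : Fin 4) {i n : ℕ}
    {T : (Spacetime → ℝ) → Spacetime → ℝ} (hT : T ∈ opSpan i n) :
    ∃ T' ∈ opSpan (i + 1) (n + 1), ∀ (s₁ : ℝ) (U : Set Spacetime) (u : Spacetime → ℝ),
      SlabNhd s₁ U → Reg s₁ U (n + 1) u → Set.EqOn (partialD α (T u)) (T' u) U := by
  refine exists_derivation_of_mem_span (Sum.inl α) (n := n) ?_ le_rfl ?_ hT
  · rintro _ ⟨I, J, -, h, rfl⟩ s₁ U u hN hu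
    exact Reg.opIJ hN h (by rwa [add_comm])
  · rintro _ ⟨I, J, rfl, h, rfl⟩
    refine ⟨opIJ (α :: I) J, opIJ_mem_opSpan (I := α :: I) ?_, fun _ _ _ _ _ _ _ => rfl⟩
    simp only [List.length_cons]; omega

lemma opSpan_mono {i n m : ℕ} (h : n ≤ m) : opSpan i n ≤ opSpan i m :=
  Submodule.span_mono fun _ ⟨I, J, h1, h2, h3⟩ => ⟨I, J, h1, h2.trans h, h3⟩

/-- Moving a boost through the translations of `∂^I L^J` only produces lower order terms with the
same number of translations. -/
lemma exists_boost_opIJ (a : Fin 3) (I : List (Fin 4)) (J : List (Fin 3)) :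
    ∃ T ∈ opSpan I.length (I.length + J.length + 1),
      ∀ (s₁ : ℝ) (U : Set Spacetime) (u : Spacetime → ℝ), SlabNhd s₁ U →
        Reg s₁ U (I.length + J.length + 1) u → Set.EqOn (boost a (opIJ I J u)) (T u) U := by
  induction I with
  | nil =>
    refine ⟨opIJ [] (a :: J), opIJ_mem_opSpan (I := []) ?_, fun _ _ _ _ _ _ _ => rfl⟩
    simp
  | cons β I ih =>
    obtain ⟨T, hT, e⟩ := ih
    obtain ⟨T', hT', e'⟩ := exists_partialD_of_mem_opSpan β hT
    refine ⟨T' + ∑ γ, boostCoeff a β γ • opIJ (γ :: I) J, ?_, fun s₁ U u hN hu p hp => ?_⟩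
    · refine Submodule.add_mem _ ?_ (Submodule.sum_mem _ fun γ _ => Submodule.smul_mem _ _ ?_)
      · refine opSpan_mono ?_ hT'
        simp only [List.length_cons]; omega
      · refine opIJ_mem_opSpan (I := γ :: I) ?_
        simp only [List.length_cons]; omega
    · have hu' : Reg s₁ U (I.length + J.length + 1 + 1) u := by
        refine hu.of_le ?_
        simp only [List.length_cons]; omega
      have hg : Reg s₁ U 2 (opIJ I J u) := Reg.opIJ hN le_rfl (hu'.of_le (by omega))
      have h1 := boost_partialD a β (hg.contDiffOn.contDiffAt (hN.isOpen.mem_nhds hp))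
      have h2 := derivation_congr (Sum.inl β) hN.isOpen (e s₁ U u hN (hu'.of_le (by omega))) hp
      have h3 := e' s₁ U u hN hu' hp
      change boost a (partialD β (opIJ I J u)) p = _
      rw [h1]
      simp only [derivation_inl] at h2
      rw [h2, h3]
      simp only [Pi.add_apply, Finset.sum_apply, Pi.smul_apply, smul_eq_mul]
      rfl

lemma exists_boost_of_mem_opSpan (a : Fin 3) {i n : ℕ}
    {T : (Spacetime → ℝ) → Spacetime → ℝ} (hT : T ∈ opSpan i n) :
    ∃ T' ∈ opSpan i (n + 1), ∀ (s₁ : ℝ) (U : Set Spacetime) (u : Spacetime → ℝ),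
      SlabNhd s₁ U → Reg s₁ U (n + 1) u → Set.EqOn (boost a (T u)) (T' u) U := by
  refine exists_derivation_of_mem_span (Sum.inr a) (n := n) ?_ le_rfl ?_ hT
  · rintro _ ⟨I, J, -, h, rfl⟩ s₁ U u hN hu
    exact Reg.opIJ hN h (by rwa [add_comm])
  · rintro _ ⟨I, J, rfl, h, rfl⟩
    obtain ⟨T, hT, e⟩ := exists_boost_opIJ a I J
    exact ⟨T, opSpan_mono (by omega) hT,
      fun s₁ U u hN hu => e s₁ U u hN (hu.of_le (by omega))⟩

/-- Normal form of words: every product of boosts and translations is a linear combination of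
operators `∂^I L^J` with the same number of translations and no greater length. -/
lemma exists_word_eq (K : List (Fin 4 ⊕ Fin 3)) :
    ∃ T ∈ opSpan (K.countP Sum.isLeft) K.length,
      ∀ (s₁ : ℝ) (U : Set Spacetime) (u : Spacetime → ℝ), SlabNhd s₁ U →
        Reg s₁ U K.length u → Set.EqOn (word K u) (T u) U := by
  induction K with
  | nil => exact ⟨opIJ [] [], opIJ_mem_opSpan (I := []) (by simp), fun _ _ _ _ _ _ _ => rfl⟩
  | cons i K ih =>
    obtain ⟨T, hT, e⟩ := ih
    rcases i with α | a
    · obtain ⟨T', hT', e'⟩ := exists_partialD_of_mem_opSpan α hT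
      refine ⟨T', by rwa [List.countP_cons_of_pos rfl], fun s₁ U u hN hu p hp => ?_⟩
      have h2 := derivation_congr (Sum.inl α) hN.isOpen
        (e s₁ U u hN (hu.of_le (by simp))) hp
      rw [word_cons, h2]
      exact e' s₁ U u hN hu hp
    · obtain ⟨T', hT', e'⟩ := exists_boost_of_mem_opSpan a hT
      refine ⟨T', by simpa using hT', fun s₁ U u hN hu p hp => ?_⟩
      have h2 := derivation_congr (Sum.inr a) hN.isOpen
        (e s₁ U u hN (hu.of_le (by simp))) hp
      rw [word_cons, h2]
      exact e' s₁ U u hN hu hp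

/-! ### Expansion of the commutator -/

/-- The linear combinations of the operators `u ↦ Q^{αβγ} ∂_γ Z u ∂_α ∂_β Z' u` with `Q` null and
`Z`, `Z'` words of total length at most `n`, where `Z'` is shorter than `n`. -/
noncomputable def commSpan (n : ℕ) : Submodule ℝ ((Spacetime → ℝ) → Spacetime → ℝ) :=
  Submodule.span ℝ {T | ∃ (Q : Fin 4 → Fin 4 → Fin 4 → ℝ) (K K' : List (Fin 4 ⊕ Fin 3)),
    IsNullCubic Q ∧ K.length + K'.length ≤ n ∧ K'.length < n ∧
      T = fun u => quasiOp Q (word K u) (word K' u)}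

lemma quasiOp_mem_commSpan {Q : Fin 4 → Fin 4 → Fin 4 → ℝ} (hQ : IsNullCubic Q)
    {K K' : List (Fin 4 ⊕ Fin 3)} {n : ℕ} (h : K.length + K'.length ≤ n) (h' : K'.length < n) :
    (fun u => quasiOp Q (word K u) (word K' u)) ∈ commSpan n :=
  Submodule.subset_span ⟨Q, K, K', hQ, h, h', rfl⟩

lemma Reg.quasiOp (hN : SlabNhd s₁ U) (Q : Fin 4 → Fin 4 → Fin 4 → ℝ)
    (hf : Reg s₁ U (k + 1) f) (hg : Reg s₁ U (k + 2) g) : Reg s₁ U k (quasiOp Q f g) :=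
  Reg.sum _ fun α _ => Reg.sum _ fun β _ => Reg.sum _ fun γ _ =>
    Reg.mul (contDiffOn_const.mul (hf.partialD hN γ).contDiffOn)
      (Reg.partialD hN α (Reg.partialD hN β hg))

lemma exists_derivation_of_mem_commSpan (i : Fin 4 ⊕ Fin 3) {n : ℕ}
    {T : (Spacetime → ℝ) → Spacetime → ℝ} (hT : T ∈ commSpan n) :
    ∃ T' ∈ commSpan (n + 1), ∀ (s₁ : ℝ) (U : Set Spacetime) (u : Spacetime → ℝ),
      SlabNhd s₁ U → Reg s₁ U (n + 2) u → Set.EqOn (derivation i (T u)) (T' u) U := by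
  refine exists_derivation_of_mem_span i (n := n + 1) (m := n + 1) ?_ le_rfl ?_ hT
  · rintro _ ⟨Q, K, K', hQ, h, h', rfl⟩ s₁ U u hN hu
    exact Reg.quasiOp hN Q (Reg.word hN K (hu.of_le (by omega)))
      (Reg.word hN K' (hu.of_le (by omega)))
  · rintro _ ⟨Q, K, K', hQ, h, h', rfl⟩
    refine ⟨(fun u => quasiOp Q (word (i :: K) u) (word K' u)) +
      (fun u => quasiOp Q (word K u) (word (i :: K') u)) +
      (fun u => quasiOp (derivForm i Q) (word K u) (word K' u)),
      Submodule.add_mem _ (Submodule.add_mem _ (quasiOp_mem_commSpan hQ ?_ ?_)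
        (quasiOp_mem_commSpan hQ ?_ ?_))
        (quasiOp_mem_commSpan (isNullCubic_derivForm i hQ) ?_ ?_),
      fun s₁ U u hN hu p hp => ?_⟩
    iterate 6 (first | omega | (simp only [List.length_cons]; omega))
    have hf : Reg s₁ U 2 (word K u) := Reg.word hN K (hu.of_le (by omega))
    have hg : Reg s₁ U 3 (word K' u) := Reg.word hN K' (hu.of_le (by omega))
    exact derivation_quasiOp i Q hN.isOpen hf.contDiffOn hg.contDiffOn hp

/-- The commutator of a word with the quasilinear operator is a combination of null forms in which
at least one derivation has left the second order factor. -/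
lemma exists_word_quasiOp (K : List (Fin 4 ⊕ Fin 3)) {Q : Fin 4 → Fin 4 → Fin 4 → ℝ}
    (hQ : IsNullCubic Q) :
    ∃ T ∈ commSpan K.length, ∀ (s₁ : ℝ) (U : Set Spacetime) (u : Spacetime → ℝ),
      SlabNhd s₁ U → Reg s₁ U (K.length + 2) u →
        Set.EqOn (word K (quasiOp Q u u)) (fun p => quasiOp Q u (word K u) p + T u p) U := by
  induction K with
  | nil => exact ⟨0, Submodule.zero_mem _, fun _ _ _ _ _ p _ => by simp⟩
  | cons i K ih =>
    obtain ⟨T, hT, e⟩ := ih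
    obtain ⟨T', hT', e'⟩ := exists_derivation_of_mem_commSpan i hT
    refine ⟨(fun u => quasiOp Q (word [i] u) (word K u)) +
      (fun u => quasiOp (derivForm i Q) (word [] u) (word K u)) + T',
      Submodule.add_mem _ (Submodule.add_mem _ (quasiOp_mem_commSpan hQ ?_ ?_)
        (quasiOp_mem_commSpan (isNullCubic_derivForm i hQ) ?_ ?_)) hT',
      fun s₁ U u hN hu p hp => ?_⟩
    iterate 4 (simp only [List.length_cons, List.length_nil]; omega)
    have hu' : Reg s₁ U (K.length + 3) u := hu.of_le (by simp only [List.length_cons]; omega)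
    have hg : Reg s₁ U 3 (word K u) := Reg.word hN K (hu'.of_le (by omega))
    have hf : Reg s₁ U 2 u := hu'.of_le (by omega)
    have hq : Reg s₁ U 1 (quasiOp Q u (word K u)) := Reg.quasiOp hN Q hf hg
    have hTu : Reg s₁ U 1 (T u) := by
      have hu2 : Reg s₁ U (K.length + 2) u := hu'.of_le (by omega)
      clear e e'
      induction hT using Submodule.span_induction with
      | mem T h =>
        obtain ⟨Q', K₁, K₂, -, h, h', rfl⟩ := h
        exact Reg.quasiOp hN Q' (Reg.word hN K₁ (hu2.of_le (by omega)))
          (Reg.word hN K₂ (hu2.of_le (by omega)))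
      | zero => exact Reg.zero
      | add T T' _ _ h h' => exact h.add h'
      | smul c T _ h => exact h.const_mul c
    rw [word_cons, derivation_congr i hN.isOpen (e s₁ U u hN (hu'.of_le (by omega))) hp,
      derivation_add i (hq.differentiableAt (k := 0) hN hp) (hTu.differentiableAt (k := 0) hN hp),
      derivation_quasiOp i Q hN.isOpen hf.contDiffOn hg.contDiffOn hp,
      e' s₁ U u hN (hu'.of_le (by omega)) hp]
    simp only [Pi.add_apply, word_cons, word_nil]
    ring

end

/-! ### Consequences of the energy bound -/

/-- The setting of the estimates on a fixed hyperboloid: `u` is regular near the slab, vanishes near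
the cone, and the conformal energies of `∂^I L^J u` on `ℋ_s`, for `|I| + |J| ≤ N`, are at most
`A²`. -/
structure EnergyBound (N : ℕ) (s₁ s A : ℝ) (U : Set Spacetime) (u : Spacetime → ℝ) : Prop where
  nhd : SlabNhd s₁ U
  mem : s ∈ Set.Icc 2 s₁
  reg : Reg s₁ U (N + 2) u
  nonneg : 0 ≤ A
  energy : ∀ (I : List (Fin 4)) (J : List (Fin 3)), I.length + J.length ≤ N →
    confEnergy s (opIJ I J u) ^ (1 / 2 : ℝ) ≤ ENNReal.ofReal A

lemma EnergyBound.pos {N : ℕ} {s₁ s A : ℝ} {U : Set Spacetime} {u : Spacetime → ℝ}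
    (h : EnergyBound N s₁ s A U u) : 0 < s := by linarith [h.mem.1]

lemma hypSq_congr {s s₁ : ℝ} {U : Set Spacetime} (hN : SlabNhd s₁ U) (hs : s ∈ Set.Icc 2 s₁)
    {f g : Spacetime → ℝ} (h : Set.EqOn f g U) : hypSq s f = hypSq s g :=
  setIntegral_congr_fun (isOpen_hypSlice (by linarith [hs.1])).measurableSet fun x hx => by
    simp only [h (hN.slab_subset (hypPoint_mem_slab hs hx))]

lemma hypSq_const_mul (s c : ℝ) (f : Spacetime → ℝ) :
    hypSq s (fun p => c * f p) = c ^ 2 * hypSq s f := by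
  simp only [hypSq, mul_pow, integral_const_mul]

lemma hypSq_add_le {s s₁ : ℝ} {U : Set Spacetime} (hN : SlabNhd s₁ U) (hs : s ∈ Set.Icc 2 s₁)
    {f g : Spacetime → ℝ} (hf : Reg s₁ U 0 f) (hg : Reg s₁ U 0 g) :
    hypSq s (fun p => f p + g p) ≤ 2 * hypSq s f + 2 * hypSq s g := by
  have := hypSq_le_sum hN hs (ι := Bool) Finset.univ (F := fun b => cond b f g)
    (hf.add hg) (by rintro (_ | _) _; exacts [hg, hf]) (fun _ => 2) (by
      intro x _
      simp only [Fintype.sum_bool, cond_true, cond_false]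
      linarith [sq_nonneg (f (hypPoint s x) - g (hypPoint s x))])
  simpa only [Fintype.sum_bool, cond_true, cond_false] using this

/-- A bound for the `L²` norm of a linear first order expression `Φ` extends from a set of operators
to its linear span, with a constant that does not depend on the solution. -/
lemma exists_hypSq_le_of_mem_span {N : ℕ} {B : ℝ → ℝ → ℝ}
    {Φ : ℝ → (Spacetime → ℝ) → Spacetime → ℝ}
    (hreg : ∀ (s s₁ : ℝ) (U : Set Spacetime) (f : Spacetime → ℝ), SlabNhd s₁ U →
      Reg s₁ U 1 f → Reg s₁ U 0 (Φ s f))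
    (hadd : ∀ (s s₁ : ℝ) (U : Set Spacetime) (f g : Spacetime → ℝ), SlabNhd s₁ U →
      Reg s₁ U 1 f → Reg s₁ U 1 g →
        Set.EqOn (Φ s fun p => f p + g p) (fun p => Φ s f p + Φ s g p) U)
    (hsmul : ∀ (s s₁ c : ℝ) (U : Set Spacetime) (f : Spacetime → ℝ), SlabNhd s₁ U →
      Reg s₁ U 1 f → Set.EqOn (Φ s fun p => c * f p) (fun p => c * Φ s f p) U)
    {G : Set ((Spacetime → ℝ) → Spacetime → ℝ)}
    (hGreg : ∀ T ∈ G, ∀ (s₁ : ℝ) (U : Set Spacetime) (u : Spacetime → ℝ), SlabNhd s₁ U →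
      Reg s₁ U (N + 2) u → Reg s₁ U 1 (T u))
    (hG : ∀ T ∈ G, ∃ C : ℝ, ∀ (s₁ s A : ℝ) (U : Set Spacetime) (u : Spacetime → ℝ),
      EnergyBound N s₁ s A U u → hypSq s (Φ s (T u)) ≤ C * B s A)
    {T : (Spacetime → ℝ) → Spacetime → ℝ} (hT : T ∈ Submodule.span ℝ G) :
    ∃ C : ℝ, ∀ (s₁ s A : ℝ) (U : Set Spacetime) (u : Spacetime → ℝ),
      EnergyBound N s₁ s A U u → hypSq s (Φ s (T u)) ≤ C * B s A := by
  have hspan : ∀ T ∈ Submodule.span ℝ G, ∀ (s₁ : ℝ) (U : Set Spacetime) (u : Spacetime → ℝ),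
      SlabNhd s₁ U → Reg s₁ U (N + 2) u → Reg s₁ U 1 (T u) := by
    intro T hT s₁ U u hN hu
    induction hT using Submodule.span_induction with
    | mem T h => exact hGreg T h s₁ U u hN hu
    | zero => exact Reg.zero
    | add T T' _ _ h h' => exact h.add h'
    | smul c T _ h => exact h.const_mul c
  induction hT using Submodule.span_induction with
  | mem T h => exact hG T h
  | zero =>
    refine ⟨0, fun s₁ s A U u h => ?_⟩
    have h0 : Set.EqOn (Φ s ((0 : (Spacetime → ℝ) → Spacetime → ℝ) u)) (fun _ => 0) U := by
      intro p hp
      have := hsmul s s₁ 0 U (fun _ => 0) h.nhd Reg.zero hp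
      simp only [zero_mul] at this
      exact this
    rw [hypSq_congr h.nhd h.mem h0]
    simp [hypSq]
  | add T T' hT hT' h h' =>
    obtain ⟨C, hC⟩ := h
    obtain ⟨C', hC'⟩ := h'
    refine ⟨2 * C + 2 * C', fun s₁ s A U u h => ?_⟩
    have r := hspan T hT s₁ U u h.nhd h.reg
    have r' := hspan T' hT' s₁ U u h.nhd h.reg
    have e : hypSq s (Φ s ((T + T') u)) = hypSq s (fun p => Φ s (T u) p + Φ s (T' u) p) :=
      hypSq_congr h.nhd h.mem (hadd s s₁ U (T u) (T' u) h.nhd r r')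
    have := hypSq_add_le h.nhd h.mem (hreg s s₁ U _ h.nhd r) (hreg s s₁ U _ h.nhd r')
    rw [e]
    linarith [hC s₁ s A U u h, hC' s₁ s A U u h]
  | smul c T hT h =>
    obtain ⟨C, hC⟩ := h
    refine ⟨c ^ 2 * C, fun s₁ s A U u h => ?_⟩
    have r := hspan T hT s₁ U u h.nhd h.reg
    have e : hypSq s (Φ s ((c • T) u)) = hypSq s (fun p => c * Φ s (T u) p) :=
      hypSq_congr h.nhd h.mem (hsmul s s₁ c U (T u) h.nhd r)
    rw [e, hypSq_const_mul, mul_assoc]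
    exact mul_le_mul_of_nonneg_left (hC s₁ s A U u h) (sq_nonneg c)

lemma weighted_congr {U : Set Spacetime} {f g : Spacetime → ℝ} (c : ℝ) (m : ℕ)
    (h : Set.EqOn f g U) : Set.EqOn (weighted c m f) (weighted c m g) U := fun p hp => by
  simp only [weighted, h hp]

/-- Words containing a translation are controlled in the weighted norm `‖s (s/t)² ·‖`. -/
lemma exists_hypSq_word_le {N : ℕ} {K : List (Fin 4 ⊕ Fin 3)} (hK : K.length ≤ N + 1)
    (hK' : 0 < K.countP Sum.isLeft) :
    ∃ C : ℝ, ∀ (s₁ s A : ℝ) (U : Set Spacetime) (u : Spacetime → ℝ), EnergyBound N s₁ s A U u →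
      hypSq s (weighted (s ^ 3) 2 (word K u)) ≤ C * A ^ 2 := by
  obtain ⟨T, hT, e⟩ := exists_word_eq K
  obtain ⟨C, hC⟩ := exists_hypSq_le_of_mem_span (N := N) (B := fun _ A => A ^ 2)
    (Φ := fun s => weighted (s ^ 3) 2)
    (fun s s₁ U f hN hf => Reg.weighted hN _ _ (hf.of_le zero_le_one))
    (fun s s₁ U f g _ _ _ p _ => by simp only [weighted]; ring)
    (fun s s₁ c U f _ _ p _ => by simp only [weighted]; ring)
    (by
      rintro _ ⟨I, J, -, h, rfl⟩ s₁ U u hN hu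
      exact Reg.opIJ hN h (hu.of_le (by omega)))
    (by
      rintro _ ⟨I, J, hI, h, rfl⟩
      obtain ⟨α, I, rfl⟩ : ∃ α I', I = α :: I' :=
        List.exists_cons_of_length_pos (by omega)
      refine ⟨250, fun s₁ s A U u h' => ?_⟩
      have hl : I.length + J.length ≤ N := by
        simp only [List.length_cons] at h; omega
      exact hypSq_partialD_le h'.nhd h'.mem (Reg.opIJ h'.nhd hl (h'.reg.of_le (by omega)))
        h'.nonneg (h'.energy I J hl) α) hT
  refine ⟨C, fun s₁ s A U u h => ?_⟩
  rw [hypSq_congr h.nhd h.mem (weighted_congr _ _ (e s₁ U u h.nhd (h.reg.of_le (by omega))))]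
  exact hC s₁ s A U u h

/-- Boosts of words are controlled in the weighted norm `‖(s/t) ·‖`. -/
lemma exists_hypSq_boost_word_le {N : ℕ} {K : List (Fin 4 ⊕ Fin 3)} (hK : K.length ≤ N)
    (a : Fin 3) :
    ∃ C : ℝ, ∀ (s₁ s A : ℝ) (U : Set Spacetime) (u : Spacetime → ℝ), EnergyBound N s₁ s A U u →
      hypSq s (weighted s 1 (boost a (word K u))) ≤ C * A ^ 2 := by
  obtain ⟨T, hT, e⟩ := exists_word_eq K
  obtain ⟨C, hC⟩ := exists_hypSq_le_of_mem_span (N := N) (B := fun _ A => A ^ 2)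
    (Φ := fun s f => weighted s 1 (boost a f))
    (fun s s₁ U f hN hf => Reg.weighted hN _ _ (Reg.derivation hN (Sum.inr a) hf))
    (fun s s₁ U f g hN hf hg p hp => by
      simp only [weighted, boost_add a (hf.differentiableAt (k := 0) hN hp)
        (hg.differentiableAt (k := 0) hN hp)]
      ring)
    (fun s s₁ c U f hN hf p hp => by
      simp only [weighted, boost_const_mul a c (hf.differentiableAt (k := 0) hN hp)]
      ring)
    (by
      rintro _ ⟨I, J, -, h, rfl⟩ s₁ U u hN hu
      exact Reg.opIJ hN h (hu.of_le (by omega)))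
    (by
      rintro _ ⟨I, J, -, h, rfl⟩
      refine ⟨1, fun s₁ s A U u h' => ?_⟩
      rw [one_mul]
      exact hypSq_boost_le h'.nhd h'.mem (Reg.opIJ h'.nhd h (h'.reg.of_le (by omega)))
        h'.nonneg (h'.energy I J (by omega)) a) hT
  refine ⟨C, fun s₁ s A U u h => ?_⟩
  have := boost_congr a h.nhd.isOpen (e s₁ U u h.nhd (h.reg.of_le (by omega)))
  rw [hypSq_congr h.nhd h.mem (weighted_congr _ _ this)]
  exact hC s₁ s A U u h

lemma boostPow_word (J : List (Fin 3)) (K : List (Fin 4 ⊕ Fin 3)) (u : Spacetime → ℝ) :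
    boostPow J (word K u) = word (J.map Sum.inr ++ K) u := by
  rw [boostPow_eq_word, word_append]

/-- Pointwise decay `|∂_α Z u| ≤ C A s⁻²` for words `Z` of order at most `N - 3`. -/
lemma exists_partialD_word_le {N : ℕ} {K : List (Fin 4 ⊕ Fin 3)} (hK : K.length + 3 ≤ N)
    (α : Fin 4) :
    ∃ C : ℝ, ∀ (s₁ s A : ℝ) (U : Set Spacetime) (u : Spacetime → ℝ), EnergyBound N s₁ s A U u →
      ∀ x ∈ hypSlice s, (s ^ 2 * partialD α (word K u) (hypPoint s x)) ^ 2 ≤ C * A ^ 2 := by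
  have h : ∀ J : List (Fin 3), ∃ C : ℝ, J ∈ sobolevWords →
      ∀ (s₁ s A : ℝ) (U : Set Spacetime) (u : Spacetime → ℝ), EnergyBound N s₁ s A U u →
        s ^ 4 * hypSq s (weighted s 2 (boostPow J (partialD α (word K u)))) ≤ C * A ^ 2 := by
    intro J
    by_cases hJ : J ∈ sobolevWords
    · have hl := length_le_of_mem_sobolevWords hJ
      obtain ⟨C, hC⟩ := exists_hypSq_word_le (N := N) (K := J.map Sum.inr ++ Sum.inl α :: K)
        (by simp only [List.length_append, List.length_map, List.length_cons]; omega)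
        (List.countP_pos_iff.mpr ⟨Sum.inl α, by simp, rfl⟩)
      refine ⟨C, fun _ s₁ s A U u h => ?_⟩
      have e : weighted (s ^ 3) 2 (word (J.map Sum.inr ++ Sum.inl α :: K) u) =
          fun p => s ^ 2 * weighted s 2 (boostPow J (partialD α (word K u))) p := by
        funext p
        have : boostPow J (partialD α (word K u)) =
          word (J.map Sum.inr ++ Sum.inl α :: K) u := boostPow_word J (Sum.inl α :: K) u
        simp only [weighted, this]
        ring
      have := hC s₁ s A U u h
      rw [e, hypSq_const_mul] at this
      calc _ = (s ^ 2) ^ 2 * _ := by rw [← pow_mul]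
        _ ≤ _ := this
    · exact ⟨0, fun h => absurd h hJ⟩
  choose C hC using h
  refine ⟨7 * ∑ J ∈ sobolevWords, C J, fun s₁ s A U u h x hx => ?_⟩
  have hr : Reg s₁ U 3 (partialD α (word K u)) :=
    Reg.partialD h.nhd α (Reg.word h.nhd K (h.reg.of_le (by omega)))
  have := sobolev_hyp h.nhd h.mem hr hx (m := 0) (by norm_num)
  simp only [pow_zero, one_mul, Nat.sub_zero] at this
  have hsum := Finset.sum_le_sum fun J hJ => hC J hJ s₁ s A U u h
  rw [← Finset.mul_sum, ← Finset.sum_mul] at hsum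
  have hs4 : (0 : ℝ) ≤ s ^ 4 := by positivity
  calc _ = s ^ 4 * partialD α (word K u) (hypPoint s x) ^ 2 := by ring
    _ ≤ s ^ 4 * (7 * ∑ J ∈ sobolevWords,
        hypSq s (weighted s 2 (boostPow J (partialD α (word K u))))) :=
        mul_le_mul_of_nonneg_left this hs4
    _ ≤ _ := by linarith

/-- Pointwise decay `|L_a Z u| ≤ C A t⁻¹` for words `Z` of order at most `N - 3`. -/
lemma exists_boost_word_le {N : ℕ} {K : List (Fin 4 ⊕ Fin 3)} (hK : K.length + 3 ≤ N)
    (a : Fin 3) :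
    ∃ C : ℝ, ∀ (s₁ s A : ℝ) (U : Set Spacetime) (u : Spacetime → ℝ), EnergyBound N s₁ s A U u →
      ∀ x ∈ hypSlice s,
        ((hypPoint s x).1 * boost a (word K u) (hypPoint s x)) ^ 2 ≤ C * A ^ 2 := by
  have h : ∀ J : List (Fin 3), ∃ C : ℝ, J ∈ sobolevWords →
      ∀ (s₁ s A : ℝ) (U : Set Spacetime) (u : Spacetime → ℝ), EnergyBound N s₁ s A U u →
        hypSq s (weighted s 1 (boostPow J (boost a (word K u)))) ≤ C * A ^ 2 := by
    intro J
    by_cases hJ : J ∈ sobolevWords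
    · have hl := length_le_of_mem_sobolevWords hJ
      rcases J with _ | ⟨j, J⟩
      · obtain ⟨C, hC⟩ := exists_hypSq_boost_word_le (N := N) (K := K) (by omega) a
        exact ⟨C, fun _ => hC⟩
      · obtain ⟨C, hC⟩ := exists_hypSq_boost_word_le (N := N) (K := J.map Sum.inr ++ Sum.inr a :: K)
          (by
            simp only [List.length_cons] at hl
            simp only [List.length_append, List.length_map, List.length_cons]; omega) j
        refine ⟨C, fun _ s₁ s A U u h => ?_⟩
        have e : boostPow (j :: J) (boost a (word K u)) =
            boost j (word (J.map Sum.inr ++ Sum.inr a :: K) u) :=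
          congrArg (boost j) (boostPow_word J (Sum.inr a :: K) u)
        rw [e]
        exact hC s₁ s A U u h
    · exact ⟨0, fun h => absurd h hJ⟩
  choose C hC using h
  refine ⟨7 * ∑ J ∈ sobolevWords, C J, fun s₁ s A U u h x hx => ?_⟩
  have hr : Reg s₁ U 3 (boost a (word K u)) :=
    Reg.derivation h.nhd (Sum.inr a) (Reg.word h.nhd K (h.reg.of_le (by omega)))
  have := sobolev_hyp h.nhd h.mem hr hx (m := 1) (by norm_num)
  simp only [pow_one] at this
  have hsum := Finset.sum_le_sum fun J hJ => hC J hJ s₁ s A U u h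
  rw [← Finset.sum_mul] at hsum
  linarith

/-- The decay estimates with a single constant, in the form in which they enter the null form
estimate. -/
lemma exists_decay {N : ℕ} {K : List (Fin 4 ⊕ Fin 3)} (hK : K.length + 3 ≤ N) :
    ∃ C : ℝ, 0 ≤ C ∧ ∀ (s₁ s A : ℝ) (U : Set Spacetime) (u : Spacetime → ℝ),
      EnergyBound N s₁ s A U u → ∀ x ∈ hypSlice s,
        (∀ α, |partialD α (word K u) (hypPoint s x)| ≤ C * A / s ^ 2) ∧
        ∀ a, |boost a (word K u) (hypPoint s x)| ≤ C * A / (hypPoint s x).1 := by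
  choose C hC using fun α => exists_partialD_word_le hK α
  choose D hD using fun a => exists_boost_word_le hK a
  have hC0 : ∀ α, |C α| ≤ ∑ α, |C α| + ∑ a, |D a| := fun α => by
    have h1 := Finset.single_le_sum (f := fun α => |C α|) (fun _ _ => abs_nonneg _)
      (Finset.mem_univ α)
    have h2 : 0 ≤ ∑ a, |D a| := Finset.sum_nonneg fun _ _ => abs_nonneg _
    linarith
  have hD0 : ∀ a, |D a| ≤ ∑ α, |C α| + ∑ a, |D a| := fun a => by
    have h1 := Finset.single_le_sum (f := fun a => |D a|) (fun _ _ => abs_nonneg _)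
      (Finset.mem_univ a)
    have h2 : 0 ≤ ∑ α, |C α| := Finset.sum_nonneg fun _ _ => abs_nonneg _
    linarith
  set E := ∑ α, |C α| + ∑ a, |D a| with hE
  have hE0 : 0 ≤ E := (abs_nonneg _).trans (hC0 0)
  have root : ∀ {A y c : ℝ}, 0 ≤ A → y ^ 2 ≤ c * A ^ 2 → |c| ≤ E → |y| ≤ √E * A := by
    intro A y c hA hy hc
    refine abs_le_of_sq_le_sq ?_ (by positivity)
    rw [mul_pow, Real.sq_sqrt hE0]
    exact hy.trans (mul_le_mul_of_nonneg_right ((le_abs_self c).trans hc) (sq_nonneg A))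
  refine ⟨√E, Real.sqrt_nonneg _, fun s₁ s A U u h x hx => ⟨fun α => ?_, fun a => ?_⟩⟩
  · have hs := h.pos
    have := root h.nonneg (hC α s₁ s A U u h x hx) (hC0 α)
    rw [abs_mul, abs_of_pos (by positivity)] at this
    rw [le_div_iff₀ (by positivity)]
    linarith
  · have ht := hypPoint_fst_pos h.pos x
    have := root h.nonneg (hD a s₁ s A U u h x hx) (hD0 a)
    rw [abs_mul, abs_of_pos ht] at this
    rw [le_div_iff₀ ht]
    linarith

/-! ### The commutator estimate -/

lemma hypSq_le_of_abs_le {s s₁ : ℝ} {U : Set Spacetime} (hN : SlabNhd s₁ U)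
    (hs : s ∈ Set.Icc 2 s₁) {ι : Type*} [Fintype ι] {f : Spacetime → ℝ} {H : ι → Spacetime → ℝ}
    (hf : Reg s₁ U 0 f) (hH : ∀ i, Reg s₁ U 0 (H i)) (c : ℝ)
    (h : ∀ x ∈ hypSlice s, |f (hypPoint s x)| ≤ c * ∑ i, |H i (hypPoint s x)|) :
    hypSq s f ≤ c ^ 2 * Fintype.card ι * ∑ i, hypSq s (H i) := by
  rw [Finset.mul_sum]
  refine hypSq_le_sum hN hs Finset.univ hf (fun i _ => hH i) (fun _ => c ^ 2 * Fintype.card ι)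
    fun x hx => ?_
  rw [← Finset.mul_sum, mul_assoc, ← sq_abs]
  calc |f (hypPoint s x)| ^ 2 ≤ (c * ∑ i, |H i (hypPoint s x)|) ^ 2 :=
        pow_le_pow_left₀ (abs_nonneg _) (h x hx) 2
    _ = c ^ 2 * (∑ i, |H i (hypPoint s x)|) ^ 2 := by ring
    _ ≤ c ^ 2 * (Fintype.card ι * ∑ i, |H i (hypPoint s x)| ^ 2) := by
        refine mul_le_mul_of_nonneg_left ?_ (sq_nonneg c)
        simpa using sq_sum_le_card_mul_sum_sq (s := Finset.univ)
          (f := fun i => |H i (hypPoint s x)|)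
    _ = _ := by simp only [sq_abs]

/-- The null form estimate on `ℋ_s`, where `t² - |x|² = s²`. -/
lemma abs_quasiOp_hypPoint_le {Q : Fin 4 → Fin 4 → Fin 4 → ℝ} (hQ : IsNullCubic Q)
    {f g : Spacetime → ℝ} {s : ℝ} (hs : 0 < s) {x : Space}
    (hg : ContDiffAt ℝ 2 g (hypPoint s x)) {m₁ l₁ m₂ l₂ : ℝ}
    (hm₁ : ∀ γ, |partialD γ f (hypPoint s x)| ≤ m₁) (hl₁ : ∀ a, |boost a f (hypPoint s x)| ≤ l₁)
    (hm₂ : ∀ α β, |partialD α (partialD β g) (hypPoint s x)| ≤ m₂)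
    (hl₂ : ∀ a β, |boost a (partialD β g) (hypPoint s x)| ≤ l₂) :
    |quasiOp Q f g (hypPoint s x)| ≤ cubicNorm Q *
      (3 * (s ^ 2 / (hypPoint s x).1 ^ 2) * (m₁ * m₂) + l₁ / (hypPoint s x).1 * m₂ +
        2 * (m₁ * (l₂ / (hypPoint s x).1))) := by
  have ht := hypPoint_fst_pos hs x
  have e : (hypPoint s x).1 ^ 2 - ‖(hypPoint s x).2‖ ^ 2 = s ^ 2 := by
    rw [hypPoint_fst_sq]
    change s ^ 2 + ‖x‖ ^ 2 - ‖x‖ ^ 2 = s ^ 2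
    ring
  have hle : ‖(hypPoint s x).2‖ ≤ (hypPoint s x).1 :=
    (Real.le_sqrt_of_sq_le (by nlinarith [sq_nonneg s]) : ‖x‖ ≤ √(s ^ 2 + ‖x‖ ^ 2))
  have := abs_quasiOp_le hQ hle ht hg hm₁ hl₁ hm₂ hl₂
  rwa [e] at this

lemma abs_le_sum_abs {ι : Type*} [Fintype ι] (F : ι → ℝ) (i : ι) : |F i| ≤ ∑ j, |F j| :=
  Finset.single_le_sum (f := fun j => |F j|) (fun _ _ => abs_nonneg _) (Finset.mem_univ i)

/-- The null form estimate when the first factor is pointwise controlled and the second factor is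
controlled in `L²`. -/
lemma exists_hypSq_quasiOp_le_of_left {N : ℕ} {Q : Fin 4 → Fin 4 → Fin 4 → ℝ} (hQ : IsNullCubic Q)
    {K K' : List (Fin 4 ⊕ Fin 3)} (hK : K.length + 3 ≤ N) (hK' : K'.length + 1 ≤ N) :
    ∃ C : ℝ, ∀ (s₁ s A : ℝ) (U : Set Spacetime) (u : Spacetime → ℝ), EnergyBound N s₁ s A U u →
      hypSq s (fun p => s * quasiOp Q (word K u) (word K' u) p) ≤ C * (A ^ 4 / s ^ 4) := by
  obtain ⟨Y, hY0, hY⟩ := exists_decay hK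
  let H : ℝ → (Spacetime → ℝ) → Fin 4 × Fin 4 ⊕ Fin 3 × Fin 4 → Spacetime → ℝ := fun s u =>
    Sum.elim (fun i => weighted (s ^ 3) 2 (word (Sum.inl i.1 :: Sum.inl i.2 :: K') u))
      fun i => weighted s 1 (boost i.1 (word (Sum.inl i.2 :: K') u))
  have hC : ∀ i, ∃ C : ℝ, ∀ (s₁ s A : ℝ) (U : Set Spacetime) (u : Spacetime → ℝ),
      EnergyBound N s₁ s A U u → hypSq s (H s u i) ≤ C * A ^ 2 := by
    rintro (⟨α, β⟩ | ⟨a, β⟩)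
    · exact exists_hypSq_word_le (by simp only [List.length_cons]; omega) (by simp)
    · exact exists_hypSq_boost_word_le (by simp only [List.length_cons]; omega) a
  choose C hC using hC
  let n : ℝ := Fintype.card (Fin 4 × Fin 4 ⊕ Fin 3 × Fin 4)
  refine ⟨(4 * cubicNorm Q * Y) ^ 2 * n * ∑ i, C i, fun s₁ s A U u h => ?_⟩
  have hs := h.pos
  have hg : Reg s₁ U 3 (word K' u) := Reg.word h.nhd K' (h.reg.of_le (by omega))
  have hf : Reg s₁ U 2 (word K u) := Reg.word h.nhd K (h.reg.of_le (by omega))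
  have hH : ∀ i, Reg s₁ U 0 (H s u i) := by
    rintro (⟨α, β⟩ | ⟨a, β⟩)
    · exact Reg.weighted h.nhd _ _
        ((Reg.partialD h.nhd α (Reg.partialD h.nhd β hg)).of_le zero_le_one)
    · exact Reg.weighted h.nhd _ _
        ((Reg.derivation h.nhd (Sum.inr a) (Reg.partialD h.nhd β hg)).of_le zero_le_one)
  have key := hypSq_le_of_abs_le h.nhd h.mem
    (((Reg.quasiOp h.nhd Q hf hg).const_mul s).of_le zero_le_one) hH
    (4 * cubicNorm Q * (Y * A / s ^ 2)) (by
      intro x hx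
      obtain ⟨hm₁, hl₁⟩ := hY s₁ s A U u h x hx
      have ht := hypPoint_fst_pos hs x
      have hcd : ContDiffAt ℝ 2 (word K' u) (hypPoint s x) :=
        (hg.contDiffOn.contDiffAt (h.nhd.isOpen.mem_nhds
          (h.nhd.slab_subset (hypPoint_mem_slab h.mem hx)))).of_le (by norm_num)
      have hq := abs_quasiOp_hypPoint_le hQ hs hcd hm₁ hl₁
        (m₂ := ∑ i : Fin 4 × Fin 4, |partialD i.1 (partialD i.2 (word K' u)) (hypPoint s x)|)
        (l₂ := ∑ i : Fin 3 × Fin 4, |boost i.1 (partialD i.2 (word K' u)) (hypPoint s x)|)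
        (fun α β => abs_le_sum_abs (fun i : Fin 4 × Fin 4 =>
          partialD i.1 (partialD i.2 (word K' u)) (hypPoint s x)) (α, β))
        (fun a β => abs_le_sum_abs (fun i : Fin 3 × Fin 4 =>
          boost i.1 (partialD i.2 (word K' u)) (hypPoint s x)) (a, β))
      have e : ∑ i, |H s u i (hypPoint s x)| =
          s ^ 3 * ((hypPoint s x).1 ^ 2)⁻¹ *
            (∑ i : Fin 4 × Fin 4, |partialD i.1 (partialD i.2 (word K' u)) (hypPoint s x)|) +
          s * ((hypPoint s x).1 ^ 1)⁻¹ *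
            ∑ i : Fin 3 × Fin 4, |boost i.1 (partialD i.2 (word K' u)) (hypPoint s x)| := by
        rw [Fintype.sum_sum_type, Finset.mul_sum, Finset.mul_sum]
        congr 1
        · refine Finset.sum_congr rfl fun i _ => ?_
          simp only [H, Sum.elim_inl, weighted, word_cons, derivation_inl, abs_mul]
          rw [abs_of_pos (by positivity : 0 < s ^ 3),
            abs_of_pos (by positivity : 0 < ((hypPoint s x).1 ^ 2)⁻¹)]
        · refine Finset.sum_congr rfl fun i _ => ?_
          simp only [H, Sum.elim_inr, weighted, word_cons, derivation_inl, abs_mul]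
          rw [abs_of_pos hs, abs_of_pos (by positivity : 0 < ((hypPoint s x).1 ^ 1)⁻¹)]
      rw [e, abs_mul, abs_of_pos hs]
      set m₂ := ∑ i : Fin 4 × Fin 4, |partialD i.1 (partialD i.2 (word K' u)) (hypPoint s x)|
      set l₂ := ∑ i : Fin 3 × Fin 4, |boost i.1 (partialD i.2 (word K' u)) (hypPoint s x)|
      have hl₂ : 0 ≤ l₂ := Finset.sum_nonneg fun _ _ => abs_nonneg _
      set t := (hypPoint s x).1
      have hA := h.nonneg
      have hn := cubicNorm_nonneg Q
      -- the powers of `t` cancel against the weights, leaving the factor `s⁻²` in every term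
      have hextra : 0 ≤ 2 * cubicNorm Q * (Y * A / s ^ 2) * (s * (t ^ 1)⁻¹ * l₂) := by positivity
      calc _ ≤ s * (cubicNorm Q * (3 * (s ^ 2 / t ^ 2) * (Y * A / s ^ 2 * m₂) +
              Y * A / t / t * m₂ + 2 * (Y * A / s ^ 2 * (l₂ / t)))) :=
            mul_le_mul_of_nonneg_left hq hs.le
        _ = 4 * cubicNorm Q * (Y * A / s ^ 2) * (s ^ 3 * (t ^ 2)⁻¹ * m₂) +
              2 * cubicNorm Q * (Y * A / s ^ 2) * (s * (t ^ 1)⁻¹ * l₂) := by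
            field_simp
            ring
        _ ≤ _ := by linarith)
  refine key.trans ?_
  have hsum := Finset.sum_le_sum fun i (_ : i ∈ Finset.univ) => hC i s₁ s A U u h
  rw [← Finset.sum_mul] at hsum
  calc _ ≤ (4 * cubicNorm Q * (Y * A / s ^ 2)) ^ 2 * n * ((∑ i, C i) * A ^ 2) :=
        mul_le_mul_of_nonneg_left hsum (by positivity)
    _ = _ := by field_simp

/-- The null form estimate when the second factor is pointwise controlled and the first factor is
controlled in `L²`. -/
lemma exists_hypSq_quasiOp_le_of_right {N : ℕ} {Q : Fin 4 → Fin 4 → Fin 4 → ℝ} (hQ : IsNullCubic Q)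
    {K K' : List (Fin 4 ⊕ Fin 3)} (hK : K.length ≤ N) (hK' : K'.length + 4 ≤ N) :
    ∃ C : ℝ, ∀ (s₁ s A : ℝ) (U : Set Spacetime) (u : Spacetime → ℝ), EnergyBound N s₁ s A U u →
      hypSq s (fun p => s * quasiOp Q (word K u) (word K' u) p) ≤ C * (A ^ 4 / s ^ 4) := by
  choose Y' hY'0 hY' using fun β : Fin 4 => exists_decay (N := N) (K := Sum.inl β :: K')
    (by simp only [List.length_cons]; omega)
  let Y := ∑ β, Y' β
  have hY0 : 0 ≤ Y := Finset.sum_nonneg fun β _ => hY'0 β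
  have hYle : ∀ β, Y' β ≤ Y := fun β =>
    Finset.single_le_sum (fun β _ => hY'0 β) (Finset.mem_univ β)
  let H : ℝ → (Spacetime → ℝ) → Fin 4 ⊕ Fin 3 → Spacetime → ℝ := fun s u =>
    Sum.elim (fun γ => weighted (s ^ 3) 2 (word (Sum.inl γ :: K) u))
      fun a => weighted s 1 (boost a (word K u))
  have hC : ∀ i, ∃ C : ℝ, ∀ (s₁ s A : ℝ) (U : Set Spacetime) (u : Spacetime → ℝ),
      EnergyBound N s₁ s A U u → hypSq s (H s u i) ≤ C * A ^ 2 := by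
    rintro (γ | a)
    · exact exists_hypSq_word_le (by simp only [List.length_cons]; omega) (by simp)
    · exact exists_hypSq_boost_word_le hK a
  choose C hC using hC
  let n : ℝ := Fintype.card (Fin 4 ⊕ Fin 3)
  refine ⟨(5 * cubicNorm Q * Y) ^ 2 * n * ∑ i, C i, fun s₁ s A U u h => ?_⟩
  have hs := h.pos
  have hA := h.nonneg
  have hg : Reg s₁ U 2 (word K' u) := Reg.word h.nhd K' (h.reg.of_le (by omega))
  have hf : Reg s₁ U 1 (word K u) := Reg.word h.nhd K (h.reg.of_le (by omega))
  have hH : ∀ i, Reg s₁ U 0 (H s u i) := by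
    rintro (γ | a)
    · exact Reg.weighted h.nhd _ _ (Reg.partialD h.nhd γ hf)
    · exact Reg.weighted h.nhd _ _ (Reg.derivation h.nhd (Sum.inr a) hf)
  have key := hypSq_le_of_abs_le h.nhd h.mem
    ((Reg.quasiOp h.nhd Q hf hg).const_mul s) hH
    (5 * cubicNorm Q * (Y * A / s ^ 2)) (by
      intro x hx
      have ht := hypPoint_fst_pos hs x
      have hcd : ContDiffAt ℝ 2 (word K' u) (hypPoint s x) :=
        hg.contDiffOn.contDiffAt (h.nhd.isOpen.mem_nhds
          (h.nhd.slab_subset (hypPoint_mem_slab h.mem hx)))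
      have hm₂ : ∀ α β, |partialD α (partialD β (word K' u)) (hypPoint s x)| ≤ Y * A / s ^ 2 :=
        fun α β => ((hY' β s₁ s A U u h x hx).1 α).trans (by gcongr; exact hYle β)
      have hl₂ : ∀ a β, |boost a (partialD β (word K' u)) (hypPoint s x)| ≤
          Y * A / (hypPoint s x).1 :=
        fun a β => ((hY' β s₁ s A U u h x hx).2 a).trans (by gcongr; exact hYle β)
      have hq := abs_quasiOp_hypPoint_le hQ hs hcd
        (m₁ := ∑ γ, |partialD γ (word K u) (hypPoint s x)|)
        (l₁ := ∑ a, |boost a (word K u) (hypPoint s x)|)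
        (fun γ => abs_le_sum_abs (fun γ => partialD γ (word K u) (hypPoint s x)) γ)
        (fun a => abs_le_sum_abs (fun a => boost a (word K u) (hypPoint s x)) a) hm₂ hl₂
      have e : ∑ i, |H s u i (hypPoint s x)| =
          s ^ 3 * ((hypPoint s x).1 ^ 2)⁻¹ * (∑ γ, |partialD γ (word K u) (hypPoint s x)|) +
          s * ((hypPoint s x).1 ^ 1)⁻¹ * ∑ a, |boost a (word K u) (hypPoint s x)| := by
        rw [Fintype.sum_sum_type, Finset.mul_sum, Finset.mul_sum]
        congr 1
        · refine Finset.sum_congr rfl fun i _ => ?_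
          simp only [H, Sum.elim_inl, weighted, word_cons, derivation_inl, abs_mul]
          rw [abs_of_pos (by positivity : 0 < s ^ 3),
            abs_of_pos (by positivity : 0 < ((hypPoint s x).1 ^ 2)⁻¹)]
        · refine Finset.sum_congr rfl fun i _ => ?_
          simp only [H, Sum.elim_inr, weighted, abs_mul]
          rw [abs_of_pos hs, abs_of_pos (by positivity : 0 < ((hypPoint s x).1 ^ 1)⁻¹)]
      rw [e, abs_mul, abs_of_pos hs]
      set m₁ := ∑ γ, |partialD γ (word K u) (hypPoint s x)|
      set l₁ := ∑ a, |boost a (word K u) (hypPoint s x)|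
      have hl₁ : 0 ≤ l₁ := Finset.sum_nonneg fun _ _ => abs_nonneg _
      set t := (hypPoint s x).1
      have hn := cubicNorm_nonneg Q
      -- the powers of `t` cancel against the weights, leaving the factor `s⁻²` in every term
      have hextra : 0 ≤ 4 * cubicNorm Q * (Y * A / s ^ 2) * (s * (t ^ 1)⁻¹ * l₁) := by positivity
      calc _ ≤ s * (cubicNorm Q * (3 * (s ^ 2 / t ^ 2) * (m₁ * (Y * A / s ^ 2)) +
              l₁ / t * (Y * A / s ^ 2) + 2 * (m₁ * (Y * A / t / t)))) :=
            mul_le_mul_of_nonneg_left hq hs.le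
        _ = 5 * cubicNorm Q * (Y * A / s ^ 2) * (s ^ 3 * (t ^ 2)⁻¹ * m₁) +
              cubicNorm Q * (Y * A / s ^ 2) * (s * (t ^ 1)⁻¹ * l₁) := by
            field_simp
            ring
        _ ≤ _ := by linarith)
  refine key.trans ?_
  have hsum := Finset.sum_le_sum fun i (_ : i ∈ Finset.univ) => hC i s₁ s A U u h
  rw [← Finset.sum_mul] at hsum
  calc _ ≤ (5 * cubicNorm Q * (Y * A / s ^ 2)) ^ 2 * n * ((∑ i, C i) * A ^ 2) :=
        mul_le_mul_of_nonneg_left hsum (by positivity)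
    _ = _ := by field_simp

/-- Every element of the commutator span satisfies the quadratic estimate: of two words of total
order at most `N`, at least one is short enough for the pointwise decay estimates. -/
lemma exists_hypSq_commSpan_le {N : ℕ} (hN : 6 ≤ N) {T : (Spacetime → ℝ) → Spacetime → ℝ}
    {n : ℕ} (hn : n ≤ N) (hT : T ∈ commSpan n) :
    ∃ C : ℝ, ∀ (s₁ s A : ℝ) (U : Set Spacetime) (u : Spacetime → ℝ), EnergyBound N s₁ s A U u →
      hypSq s (fun p => s * T u p) ≤ C * (A ^ 4 / s ^ 4) :=
  exists_hypSq_le_of_mem_span (N := N) (B := fun s A => A ^ 4 / s ^ 4) (Φ := fun s f p => s * f p)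
    (fun s s₁ U f _ hf => (hf.of_le zero_le_one).const_mul s)
    (fun s s₁ U f g _ _ _ p _ => mul_add _ _ _)
    (fun s s₁ c U f _ _ p _ => mul_left_comm _ _ _)
    (by
      rintro _ ⟨Q, K, K', -, h, h', rfl⟩ s₁ U u hU hu
      exact Reg.quasiOp hU Q (Reg.word hU K (hu.of_le (by omega)))
        (Reg.word hU K' (hu.of_le (by omega))))
    (by
      rintro _ ⟨Q, K, K', hQ, h, h', rfl⟩
      rcases le_or_gt (K.length + 3) N with hK | hK
      · exact exists_hypSq_quasiOp_le_of_left hQ hK (by omega)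
      · exact exists_hypSq_quasiOp_le_of_right hQ (by omega) (by omega)) hT

lemma confEnergy_le_energySum {N : ℕ} (s : ℝ) (u : Spacetime → ℝ) {I : List (Fin 4)}
    {J : List (Fin 3)} (h : I.length + J.length ≤ N) :
    confEnergy s (opIJ I J u) ^ (1 / 2 : ℝ) ≤ energySum N s u := by
  have h1 : confEnergy s (opIJ I J u) ^ (1 / 2 : ℝ) ≤
      ∑ J' : Fin J.length → Fin 3, confEnergy s (opIJ I (List.ofFn J') u) ^ (1 / 2 : ℝ) := by
    have := Finset.single_le_sum (f := fun J' : Fin J.length → Fin 3 =>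
      confEnergy s (opIJ I (List.ofFn J') u) ^ (1 / 2 : ℝ)) (fun _ _ => zero_le)
      (Finset.mem_univ J.get)
    simpa only [List.ofFn_get] using this
  have h2 := Finset.single_le_sum (f := fun I' : Fin I.length → Fin 4 =>
      ∑ J' : Fin J.length → Fin 3,
        confEnergy s (opIJ (List.ofFn I') (List.ofFn J') u) ^ (1 / 2 : ℝ)) (fun _ _ => zero_le)
      (Finset.mem_univ I.get)
  simp only [List.ofFn_get] at h2
  have h3 := Finset.single_le_sum (f := fun l => ∑ I' : Fin I.length → Fin 4,
      ∑ J' : Fin l → Fin 3,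
        confEnergy s (opIJ (List.ofFn I') (List.ofFn J') u) ^ (1 / 2 : ℝ)) (fun _ _ => zero_le)
      (Finset.mem_range.mpr (by omega : J.length < N + 1 - I.length))
  have h4 := Finset.single_le_sum (f := fun k => ∑ l ∈ Finset.range (N + 1 - k),
      ∑ I' : Fin k → Fin 4, ∑ J' : Fin l → Fin 3,
        confEnergy s (opIJ (List.ofFn I') (List.ofFn J') u) ^ (1 / 2 : ℝ)) (fun _ _ => zero_le)
      (Finset.mem_range.mpr (by omega : I.length < N + 1))
  exact h1.trans (h2.trans (h3.trans h4))

/-- A solution that is regular on the slab is regular on a neighbourhood of it inside the cone. -/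
lemma exists_energyBound {N : ℕ} {Q : Fin 4 → Fin 4 → Fin 4 → ℝ} {s₁ A : ℝ} {u : Spacetime → ℝ}
    (hs₁ : 2 < s₁) (hA : 0 ≤ A) (hu : IsSolutionOnSlab Q (N + 2) 2 s₁ u)
    (hE : ∀ s ∈ Set.Icc 2 s₁, energySum N s u ≤ ENNReal.ofReal A) {s : ℝ}
    (hs : s ∈ Set.Icc 2 s₁) : ∃ U, EnergyBound N s₁ s A U u := by
  let V : Set Spacetime := {p | ContDiffAt ℝ (N + 2 : ℕ) u p}
  have hV : IsOpen V := isOpen_iff_mem_nhds.mpr fun p (hp : ContDiffAt ℝ (N + 2 : ℕ) u p) =>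
    hp.eventually (WithTop.coe_injective.ne (ENat.natCast_ne_top (N + 2)))
  refine ⟨coneK ∩ V, ⟨hs₁, isOpen_coneK.inter hV, fun p hp => ⟨hp.1, hu.regular p hp⟩,
    Set.inter_subset_left⟩, hs,
    ⟨fun p hp => ContDiffAt.contDiffWithinAt (show p ∈ V from hp.2), hu.vanishes⟩, hA,
    fun I J h => (confEnergy_le_energySum s u h).trans (hE s hs)⟩

lemma hypL2Norm_eq {s s₁ : ℝ} {U : Set Spacetime} (hN : SlabNhd s₁ U) (hs : s ∈ Set.Icc 2 s₁)
    {f : Spacetime → ℝ} (hf : Reg s₁ U 0 f) : hypL2Norm s f = ENNReal.ofReal (√(hypSq s f)) := by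
  have e : ∀ x : Space, ‖f (hypPoint s x)‖ₑ ^ (2 : ℝ) = ENNReal.ofReal (f (hypPoint s x) ^ 2) := by
    intro x
    rw [Real.enorm_eq_ofReal_abs, ENNReal.ofReal_rpow_of_nonneg (abs_nonneg _) (by norm_num),
      Real.rpow_two, sq_abs]
  rw [hypL2Norm, eLpNorm_eq_lintegral_rpow_enorm_toReal (by norm_num) (by norm_num)]
  simp only [ENNReal.toReal_ofNat, e]
  rw [← ofReal_integral_eq_lintegral_ofReal (integrableOn_sq hN hs hf)
    (Eventually.of_forall fun _ => sq_nonneg _),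
    ENNReal.ofReal_rpow_of_nonneg (integral_nonneg fun _ => sq_nonneg _) (by norm_num),
    ← Real.sqrt_eq_rpow]
  rfl

/-- The commutator estimate for a fixed operator `∂^I L^J`. -/
lemma exists_hypL2Norm_commutator_le {N : ℕ} (hN : 6 ≤ N) {Q : Fin 4 → Fin 4 → Fin 4 → ℝ}
    (hQ : IsNullCubic Q) {I : List (Fin 4)} {J : List (Fin 3)} (hIJ : I.length + J.length ≤ N) :
    ∃ C : ℝ, ∀ (s₁ s A : ℝ) (U : Set Spacetime) (u : Spacetime → ℝ), EnergyBound N s₁ s A U u →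
      hypL2Norm s (fun p => hypTime p * quasiCommutator Q I J u p) ≤
        ENNReal.ofReal (C * A ^ 2 * s ^ (-2 : ℤ)) := by
  let K : List (Fin 4 ⊕ Fin 3) := I.map Sum.inl ++ J.map Sum.inr
  have hK : K.length ≤ N := by simpa [K] using hIJ
  obtain ⟨T, hT, e⟩ := exists_word_quasiOp K hQ
  obtain ⟨C, hC⟩ := exists_hypSq_commSpan_le hN hK hT
  refine ⟨√|C|, fun s₁ s A U u h => ?_⟩
  have hs := h.pos
  have hq : Reg s₁ U 0 (fun p => s * quasiCommutator Q I J u p) := by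
    have h1 : Reg s₁ U N (quasiOp Q u u) := Reg.quasiOp h.nhd Q (h.reg.of_le (by omega)) h.reg
    have h2 : Reg s₁ U 0 (opIJ I J (quasiOp Q u u)) :=
      Reg.opIJ h.nhd hIJ (h1.of_le (by omega))
    have h3 : Reg s₁ U 2 (opIJ I J u) := Reg.opIJ h.nhd hIJ (h.reg.of_le (by omega))
    have h4 : Reg s₁ U 0 (quasiOp Q u (opIJ I J u)) :=
      Reg.quasiOp h.nhd Q (h.reg.of_le (by omega)) h3
    refine Reg.const_mul s (Reg.congr h.nhd (h2.add (h4.const_mul (-1))) fun p _ => ?_)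
    simp only [quasiCommutator]; ring
  have e1 : hypL2Norm s (fun p => hypTime p * quasiCommutator Q I J u p) =
      hypL2Norm s (fun p => s * quasiCommutator Q I J u p) := by
    simp only [hypL2Norm, hypTime_hypPoint hs.le]
  have e2 : hypSq s (fun p => s * quasiCommutator Q I J u p) = hypSq s (fun p => s * T u p) := by
    refine hypSq_congr h.nhd h.mem fun p hp => ?_
    have := e s₁ U u h.nhd (h.reg.of_le (by omega)) hp
    simp only [quasiCommutator, opIJ_eq_word]
    rw [this]
    ring
  rw [e1, hypL2Norm_eq h.nhd h.mem hq, e2]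
  refine ENNReal.ofReal_le_ofReal (Real.sqrt_le_iff.mpr ⟨by positivity, ?_⟩)
  calc _ ≤ C * (A ^ 4 / s ^ 4) := hC s₁ s A U u h
    _ ≤ |C| * (A ^ 4 / s ^ 4) := mul_le_mul_of_nonneg_right (le_abs_self C) (by positivity)
    _ = (√|C|) ^ 2 * (A ^ 4 / s ^ 4) := by rw [Real.sq_sqrt (abs_nonneg C)]
    _ = _ := by
      rw [zpow_neg]
      norm_cast
      field_simp

end HypWave

theorem mainTheorem10 (N : ℕ) (hN : 9 ≤ N) (Q : Fin 4 → Fin 4 → Fin 4 → ℝ)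
    (hQ : HypWave.IsNullCubic Q) (M : ℝ) (hM : 0 < M) :
    ∃ C : ℝ, 0 < C ∧
      ∀ (C₁ ε s₁ : ℝ) (u : HypWave.Spacetime → ℝ), 0 < C₁ → 0 < ε → C₁ * ε ≤ M → 2 < s₁ →
        HypWave.IsSolutionOnSlab Q (N + 2) 2 s₁ u →
        (∀ s ∈ Set.Icc 2 s₁, HypWave.energySum N s u ≤ ENNReal.ofReal (C₁ * ε)) →
        ∀ (I : List (Fin 4)) (J : List (Fin 3)), I.length + J.length ≤ N →
          ∀ s ∈ Set.Icc 2 s₁,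
            HypWave.hypL2Norm s (fun p => HypWave.hypTime p * HypWave.quasiCommutator Q I J u p) ≤
              ENNReal.ofReal (C * (C₁ * ε) ^ 2 * s ^ (-2 : ℤ)) := by
  -- one constant serves all of the finitely many pairs `(I, J)`
  have hfin : {q : List (Fin 4) × List (Fin 3) | q.1.length + q.2.length ≤ N}.Finite :=
    ((List.finite_length_le (Fin 4) N).prod (List.finite_length_le (Fin 3) N)).subset
      fun q (hq : q.1.length + q.2.length ≤ N) =>
        ⟨(by omega : q.1.length ≤ N), (by omega : q.2.length ≤ N)⟩
  have h : ∀ q : List (Fin 4) × List (Fin 3), ∃ C : ℝ, q.1.length + q.2.length ≤ N →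
      ∀ (s₁ s A : ℝ) (U : Set HypWave.Spacetime) (u : HypWave.Spacetime → ℝ),
        HypWave.EnergyBound N s₁ s A U u →
          HypWave.hypL2Norm s
              (fun p => HypWave.hypTime p * HypWave.quasiCommutator Q q.1 q.2 u p) ≤
            ENNReal.ofReal (C * A ^ 2 * s ^ (-2 : ℤ)) := by
    intro q
    by_cases hq : q.1.length + q.2.length ≤ N
    · obtain ⟨C, hC⟩ := HypWave.exists_hypL2Norm_commutator_le (by omega) hQ hq
      exact ⟨C, fun _ => hC⟩
    · exact ⟨0, fun h => absurd h hq⟩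
  choose C hC using h
  obtain ⟨D, hD⟩ := (hfin.image C).bddAbove
  refine ⟨max D 1, by positivity, fun C₁ ε s₁ u hC₁ hε _ hs₁ hu hE I J hIJ s hs => ?_⟩
  obtain ⟨U, hU⟩ := HypWave.exists_energyBound hs₁ (mul_pos hC₁ hε).le hu hE hs
  refine (hC (I, J) hIJ s₁ s _ U u hU).trans (ENNReal.ofReal_le_ofReal ?_)
  have hle : C (I, J) ≤ max D 1 := (hD ⟨(I, J), hIJ, rfl⟩).trans (le_max_left _ _)
  have hs0 : 0 < s := hU.pos
  gcongr
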